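/- **Setting.** Let $n\ge 0$, $d\ge 1$, let $U\subset\mathbb R^n$ be open, and consider $u_t+\sum_{j=1}^d f^j(u)_{x_j}=\Delta_x u$, $u\in U$, $x\in\mathbb R^d$, with a stationary $X$-periodic wave $u=\bar u(x_1)\in U$, $X>0$, solving $\bar u'=f^1(\bar u)-\bar q$ for a constant $\bar q\in\mathbb R^n$. Put $A^j:=Df^j(\bar u)$. For $\xi\in\mathbb R^d$ let $L_\xi$ be the operator on $L^2([0,X];\mathbb C^n)$ with domain the $X$-periodic functions in $H^2$, $$L_\xi v=(\partial_x+i\xi_1)^2v-(\partial_x+i\xi_1)(A^1v)-i\sum_{j\ne1}\xi_jA^jv-\sum_{j\neq 1}\xi_j^2v ,$$ and write $L_{r\omega}=L_0+rL^1_\omega-r^2$ for $|\omega|=1$, i.e. $L^1_\omega=i\big(\omega_1(2\partial_x-A^1)-\sum_{j\ne1}\omega_jA^j\big)$. Assume: * (H1) $f^j\in C^{K+1}(U)$ with $K\ge\lfloor d/2\rfloor+4$. * (H2) With $u(\cdot\,;a,s,\nu,q)$ the solution of $u'=\sum_j\nu_jf^j(u)-su-q$, $u(0)=a$, the map $(T;a,s,\nu,q)\mapsto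 u(T;a,s,\nu,q)-a$ on $\mathbb R\times U\times\mathbb R\times S^{d-1}\times\mathbb R^n$ is a submersion at $(X;\bar u(0),0,e_1,\bar q)$. * (D1) $\sigma(L_\xi)\subset\{\operatorname{Re}\lambda<0\}$ for all $\xi\neq0$ with $|\xi_1|\le\pi/X$. * (D2) There is $\theta>0$ such that $\operatorname{Re}\sigma(L_\xi)\le-\theta|\xi|^2$ for all sufficiently small $\xi$. * (D3) $0$ is a semisimple eigenvalue of $L_0$ of multiplicity exactly $n+1$: $L^2=\ker L_0\oplus\operatorname{ran}L_0$ and $\dim\ker L_0=n+1$. Let $\Pi_0$ be the projection onto $\ker L_0$ along $\operatorname{ran}L_0$. * (H3) For every $\omega\in S^{d-1}$ the eigenvalues of $\Pi_0L^1_\omega|_{\ker L_0}$ are simple. **Eigensystems.** For $\varepsilon,\delta>0$, an *eigensystem* on $S^{d-1}\times[0,\varepsilon)$ consists of functions $\lambda_j(\omega,r)\in\mathbb C$ and $q_j(\omega,r),\tilde q_j(\omega,r)\in L^2([0,X];\mathbb C^n)$, $1\le j\le n+1$, such that: $\lambda_j=r\mu_j$ with $\mu_j$ of class $C^\infty$ on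 $S^{d-1}\times[0,\varepsilon)$, and $q_j,\tilde q_j$ are $C^\infty$ maps from $S^{d-1}\times[0,\varepsilon)$ to $L^2$; $q_j(\omega,r)$ and $\tilde q_j(\omega,r)$ are right and left eigenfunctions of $L_{r\omega}$ for $\lambda_j(\omega,r)$, that is $L_{r\omega}q_j=\lambda_jq_j$ and $L_{r\omega}^*\tilde q_j=\bar\lambda_j\tilde q_j$, normalized by $\langle\tilde q_j,q_j\rangle=1$ (inner product conjugate linear in the first argument); and for $0<r<\varepsilon$ the numbers $\lambda_1(\omega,r),\dots,\lambda_{n+1}(\omega,r)$ are distinct and are exactly the points of $\sigma(L_{r\omega})$ in $\{|\lambda|<\delta\}$. Call it *adapted* if for every $\omega\in S^{d-1}$ we have $q_1(\omega,0)=\bar u'$ and, for each $j\ne1$, $\tilde q_j(\omega,0)$ is a constant function of $x$ (a vector in $\mathbb C^n$ that depends only on $j$ and $\omega$). **Lemma.** Under (H1)–(H3) and (D1)–(D3): 1. For some $\varepsilon,\delta>0$ there is an adapted eigensystem. 2. Every eigensystem (for any $\varepsilon,\delta>0$) becomes an adapted eigensystem, with the same $\varepsilon,\delta$, after a relabelling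 of the indices $j$ (for each angle $\omega$, independently of $r$) and a rescaling $q_j\mapsto c_jq_j$, $\tilde q_j\mapsto\bar c_j^{\,-1}\tilde q_j$ by nonvanishing scalars $c_j(\omega,r)$. -/

import Mathlib

open MeasureTheory

noncomputable section

namespace Bloch

/-- `ℂⁿ` with its Hermitian norm. -/
abbrev CVec (n : ℕ) : Type := EuclideanSpace ℂ (Fin n)

/-- `ℝⁿ` with its Euclidean norm. -/
abbrev RVec (n : ℕ) : Type := EuclideanSpace ℝ (Fin n)

/-- `L²` of one period: square integrable `X`-periodic functions with values in `ℂⁿ`. The inner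
product is `⟪v, w⟫ = ∫₀^X v(x)* w(x) dx`, conjugate linear in the first argument. -/
abbrev L2Per (n : ℕ) (X : ℝ) [Fact (0 < X)] : Type :=
  Lp (CVec n) 2 (volume : Measure (AddCircle X))

section WeakDerivative

variable {n : ℕ} {X : ℝ} [Fact (0 < X)]

/-- `v` is the weak derivative of `u` on the circle of length `X`. -/
def IsWeakDeriv (u v : L2Per n X) : Prop :=
  ∀ φ : ℝ → ℂ, ContDiff ℝ (⊤ : ℕ∞) φ → Function.Periodic φ X →
    ∫ x in (0 : ℝ)..X, deriv φ x • u (x : AddCircle X) =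
      -∫ x in (0 : ℝ)..X, φ x • v (x : AddCircle X)

theorem intervalIntegrable_coe (u : L2Per n X) :
    IntervalIntegrable (fun x : ℝ => u (x : AddCircle X)) volume 0 X := by
  have hu : Integrable (u : AddCircle X → CVec n) volume :=
    (Lp.memLp u).integrable (by norm_num)
  have h := (AddCircle.measurePreserving_mk X 0).integrable_comp_of_integrable hu
  rw [zero_add] at h
  rw [intervalIntegrable_iff_integrableOn_Ioc_of_le (Fact.out : 0 < X).le]
  exact h

theorem intervalIntegrable_smul (u : L2Per n X) {φ : ℝ → ℂ} (hφ : Continuous φ) :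
    IntervalIntegrable (fun x : ℝ => φ x • u (x : AddCircle X)) volume 0 X :=
  (intervalIntegrable_coe u).continuousOn_smul hφ.continuousOn

theorem ae_coe {P : AddCircle X → Prop} (h : ∀ᵐ y : AddCircle X, P y) :
    ∀ᵐ x : ℝ, x ∈ Set.uIoc 0 X → P (x : AddCircle X) := by
  have hq := (AddCircle.measurePreserving_mk X 0).quasiMeasurePreserving.ae h
  rw [zero_add, ae_restrict_iff' measurableSet_Ioc] at hq
  rwa [Set.uIoc_of_le (Fact.out : 0 < X).le]

theorem integral_smul_add (u v : L2Per n X) {φ : ℝ → ℂ} (hφ : Continuous φ) :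
    ∫ x in (0 : ℝ)..X, φ x • (u + v : L2Per n X) (x : AddCircle X) =
      (∫ x in (0 : ℝ)..X, φ x • u (x : AddCircle X)) +
        ∫ x in (0 : ℝ)..X, φ x • v (x : AddCircle X) := by
  rw [← intervalIntegral.integral_add (intervalIntegrable_smul u hφ)
    (intervalIntegrable_smul v hφ)]
  apply intervalIntegral.integral_congr_ae
  filter_upwards [ae_coe (Lp.coeFn_add u v)] with x hx hxI
  rw [hx hxI, Pi.add_apply, smul_add]

theorem integral_smul_smul (c : ℂ) (u : L2Per n X) (φ : ℝ → ℂ) :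
    ∫ x in (0 : ℝ)..X, φ x • (c • u : L2Per n X) (x : AddCircle X) =
      c • ∫ x in (0 : ℝ)..X, φ x • u (x : AddCircle X) := by
  rw [← intervalIntegral.integral_smul]
  apply intervalIntegral.integral_congr_ae
  filter_upwards [ae_coe (Lp.coeFn_smul c u)] with x hx hxI
  rw [hx hxI, Pi.smul_apply, smul_comm]

/-- The pairs `(u, u_x)`, `u` in the periodic Sobolev space `H¹`. -/
def weakDerivGraph (n : ℕ) (X : ℝ) [Fact (0 < X)] :
    Submodule ℂ (L2Per n X × L2Per n X) where
  carrier := {p | IsWeakDeriv p.1 p.2}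
  zero_mem' := by
    intro φ hφ _
    have h (ψ : ℝ → ℂ) :
        ∫ x in (0 : ℝ)..X, ψ x • (0 : L2Per n X) (x : AddCircle X) = 0 := by
      simpa only [zero_smul] using integral_smul_smul (0 : ℂ) (0 : L2Per n X) ψ
    simp only [Prod.fst_zero, Prod.snd_zero, h, neg_zero]
  add_mem' := by
    intro p q hp hq φ hφ hper
    have hd : Continuous (deriv φ) := hφ.continuous_deriv (by simp)
    simp only [Prod.fst_add, Prod.snd_add]
    rw [integral_smul_add _ _ hd, integral_smul_add _ _ hφ.continuous, hp φ hφ hper,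
      hq φ hφ hper, neg_add]
  smul_mem' := by
    intro c p hp φ hφ hper
    simp only [Prod.smul_fst, Prod.smul_snd]
    rw [integral_smul_smul, integral_smul_smul, hp φ hφ hper, smul_neg]

theorem eq_zero_of_forall_test (v : L2Per n X)
    (h : ∀ φ : ℝ → ℂ, ContDiff ℝ (⊤ : ℕ∞) φ → Function.Periodic φ X →
      ∫ x in (0 : ℝ)..X, φ x • v (x : AddCircle X) = 0) : v = 0 := by
  have hX : 0 < X := Fact.out
  have hcomp (i : Fin n) : ∀ᵐ y : AddCircle X, (v y) i = 0 := by
    have hm : MemLp (fun y : AddCircle X => (v y) i) 2 AddCircle.haarAddCircle := by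
      have h1 : MemLp (fun y : AddCircle X => (v y) i) 2 volume :=
        (EuclideanSpace.proj (𝕜 := ℂ) i).comp_memLp' (Lp.memLp v)
      have h2 := AddCircle.volume_eq_smul_haarAddCircle (T := X)
      refine MemLp.of_measure_le_smul (c := (ENNReal.ofReal X)⁻¹) ?_ ?_ h1
      · simp [hX]
      · rw [h2, smul_smul, ENNReal.inv_mul_cancel (by simp [hX]) (by simp), one_smul]
    have hz : hm.toLp _ = 0 := by
      apply fourierBasis.repr.injective
      ext k
      rw [fourierBasis_repr, fourierCoeff_congr_ae hm.coeFn_toLp,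
        fourierCoeff_eq_intervalIntegral _ k 0, zero_add]
      have hk := h (fun x => fourier (-k) (x : AddCircle X)) ?_ ?_
      · have hk' := congrArg (EuclideanSpace.proj (𝕜 := ℂ) i) hk
        rw [← ContinuousLinearMap.intervalIntegral_comp_comm _
          (intervalIntegrable_smul v (by fun_prop))] at hk'
        simp only [map_smul, map_zero] at hk'
        rw [map_zero]
        exact (congrArg ((1 / X : ℝ) • ·) hk').trans (smul_zero _)
      · simp only [fourier_coe_apply]
        have h1 : ContDiff ℝ (⊤ : ℕ∞) fun x : ℝ => (x : ℂ) := Complex.ofRealCLM.contDiff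
        fun_prop
      · intro x
        simp
    have hv := hm.coeFn_toLp
    rw [hz] at hv
    have h0 : ∀ᵐ y ∂(AddCircle.haarAddCircle : Measure (AddCircle X)), (v y) i = 0 := by
      filter_upwards [hv, Lp.coeFn_zero ℂ 2 (AddCircle.haarAddCircle : Measure (AddCircle X))]
        with y h1 h2
      rw [← h1, h2, Pi.zero_apply]
    have h2 := Measure.ae_smul_measure h0 (ENNReal.ofReal X)
    rwa [← AddCircle.volume_eq_smul_haarAddCircle] at h2
  rw [Lp.eq_zero_iff_ae_eq_zero]
  filter_upwards [ae_all_iff.2 hcomp] with y hy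
  ext i
  exact hy i

/-- Weak derivatives are unique. -/
theorem weakDerivGraph_single_valued (p : L2Per n X × L2Per n X)
    (hp : p ∈ weakDerivGraph n X) (h0 : p.1 = 0) : p.2 = 0 := by
  refine eq_zero_of_forall_test _ fun φ hφ hper => ?_
  have h := hp φ hφ hper
  have h1 : ∫ x in (0 : ℝ)..X, deriv φ x • (0 : L2Per n X) (x : AddCircle X) = 0 := by
    simpa only [zero_smul] using integral_smul_smul (0 : ℂ) (0 : L2Per n X) (deriv φ)
  rw [h0, h1] at h
  exact neg_eq_zero.1 h.symm

/-- The weak derivative `∂ₓ` as an operator in `L²`; its domain is the periodic space `H¹`. -/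
def weakDeriv (n : ℕ) (X : ℝ) [Fact (0 < X)] : L2Per n X →ₗ.[ℂ] L2Per n X :=
  (weakDerivGraph n X).toLinearPMap

theorem memLp_mul (B : C(AddCircle X, CVec n →L[ℂ] CVec n)) (u : L2Per n X) :
    MemLp (fun x => B x (u x)) 2 (volume : Measure (AddCircle X)) := by
  refine MemLp.of_le_mul (c := ‖B‖) (Lp.memLp u) ?_ ?_
  · exact (ContinuousLinearMap.apply ℂ (CVec n)).flip.aestronglyMeasurable_comp₂
      B.continuous.aestronglyMeasurable (Lp.aestronglyMeasurable u)
  · filter_upwards with x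
    exact (ContinuousLinearMap.le_opNorm _ _).trans
      (mul_le_mul_of_nonneg_right (B.norm_coe_le_norm x) (norm_nonneg _))

/-- Multiplication by a continuous periodic matrix-valued function. -/
def mulOp (B : C(AddCircle X, CVec n →L[ℂ] CVec n)) : L2Per n X →ₗ[ℂ] L2Per n X where
  toFun u := (memLp_mul B u).toLp
  map_add' u v := by
    rw [← MemLp.toLp_add]
    apply MemLp.toLp_congr
    filter_upwards [Lp.coeFn_add u v] with x hx
    simp only [Pi.add_apply, hx, map_add]
  map_smul' c u := by
    rw [RingHom.id_apply, ← MemLp.toLp_const_smul]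
    apply MemLp.toLp_congr
    filter_upwards [Lp.coeFn_smul c u] with x hx
    simp only [Pi.smul_apply, hx, map_smul]

end WeakDerivative

/-- A system of viscous conservation laws `u_t + ∑ⱼ fʲ(u)_{xⱼ} = Δu` in `d` space dimensions for
`u ∈ U ⊆ ℝⁿ`, with fluxes `fʲ` of class `C^{K+1}`, `K ≥ [d/2] + 4`, and a stationary periodic wave
`u = ū(x₁)` of period `X`, that is, a solution of the integrated profile equation
`ū' = f¹(ū) - q̄` (direction `ν = e₁`, speed `s = 0`). The coordinate `x₁` has index `0`. -/
structure PeriodicWave (n d : ℕ) [NeZero d] where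
  U : Set (RVec n)
  isOpen_U : IsOpen U
  K : ℕ
  le_K : d / 2 + 4 ≤ K
  f : Fin d → RVec n → RVec n
  contDiffOn_f : ∀ j, ContDiffOn ℝ ((K + 1 : ℕ) : WithTop ℕ∞) (f j) U
  X : ℝ
  X_pos : 0 < X
  ubar : ℝ → RVec n
  ubar_mem : ∀ x, ubar x ∈ U
  periodic_ubar : Function.Periodic ubar X
  qbar : RVec n
  profile : ∀ x, HasDerivAt ubar (f 0 (ubar x) - qbar) x

namespace PeriodicWave

variable {n d : ℕ} [NeZero d] (W : PeriodicWave n d)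

instance fact_X_pos : Fact (0 < W.X) := ⟨W.X_pos⟩

/-- `u` solves `u' = ∑ⱼ νⱼ fʲ(u) - s u - q` on `[0, T]` with `u(0) = a`, taking values in `U`. -/
def IsProfileSolution (T : ℝ) (a : RVec n) (s : ℝ) (ν : RVec d) (q : RVec n)
    (u : ℝ → RVec n) : Prop :=
  u 0 = a ∧ ∀ x ∈ Set.Icc 0 T, u x ∈ W.U ∧
    HasDerivWithinAt u ((∑ j, ν j • W.f j (u x)) - s • u x - q) (Set.Icc 0 T) x

open Classical in
/-- The solution operator `u(T; a, s, ν, q)` of the profile equation (by convention `0` when the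
solution does not exist up to `T`). -/
def profileFlow (T : ℝ) (a : RVec n) (s : ℝ) (ν : RVec d) (q : RVec n) : RVec n :=
  if h : ∃ u, W.IsProfileSolution T a s ν q u then h.choose T else 0

/-- `H : (T, a, s, ν, q) ↦ u(T; a, s, ν, q) - a`, written for all `ν ∈ ℝᵈ`. -/
def returnMap (p : ℝ × RVec n × ℝ × RVec d × RVec n) : RVec n :=
  W.profileFlow p.1 p.2.1 p.2.2.1 p.2.2.2.1 p.2.2.2.2 - p.2.1

/-- (H2): `H`, with `ν` restricted to the unit sphere `S^{d-1}`, is a submersion at the point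
`(X, ū(0), 0, e₁, q̄)`. The tangent space of the sphere at `e₁` is `{ν | ν₁ = 0}`. -/
def H2 : Prop :=
  ∃ H' : (ℝ × RVec n × ℝ × RVec d × RVec n) →L[ℝ] RVec n,
    HasFDerivAt W.returnMap H' (W.X, W.ubar 0, 0, EuclideanSpace.single 0 1, W.qbar) ∧
    ∀ y : RVec n, ∃ (T : ℝ) (a : RVec n) (s : ℝ) (ν : RVec d) (q : RVec n),
      ν 0 = 0 ∧ H' (T, a, s, ν, q) = y

/-- `Dfʲ(u)` acting on `ℂⁿ`. -/
def jacobian (j : Fin d) (u : RVec n) : CVec n →L[ℂ] CVec n :=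
  Matrix.toEuclideanCLM (𝕜 := ℂ)
    (Matrix.of fun a b => ((fderiv ℝ (W.f j) u (EuclideanSpace.single b 1) a : ℝ) : ℂ))

theorem continuous_jacobian (j : Fin d) : Continuous fun x => W.jacobian j (W.ubar x) := by
  have hu : Continuous W.ubar :=
    continuous_iff_continuousAt.2 fun x => (W.profile x).continuousAt
  have hD : ContinuousOn (fderiv ℝ (W.f j)) W.U :=
    (W.contDiffOn_f j).continuousOn_fderiv_of_isOpen W.isOpen_U (by simp)
  have hc : Continuous fun x => fderiv ℝ (W.f j) (W.ubar x) :=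
    hD.comp_continuous hu W.ubar_mem
  have hL : Continuous
      (Matrix.toEuclideanCLM (𝕜 := ℂ) : Matrix (Fin n) (Fin n) ℂ → (CVec n →L[ℂ] CVec n)) :=
    LinearMap.continuous_of_finiteDimensional
      (Matrix.toEuclideanCLM (𝕜 := ℂ) (n := Fin n)).toAlgEquiv.toLinearMap
  refine hL.comp (continuous_matrix fun a b => ?_)
  simp only [Matrix.of_apply]
  fun_prop

theorem periodic_jacobian (j : Fin d) :
    Function.Periodic (fun x => W.jacobian j (W.ubar x)) W.X := fun x => by
  simp only [W.periodic_ubar x]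

/-- The periodic coefficient `Aʲ = Dfʲ(ū)`. -/
def coeff (j : Fin d) : C(AddCircle W.X, CVec n →L[ℂ] CVec n) where
  toFun := (W.periodic_jacobian j).lift
  continuous_toFun := (W.continuous_jacobian j).quotient_lift _

/-- Multiplication by `Aʲ` in `L²`. -/
def A (j : Fin d) : L2Per n W.X →ₗ[ℂ] L2Per n W.X := mulOp (W.coeff j)

/-- The common domain of the operators `L_ξ`: all `u` such that `u`, `u_x` and `A¹u` are in the
periodic space `H¹`. As `A¹` is of class `C¹`, this is the periodic Sobolev space `H²`. -/
def dom : Submodule ℂ (L2Per n W.X) where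
  carrier := {u | ∃ h : u ∈ (weakDeriv n W.X).domain,
    weakDeriv n W.X ⟨u, h⟩ ∈ (weakDeriv n W.X).domain ∧ W.A 0 u ∈ (weakDeriv n W.X).domain}
  zero_mem' := ⟨zero_mem _, by
    have : (⟨0, zero_mem _⟩ : (weakDeriv n W.X).domain) = 0 := rfl
    rw [this, LinearPMap.map_zero]; exact zero_mem _, by
    rw [map_zero]; exact zero_mem _⟩
  add_mem' := by
    rintro u v ⟨hu, hu1, hu2⟩ ⟨hv, hv1, hv2⟩
    refine ⟨add_mem hu hv, ?_, ?_⟩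
    · have : (⟨u + v, add_mem hu hv⟩ : (weakDeriv n W.X).domain) = ⟨u, hu⟩ + ⟨v, hv⟩ := rfl
      rw [this, LinearPMap.map_add]
      exact add_mem hu1 hv1
    · rw [map_add]
      exact add_mem hu2 hv2
  smul_mem' := by
    rintro c u ⟨hu, hu1, hu2⟩
    refine ⟨Submodule.smul_mem _ c hu, ?_, ?_⟩
    · have : (⟨c • u, Submodule.smul_mem _ c hu⟩ : (weakDeriv n W.X).domain) = c • ⟨u, hu⟩ := rfl
      rw [this, LinearPMap.map_smul]
      exact Submodule.smul_mem _ c hu1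
    · rw [map_smul]
      exact Submodule.smul_mem _ c hu2

/-- `u ↦ u_x` on the domain. -/
def dx : W.dom →ₗ[ℂ] L2Per n W.X where
  toFun u := weakDeriv n W.X ⟨u, u.2.1⟩
  map_add' u v := (weakDeriv n W.X).map_add ⟨u, u.2.1⟩ ⟨v, v.2.1⟩
  map_smul' c u := (weakDeriv n W.X).map_smul c ⟨u, u.2.1⟩

/-- `u ↦ u_xx` on the domain. -/
def dxx : W.dom →ₗ[ℂ] L2Per n W.X where
  toFun u := weakDeriv n W.X ⟨W.dx u, u.2.2.1⟩
  map_add' u v := by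
    rw [← LinearPMap.map_add]
    congr 2
    exact W.dx.map_add u v
  map_smul' c u := by
    rw [RingHom.id_apply, ← LinearPMap.map_smul]
    congr 2
    exact W.dx.map_smul c u

/-- `u ↦ (A¹ u)_x` on the domain. -/
def dxA : W.dom →ₗ[ℂ] L2Per n W.X where
  toFun u := weakDeriv n W.X ⟨W.A 0 u, u.2.2.2⟩
  map_add' u v := by
    rw [← LinearPMap.map_add]
    congr 2
    exact (W.A 0).map_add u v
  map_smul' c u := by
    rw [RingHom.id_apply, ← LinearPMap.map_smul]
    congr 2
    exact (W.A 0).map_smul c u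

/-- The inclusion of the domain in `L²`. -/
abbrev incl : W.dom →ₗ[ℂ] L2Per n W.X := W.dom.subtype

/-- The Bloch operator `L_ξ = e^{-iξ₁x₁} L_{ξ̃} e^{iξ₁x₁}`: since `e^{-iξ₁x₁} ∂ₓ e^{iξ₁x₁} = ∂ₓ + iξ₁`,
`L_ξ u = (∂ₓ + iξ₁)² u - (∂ₓ + iξ₁)(A¹u) - i ∑_{j≠1} ξⱼ Aʲ u - ∑_{j≠1} ξⱼ² u`. -/
def L (ξ : RVec d) : W.dom →ₗ[ℂ] L2Per n W.X :=
  (W.dxx + (2 * Complex.I * (ξ 0 : ℂ)) • W.dx - ((ξ 0 : ℂ) ^ 2) • W.incl)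
    - (W.dxA + (Complex.I * (ξ 0 : ℂ)) • (W.A 0 ∘ₗ W.incl))
    - Complex.I • (∑ j ∈ Finset.univ.erase 0, (ξ j : ℂ) • (W.A j ∘ₗ W.incl))
    - (∑ j ∈ Finset.univ.erase (0 : Fin d), (ξ j : ℂ) ^ 2) • W.incl

/-- The first-order coefficient `L¹_ω` in `L_{rω} = L_0 + r L¹_ω + r² L²_ω`, `|ω| = 1`. -/
def L1 (ω : RVec d) : W.dom →ₗ[ℂ] L2Per n W.X :=
  Complex.I • ((ω 0 : ℂ) • ((2 : ℂ) • W.dx - W.A 0 ∘ₗ W.incl)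
    - ∑ j ∈ Finset.univ.erase 0, (ω j : ℂ) • (W.A j ∘ₗ W.incl))

/-- The resolvent set of `L_ξ`: `L_ξ - λ` maps the domain bijectively onto `L²`, with bounded
inverse. -/
def resolventSet (ξ : RVec d) : Set ℂ :=
  {l | ∃ R : L2Per n W.X →L[ℂ] W.dom,
    (∀ g, (W.L ξ - l • W.incl) (R g) = g) ∧ ∀ u, R ((W.L ξ - l • W.incl) u) = u}

/-- The spectrum of `L_ξ`. -/
def spec (ξ : RVec d) : Set ℂ := (W.resolventSet ξ)ᶜ

/-- (D1): `σ(L_ξ) ⊂ {Re λ < 0}` for all Bloch frequencies `ξ ≠ 0`. The Floquet exponent `ξ₁` ranges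
over one period cell `[-π/X, π/X]`, since `L_ξ` and `L_{ξ + (2π/X)e₁}` are unitarily equivalent. -/
def D1 : Prop :=
  ∀ ξ : RVec d, |ξ 0| ≤ Real.pi / W.X → ξ ≠ 0 → ∀ l ∈ W.spec ξ, l.re < 0

/-- (D2): `Re σ(L_ξ) ≤ -θ|ξ|²` for small `ξ`, with some `θ > 0`. -/
def D2 : Prop :=
  ∃ θ > 0, ∃ r > 0, ∀ ξ : RVec d, ‖ξ‖ < r → ∀ l ∈ W.spec ξ, l.re ≤ -θ * ‖ξ‖ ^ 2

/-- The kernel of `L_0`. -/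
def ker0 : Submodule ℂ (L2Per n W.X) := (LinearMap.ker (W.L 0)).map W.incl

/-- The range of `L_0`. -/
def ran0 : Submodule ℂ (L2Per n W.X) := LinearMap.range (W.L 0)

/-- (D3): `0` is a semisimple eigenvalue of `L_0`, that is `L² = ker L_0 ⊕ ran L_0`, of
multiplicity exactly `n + 1`. -/
def D3 : Prop :=
  IsCompl W.ker0 W.ran0 ∧ Module.finrank ℂ W.ker0 = n + 1

theorem ker0_le_dom : W.ker0 ≤ W.dom := by
  rintro _ ⟨u, _, rfl⟩
  exact u.2

variable {W} in
/-- `Π₀ L¹_ω` restricted to `ker L_0`, where the zero eigenprojection `Π₀` is the projection onto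
`ker L_0` along `ran L_0`. -/
def reduced (h : W.D3) (ω : RVec d) : Module.End ℂ W.ker0 :=
  Submodule.projectionOnto W.ker0 W.ran0 h.1 ∘ₗ W.L1 ω ∘ₗ Submodule.inclusion W.ker0_le_dom

variable {W} in
/-- (H3): for every angle `ω` the eigenvalues of `Π₀ L¹_ω` on `ker L_0` are (algebraically)
simple. -/
def H3 (h : W.D3) : Prop :=
  ∀ ω : RVec d, ‖ω‖ = 1 → ∀ l : ℂ, (reduced h ω).HasEigenvalue l →
    Module.finrank ℂ ((reduced h ω).maxGenEigenspace l) = 1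

/-- `v` is a right eigenfunction of `L_ξ`, `L_ξ v = λ v`. -/
def IsRightEigenfunction (ξ : RVec d) (l : ℂ) (v : L2Per n W.X) : Prop :=
  v ≠ 0 ∧ ∃ h : v ∈ W.dom, W.L ξ ⟨v, h⟩ = l • v

/-- `w` is a left eigenfunction of `L_ξ`: `⟪w, L_ξ u⟫ = λ ⟪w, u⟫` on the domain, that is, `w` is in
the domain of the adjoint and `L_ξ* w = λ̄ w`. -/
def IsLeftEigenfunction (ξ : RVec d) (l : ℂ) (w : L2Per n W.X) : Prop :=
  w ≠ 0 ∧ ∀ u : W.dom, inner ℂ w (W.L ξ u) = l * inner ℂ w (u : L2Per n W.X)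

/-- The functions `λⱼ(ω, r)`, `qⱼ(ω, r)`, `q̃ⱼ(ω, r)`, `|ω| = 1`, `0 ≤ r < ε`, are the `n + 1`
eigenvalues of `L_{rω}` bifurcating from `0` at `r = 0` and associated right and left
eigenfunctions, normalized by `⟪q̃ⱼ, qⱼ⟫ = 1`; `λⱼ / r`, `qⱼ` and `q̃ⱼ` are smooth in `(ω, r)` up to
`r = 0`. -/
structure IsEigensystem (ε δ : ℝ) (lam : Fin (n + 1) → RVec d → ℝ → ℂ)
    (q qt : Fin (n + 1) → RVec d → ℝ → L2Per n W.X) : Prop where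
  ε_pos : 0 < ε
  δ_pos : 0 < δ
  smooth_lam : ∀ j, ∃ μ : RVec d × ℝ → ℂ,
    ContDiffOn ℝ (⊤ : ℕ∞) μ (Metric.sphere 0 1 ×ˢ Set.Ico 0 ε) ∧
    ∀ ω : RVec d, ‖ω‖ = 1 → ∀ r ∈ Set.Ico 0 ε, lam j ω r = r * μ (ω, r)
  smooth_q : ∀ j, ContDiffOn ℝ (⊤ : ℕ∞) (fun p : RVec d × ℝ => q j p.1 p.2)
    (Metric.sphere 0 1 ×ˢ Set.Ico 0 ε)
  smooth_qt : ∀ j, ContDiffOn ℝ (⊤ : ℕ∞) (fun p : RVec d × ℝ => qt j p.1 p.2)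
    (Metric.sphere 0 1 ×ˢ Set.Ico 0 ε)
  right : ∀ j, ∀ ω : RVec d, ‖ω‖ = 1 → ∀ r ∈ Set.Ico 0 ε,
    W.IsRightEigenfunction (r • ω) (lam j ω r) (q j ω r)
  left : ∀ j, ∀ ω : RVec d, ‖ω‖ = 1 → ∀ r ∈ Set.Ico 0 ε,
    W.IsLeftEigenfunction (r • ω) (lam j ω r) (qt j ω r)
  normalized : ∀ j, ∀ ω : RVec d, ‖ω‖ = 1 → ∀ r ∈ Set.Ico 0 ε,
    inner ℂ (qt j ω r) (q j ω r) = (1 : ℂ)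
  /-- For `r > 0` the `λⱼ` are distinct and are all the spectrum of `L_{rω}` near `0`. -/
  distinct : ∀ ω : RVec d, ‖ω‖ = 1 → ∀ r ∈ Set.Ioo 0 ε,
    Function.Injective fun j => lam j ω r
  exhaust : ∀ ω : RVec d, ‖ω‖ = 1 → ∀ r ∈ Set.Ioo 0 ε,
    W.spec (r • ω) ∩ Metric.ball 0 δ = Set.range fun j => lam j ω r

theorem periodic_deriv_ubar :
    Function.Periodic (fun x => WithLp.toLp 2 fun i => ((deriv W.ubar x i : ℝ) : ℂ) : ℝ → CVec n)
      W.X := fun x => by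
  have h : deriv W.ubar (x + W.X) = deriv W.ubar x := by
    rw [(W.profile _).deriv, (W.profile _).deriv, W.periodic_ubar x]
  simp only [h]

/-- `ū'` as a `ℂⁿ`-valued function on the circle. -/
def ubarDeriv : AddCircle W.X → CVec n := W.periodic_deriv_ubar.lift

/-- At `r = 0` the first right eigenfunction is `ū'` and all left eigenfunctions but the first are
constant functions of `x`, for each angle `ω`. -/
def IsAdapted (q qt : Fin (n + 1) → RVec d → ℝ → L2Per n W.X) : Prop :=
  ∀ ω : RVec d, ‖ω‖ = 1 →
    q 0 ω 0 =ᵐ[volume] W.ubarDeriv ∧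
    ∀ j, j ≠ 0 → ∃ c : CVec n, qt j ω 0 =ᵐ[volume] fun _ => c

end PeriodicWave

end Bloch

end

noncomputable section

/-! ### Weak derivatives, period integrals and complex conjugation on `L²`. -/

namespace Bloch

variable {n : ℕ} {X : ℝ} [Fact (0 < X)]

/-! Existence rests on a Lyapunov–Schmidt reduction at `λ = 0`. With `G = (L_0 + Π₀)⁻¹`, the
operator `(L_{rω} - rμ + Π₀) G` has the form `M = 1 + rE` with `E` bounded and polynomial in `(ω, r,
μ)`. Hence, for `r ≠ 0` and `M` invertible, `rμ` is in the spectrum of `L_{rω}` exactly when the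
determinant of the `(n+1) × (n+1)` matrix `Φ = π E M⁻¹ ι` vanishes. The factor `r` has been divided
out, so `Φ` is smooth up to `r = 0`, where it equals `A₀(ω) - μ` with `A₀(ω)` the matrix of `Π₀
L¹_ω`. By (H3) the roots at `r = 0` are simple, and the implicit function theorem continues them
smoothly (`exists_local_root`).

Two global questions on the sphere remain. Labelling: (D1) forces the roots at `r = 0` into `Re μ ≤
0`, and `A₀(-ω) = -A₀(ω)` then forces `Re μ = 0`. Being distinct and imaginary, they are ordered by
imaginary part, and this order gives global labels (`exists_roots`). Eigenvectors: complex
conjugation anticommutes with `L¹_ω`, so `-iA₀(ω)` is real and each eigenline is the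
complexification of a real line field over the sphere. Such a field has a nonvanishing section
except possibly over the circle, where it may be a Möbius band; there a phase of half the angle
trivializes its complexification (`LineField.exists_section`). Applying the adjugate of `Φ` to these
vectors produces right and left eigenfunctions for small `r > 0` as well (`exists_eigensystem`).

Adaptedness comes from conservation form. Everything in `ran L_0` has mean zero, so by (D3) the mean
maps `ker L_0` onto `ℂⁿ`, with a one-dimensional kernel. That kernel contains `ū'`, which is nonzero
because (D1) excludes a constant wave (`ubarLp_ne_zero`). Since `L¹_ω ū'` has mean zero, `ū'` is an
eigenvector of `Π₀ L¹_ω`. In any eigensystem the `qⱼ(ω,0)` and `q̃ⱼ(ω,0)` are dual eigenbases of `Π₀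
L¹_ω`, so by simplicity `ū'` is parallel to exactly one `qⱼ(ω,0)`, and every other `q̃ⱼ(ω,0)` is
orthogonal to `ū'` and to `ran L_0`. These two span all mean-zero functions, hence such a `q̃ⱼ(ω,0)`
is constant (`eq_constFun_of_orthogonal`). The selected index is locally constant in `ω`, so
relabelling preserves smoothness. -/

theorem weakDeriv_graph : (weakDeriv n X).graph = weakDerivGraph n X :=
  Submodule.toLinearPMap_graph_eq _ weakDerivGraph_single_valued

theorem isWeakDeriv_weakDeriv (u : (weakDeriv n X).domain) :
    IsWeakDeriv (u : L2Per n X) (weakDeriv n X u) := by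
  have h : ((u : L2Per n X), weakDeriv n X u) ∈ weakDerivGraph n X :=
    weakDeriv_graph (n := n) (X := X) ▸ (weakDeriv n X).mem_graph u
  exact h

theorem IsWeakDeriv.mem_domain {u v : L2Per n X} (h : IsWeakDeriv u v) :
    u ∈ (weakDeriv n X).domain := by
  have h' : (u, v) ∈ (weakDeriv n X).graph := by
    rw [weakDeriv_graph]; exact h
  exact LinearPMap.mem_domain_of_mem_graph h'

theorem IsWeakDeriv.unique {u v w : L2Per n X} (hv : IsWeakDeriv u v) (hw : IsWeakDeriv u w) :
    v = w := by
  have h := (weakDerivGraph n X).sub_mem (show (u, v) ∈ weakDerivGraph n X from hv)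
      (show (u, w) ∈ weakDerivGraph n X from hw)
  exact sub_eq_zero.1 (weakDerivGraph_single_valued _ h (sub_self u))

theorem IsWeakDeriv.weakDeriv_eq {u v : L2Per n X} (h : IsWeakDeriv u v)
    (hu : u ∈ (weakDeriv n X).domain) : weakDeriv n X ⟨u, hu⟩ = v :=
  IsWeakDeriv.unique (isWeakDeriv_weakDeriv ⟨u, hu⟩) h

theorem integral_norm_le_norm (u : L2Per n X) :
    ∫ x in (0 : ℝ)..X, ‖u (x : AddCircle X)‖ ≤ X ^ (1 / 2 : ℝ) * ‖u‖ := by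
  have hX : 0 < X := Fact.out
  have h2 : ∫ x in (0 : ℝ)..X, ‖u (x : AddCircle X)‖ = ∫ y : AddCircle X, ‖u y‖ := by
    have := AddCircle.intervalIntegral_preimage X 0 (fun y : AddCircle X => ‖u y‖)
    rwa [zero_add] at this
  have h3 := eLpNorm_le_eLpNorm_mul_rpow_measure_univ (p := 1) (q := 2) (by norm_num)
    (Lp.aestronglyMeasurable u)
  rw [h2, integral_norm_eq_lintegral_enorm (Lp.aestronglyMeasurable u),
    ← eLpNorm_one_eq_lintegral_enorm, Lp.norm_def]
  refine (ENNReal.toReal_mono ?_ h3).trans (le_of_eq ?_)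
  · refine ENNReal.mul_ne_top (Lp.eLpNorm_ne_top u) ?_
    rw [AddCircle.measure_univ]
    exact (ENNReal.rpow_lt_top_of_nonneg (by norm_num) (by simp)).ne
  · rw [ENNReal.toReal_mul, AddCircle.measure_univ, ← ENNReal.toReal_rpow,
      ENNReal.toReal_ofReal hX.le, mul_comm]
    norm_num

/-- Integration against a continuous scalar function over one period. -/
def testIntegral (n : ℕ) (X : ℝ) [Fact (0 < X)] (φ : C(ℝ, ℂ)) : L2Per n X →L[ℂ] CVec n :=
  LinearMap.mkContinuousOfExistsBound
    { toFun := fun u => ∫ x in (0 : ℝ)..X, φ x • u (x : AddCircle X)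
      map_add' := fun u v => integral_smul_add u v φ.continuous
      map_smul' := fun c u => integral_smul_smul c u φ } <| by
  have hX : 0 < X := Fact.out
  obtain ⟨C, hC⟩ := (isCompact_Icc (a := (0 : ℝ)) (b := X)).exists_bound_of_continuousOn
    φ.continuous.continuousOn
  have hC0 : 0 ≤ C := (norm_nonneg _).trans (hC 0 ⟨le_rfl, hX.le⟩)
  refine ⟨C * X ^ (1 / 2 : ℝ), fun u => ?_⟩
  have h1 : ‖∫ x in (0 : ℝ)..X, φ x • u (x : AddCircle X)‖ ≤
      ∫ x in (0 : ℝ)..X, C * ‖u (x : AddCircle X)‖ := by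
    refine intervalIntegral.norm_integral_le_of_norm_le hX.le ?_
      ((intervalIntegrable_coe u).norm.const_mul C)
    filter_upwards with x hx
    rw [norm_smul]
    exact mul_le_mul_of_nonneg_right (hC x ⟨hx.1.le, hx.2⟩) (norm_nonneg _)
  rw [intervalIntegral.integral_const_mul] at h1
  rw [mul_assoc]
  exact h1.trans (mul_le_mul_of_nonneg_left (integral_norm_le_norm u) hC0)

theorem testIntegral_apply (φ : C(ℝ, ℂ)) (u : L2Per n X) :
    testIntegral n X φ u = ∫ x in (0 : ℝ)..X, φ x • u (x : AddCircle X) := rfl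

/-- Each test function imposes one closed linear condition. Closedness later yields the boundedness
of `∂ₓ G` through the closed graph theorem. -/
theorem isClosed_weakDerivGraph : IsClosed (weakDerivGraph n X : Set (L2Per n X × L2Per n X)) := by
  have h : (weakDerivGraph n X : Set (L2Per n X × L2Per n X)) =
      ⋂ (φ : ℝ → ℂ) (hφ : ContDiff ℝ (⊤ : ℕ∞) φ) (_ : Function.Periodic φ X),
        {p | testIntegral n X ⟨deriv φ, hφ.continuous_deriv (by simp)⟩ p.1 =
          -testIntegral n X ⟨φ, hφ.continuous⟩ p.2} := by
    ext p
    simp only [Set.mem_iInter, Set.mem_ofPred_eq]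
    rfl
  rw [h]
  refine isClosed_iInter fun φ => isClosed_iInter fun hφ => isClosed_iInter fun _ => ?_
  exact isClosed_eq ((testIntegral n X _).continuous.comp continuous_fst)
    ((testIntegral n X _).continuous.comp continuous_snd).neg

theorem continuous_mulOp (B : C(AddCircle X, CVec n →L[ℂ] CVec n)) : Continuous (mulOp B) := by
  refine (LinearMap.mkContinuous (mulOp B) ‖B‖ fun u => ?_).continuous
  refine Lp.norm_le_mul_norm_of_ae_le_mul ?_
  filter_upwards [(memLp_mul B u).coeFn_toLp] with x hx
  change ‖((memLp_mul B u).toLp : AddCircle X → CVec n) x‖ ≤ _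
  rw [hx]
  exact (ContinuousLinearMap.le_opNorm _ _).trans
    (mul_le_mul_of_nonneg_right (B.norm_coe_le_norm x) (norm_nonneg _))

theorem mulOp_coe (B : C(AddCircle X, CVec n →L[ℂ] CVec n)) (u : L2Per n X) :
    mulOp B u =ᵐ[volume] fun x => B x (u x) :=
  (memLp_mul B u).coeFn_toLp

/-- The integral over one period. -/
def periodIntegral (n : ℕ) (X : ℝ) [Fact (0 < X)] : L2Per n X →L[ℂ] CVec n := testIntegral n X 1

theorem periodIntegral_apply (u : L2Per n X) :
    periodIntegral n X u = ∫ x in (0 : ℝ)..X, u (x : AddCircle X) := by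
  simp [periodIntegral, testIntegral_apply]

/-- Test with `φ = 1`. All uses of the conservation form of the equations go through this fact. -/
theorem IsWeakDeriv.periodIntegral_eq_zero {u v : L2Per n X} (h : IsWeakDeriv u v) :
    periodIntegral n X v = 0 := by
  have := h (fun _ => 1) contDiff_const (fun _ => rfl)
  simp only [deriv_const, zero_smul, intervalIntegral.integral_zero, one_smul] at this
  rw [periodIntegral_apply]
  exact neg_eq_zero.1 this.symm

/-- Constant functions in `L²`. -/
def constFun (n : ℕ) (X : ℝ) [Fact (0 < X)] (c : CVec n) : L2Per n X := Lp.const 2 volume c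

theorem constFun_coe (c : CVec n) : constFun n X c =ᵐ[volume] fun _ => c :=
  Lp.coeFn_const ..

theorem inner_constFun (c : CVec n) (u : L2Per n X) :
    inner ℂ (constFun n X c) u = inner ℂ c (periodIntegral n X u) := by
  rw [L2.inner_def, periodIntegral_apply]
  have h : ∫ y : AddCircle X, inner ℂ (constFun n X c y) (u y) =
      ∫ y : AddCircle X, innerSL ℂ c (u y) := by
    refine integral_congr_ae ?_
    filter_upwards [constFun_coe (X := X) c] with y hy
    rw [hy, innerSL_apply_apply]
  have h2 := AddCircle.intervalIntegral_preimage X 0 (fun y : AddCircle X => innerSL ℂ c (u y))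
  rw [zero_add] at h2
  rw [h, ← h2]
  rw [ContinuousLinearMap.intervalIntegral_comp_comm _ (intervalIntegrable_coe u)]
  rfl

theorem periodIntegral_constFun (c : CVec n) :
    periodIntegral n X (constFun n X c) = X • c := by
  rw [periodIntegral_apply]
  have : ∫ x in (0 : ℝ)..X, constFun n X c (x : AddCircle X) = ∫ x in (0 : ℝ)..X, c := by
    apply intervalIntegral.integral_congr_ae
    filter_upwards [ae_coe (constFun_coe (X := X) c)] with x hx hxI
    rw [hx hxI]
  rw [this]; simp

theorem periodIntegral_surjective : Function.Surjective (periodIntegral n X) := fun c => by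
  have hX : 0 < X := Fact.out
  refine ⟨constFun n X (X⁻¹ • c), ?_⟩
  rw [periodIntegral_constFun, smul_smul, mul_inv_cancel₀ hX.ne', one_smul]

/-- Complex conjugation on `ℂⁿ`. -/
def conjVec (n : ℕ) : CVec n →L[ℝ] CVec n :=
  LinearMap.toContinuousLinearMap
    { toFun := fun v => WithLp.toLp 2 fun i => star (v i)
      map_add' := fun v w => by ext i; simp
      map_smul' := fun c v => by ext i; simp }

theorem conjVec_apply (v : CVec n) (i : Fin n) : conjVec n v i = star (v i) := rfl

theorem conjVec_smul (c : ℂ) (v : CVec n) : conjVec n (c • v) = star c • conjVec n v := by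
  ext i; simp [conjVec_apply]

theorem conjVec_conjVec (v : CVec n) : conjVec n (conjVec n v) = v := by
  ext i; simp [conjVec_apply]

/-- Complex conjugation on `L²`. -/
def conjL (n : ℕ) (X : ℝ) [Fact (0 < X)] : L2Per n X →L[ℝ] L2Per n X :=
  (conjVec n).compLpL 2 volume

theorem conjL_coe (u : L2Per n X) : conjL n X u =ᵐ[volume] fun x => conjVec n (u x) :=
  (conjVec n).coeFn_compLpL u

theorem conjL_conjL (u : L2Per n X) : conjL n X (conjL n X u) = u := by
  apply Lp.ext
  filter_upwards [conjL_coe (conjL n X u), conjL_coe u] with x h1 h2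
  rw [h1, h2, conjVec_conjVec]

theorem conjL_smul (c : ℂ) (u : L2Per n X) : conjL n X (c • u) = star c • conjL n X u := by
  apply Lp.ext
  filter_upwards [conjL_coe (c • u), Lp.coeFn_smul c u, Lp.coeFn_smul (star c) (conjL n X u),
    conjL_coe u] with x h1 h2 h3 h4
  rw [h1, h2, h3, Pi.smul_apply, Pi.smul_apply, h4, conjVec_smul]

theorem testIntegral_conjL (φ : C(ℝ, ℂ)) (u : L2Per n X) :
    testIntegral n X φ (conjL n X u) = conjVec n (testIntegral n X (star φ) u) := by
  rw [testIntegral_apply, testIntegral_apply,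
    ← ContinuousLinearMap.intervalIntegral_comp_comm _ (intervalIntegrable_smul u (star φ).continuous)]
  apply intervalIntegral.integral_congr_ae
  filter_upwards [ae_coe (conjL_coe u)] with x hx hxI
  rw [hx hxI, conjVec_smul]
  simp

theorem IsWeakDeriv.conjL {u v : L2Per n X} (h : IsWeakDeriv u v) :
    IsWeakDeriv (conjL n X u) (conjL n X v) := by
  intro φ hφ hper
  have hφ' : ContDiff ℝ (⊤ : ℕ∞) fun x => star (φ x) :=
    (starL' ℝ : ℂ ≃L[ℝ] ℂ).contDiff.comp hφ
  have hd : deriv (fun x => star (φ x)) = fun x => star (deriv φ x) := by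
    ext x
    have hx : DifferentiableAt ℝ φ x := (hφ.differentiable (by simp)) x
    exact hx.hasDerivAt.star.deriv
  have hper' : Function.Periodic (fun x => star (φ x)) X := fun x => by simp only [hper x]
  have h1 := h _ hφ' hper'
  have e1 := testIntegral_conjL (X := X) ⟨deriv φ, hφ.continuous_deriv (by simp)⟩ u
  have e2 := testIntegral_conjL (X := X) ⟨φ, hφ.continuous⟩ v
  simp only [testIntegral_apply, ContinuousMap.coe_mk] at e1 e2
  rw [e1, e2, ← map_neg]
  congr 1
  rw [hd] at h1
  exact h1

theorem mulOp_conjL (B : C(AddCircle X, CVec n →L[ℂ] CVec n))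
    (hB : ∀ x v, B x (conjVec n v) = conjVec n (B x v)) (u : L2Per n X) :
    mulOp B (conjL n X u) = conjL n X (mulOp B u) := by
  apply Lp.ext
  filter_upwards [mulOp_coe B (conjL n X u), conjL_coe u, conjL_coe (mulOp B u), mulOp_coe B u]
    with x h1 h2 h3 h4
  rw [h1, h2, h3, h4, hB]

end Bloch

/-! ### Reality and expansion of the Bloch operators; closed range of `L_0`. -/

namespace Bloch
namespace PeriodicWave

variable {n d : ℕ} [NeZero d] (W : PeriodicWave n d)

theorem continuous_A (j : Fin d) : Continuous (W.A j) := continuous_mulOp _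

theorem coeff_coe (j : Fin d) (x : ℝ) : W.coeff j (x : AddCircle W.X) = W.jacobian j (W.ubar x) :=
  rfl

theorem jacobian_apply (j : Fin d) (u : RVec n) (v : CVec n) (i : Fin n) :
    W.jacobian j u v i =
      ∑ k, ((fderiv ℝ (W.f j) u (EuclideanSpace.single k 1) i : ℝ) : ℂ) * v k := by
  rw [jacobian, Matrix.ofLp_toEuclideanCLM]
  rfl

theorem coeff_conj (j : Fin d) (y : AddCircle W.X) (v : CVec n) :
    W.coeff j y (conjVec n v) = conjVec n (W.coeff j y v) := by
  induction y using QuotientAddGroup.induction_on with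
  | H x =>
    ext i
    rw [coeff_coe, jacobian_apply, conjVec_apply, jacobian_apply]
    simp [conjVec_apply]

theorem A_conjL (j : Fin d) (u : L2Per n W.X) : W.A j (conjL n W.X u) = conjL n W.X (W.A j u) :=
  mulOp_conjL _ (W.coeff_conj j) u

theorem dx_apply (u : W.dom) : W.dx u = weakDeriv n W.X ⟨u, u.2.1⟩ := rfl

theorem dxx_apply (u : W.dom) : W.dxx u = weakDeriv n W.X ⟨W.dx u, u.2.2.1⟩ := rfl

theorem dxA_apply (u : W.dom) : W.dxA u = weakDeriv n W.X ⟨W.A 0 u, u.2.2.2⟩ := rfl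

theorem isWeakDeriv_dx (u : W.dom) : IsWeakDeriv (u : L2Per n W.X) (W.dx u) :=
  W.dx_apply u ▸ isWeakDeriv_weakDeriv (n := n) (X := W.X) ⟨u, u.2.1⟩

theorem isWeakDeriv_dxx (u : W.dom) : IsWeakDeriv (W.dx u) (W.dxx u) :=
  W.dxx_apply u ▸ isWeakDeriv_weakDeriv (n := n) (X := W.X) ⟨W.dx u, u.2.2.1⟩

theorem isWeakDeriv_dxA (u : W.dom) : IsWeakDeriv (W.A 0 u) (W.dxA u) :=
  W.dxA_apply u ▸ isWeakDeriv_weakDeriv (n := n) (X := W.X) ⟨W.A 0 u, u.2.2.2⟩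

theorem mem_dom {u v w z : L2Per n W.X} (h1 : IsWeakDeriv u v) (h2 : IsWeakDeriv v w)
    (h3 : IsWeakDeriv (W.A 0 u) z) : u ∈ W.dom :=
  ⟨h1.mem_domain, (h1.weakDeriv_eq h1.mem_domain).symm ▸ h2.mem_domain, h3.mem_domain⟩

theorem dx_eq {u : W.dom} {v : L2Per n W.X} (h : IsWeakDeriv (u : L2Per n W.X) v) : W.dx u = v :=
  (W.isWeakDeriv_dx u).unique h

theorem dxx_eq {u : W.dom} {v w : L2Per n W.X} (h : IsWeakDeriv (u : L2Per n W.X) v)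
    (h' : IsWeakDeriv v w) : W.dxx u = w := by
  have := W.isWeakDeriv_dxx u
  rw [W.dx_eq h] at this
  exact this.unique h'

theorem dxA_eq {u : W.dom} {v : L2Per n W.X} (h : IsWeakDeriv (W.A 0 u) v) : W.dxA u = v :=
  (W.isWeakDeriv_dxA u).unique h

theorem conjL_mem_dom (u : W.dom) : conjL n W.X u ∈ W.dom := by
  have h := (W.isWeakDeriv_dxA u).conjL
  rw [← A_conjL] at h
  exact W.mem_dom (W.isWeakDeriv_dx u).conjL (W.isWeakDeriv_dxx u).conjL h

/-- Complex conjugation on the domain. -/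
def conjDom (u : W.dom) : W.dom := ⟨conjL n W.X u, W.conjL_mem_dom u⟩

theorem dx_conjDom (u : W.dom) : W.dx (W.conjDom u) = conjL n W.X (W.dx u) :=
  W.dx_eq (W.isWeakDeriv_dx u).conjL

theorem L_zero_apply (u : W.dom) : W.L 0 u = W.dxx u - W.dxA u := by
  simp [L]

theorem L_zero_conjDom (u : W.dom) : W.L 0 (W.conjDom u) = conjL n W.X (W.L 0 u) := by
  rw [L_zero_apply, L_zero_apply, map_sub]
  congr 1
  · exact W.dxx_eq (W.isWeakDeriv_dx u).conjL (W.isWeakDeriv_dxx u).conjL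
  · refine W.dxA_eq ?_
    have := (W.isWeakDeriv_dxA u).conjL
    rwa [← A_conjL] at this

theorem L1_apply (ω : RVec d) (u : W.dom) :
    W.L1 ω u = Complex.I • ((ω 0 : ℂ) • ((2 : ℂ) • W.dx u - W.A 0 u)
      - ∑ j ∈ Finset.univ.erase 0, (ω j : ℂ) • W.A j u) := by
  simp only [L1, LinearMap.sub_apply, LinearMap.smul_apply, LinearMap.sum_apply,
    LinearMap.comp_apply, Submodule.subtype_apply]

/-- `L¹_ω` is `i` times an operator with real coefficients; the sign comes from conjugating `i`. -/
theorem L1_conjDom (ω : RVec d) (u : W.dom) :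
    W.L1 ω (W.conjDom u) = -conjL n W.X (W.L1 ω u) := by
  rw [L1_apply, L1_apply, conjL_smul]
  have h2 : ((2 : ℂ) • conjL n W.X (W.dx u)) = conjL n W.X ((2 : ℂ) • W.dx u) := by
    rw [conjL_smul]; simp
  have hr (t : ℝ) (v : L2Per n W.X) : (t : ℂ) • conjL n W.X v = conjL n W.X ((t : ℂ) • v) := by
    rw [conjL_smul]; simp
  have hI : star Complex.I = -Complex.I := Complex.conj_I
  rw [dx_conjDom, h2, hI, neg_smul, neg_neg]
  congr 1
  simp only [conjDom, A_conjL, ← map_sub, hr]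
  rw [← map_sum, ← map_sub]

theorem L_smul (r : ℝ) (ω : RVec d) (u : W.dom) :
    W.L (r • ω) u = W.L 0 u + (r : ℂ) • W.L1 ω u
      - ((r : ℂ) ^ 2 * ∑ j, (ω j : ℂ) ^ 2) • (u : L2Per n W.X) := by
  rw [L_zero_apply, L1_apply, ← Finset.add_sum_erase _ _ (Finset.mem_univ (0 : Fin d))]
  have e1 (v : Fin d → L2Per n W.X) : ∑ j ∈ Finset.univ.erase (0 : Fin d), ((r : ℂ) * (ω j : ℂ)) • v j
      = (r : ℂ) • ∑ j ∈ Finset.univ.erase (0 : Fin d), (ω j : ℂ) • v j := by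
    rw [Finset.smul_sum]; simp only [mul_smul]
  have e2 : ∑ j ∈ Finset.univ.erase (0 : Fin d), ((r : ℂ) * (ω j : ℂ)) ^ 2 =
      (r : ℂ) ^ 2 * ∑ j ∈ Finset.univ.erase (0 : Fin d), (ω j : ℂ) ^ 2 := by
    rw [Finset.mul_sum]; simp only [mul_pow]
  simp only [L, LinearMap.sub_apply, LinearMap.add_apply, LinearMap.smul_apply,
    LinearMap.sum_apply, LinearMap.comp_apply, Submodule.subtype_apply, PiLp.smul_apply,
    smul_eq_mul, Complex.ofReal_mul, e1, e2]
  module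

theorem sum_sq_eq_norm_sq {d : ℕ} (ω : RVec d) : (∑ j, (ω j : ℂ) ^ 2) = ((‖ω‖ ^ 2 : ℝ) : ℂ) := by
  rw [EuclideanSpace.norm_sq_eq]
  simp

variable {W}

theorem D2.one_mem_resolventSet (h : W.D2) : (1 : ℂ) ∈ W.resolventSet 0 := by
  obtain ⟨θ, _, r, hr, H⟩ := h
  by_contra hs
  have := H 0 (by simpa using hr) 1 hs
  norm_num at this

/-- With `R = (L_0 - 1)⁻¹`, which exists by (D2) at `ξ = 0`, the bounded operator `T = L_0 R = 1 +
R` has the same range as `L_0`. Restricted to `(ker T)ᗮ` it is injective with unchanged range, and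
an injective bounded operator whose range has a closed algebraic complement, here the
finite-dimensional `ker L_0`, has closed range. -/
theorem isClosed_ran0 (h2 : W.D2) (h3 : W.D3) : IsClosed (W.ran0 : Set (L2Per n W.X)) := by
  obtain ⟨R, hR1, hR2⟩ := h2.one_mem_resolventSet
  have hfin : FiniteDimensional ℂ W.ker0 := by
    refine FiniteDimensional.of_finrank_pos ?_
    rw [h3.2]; omega
  let T : L2Per n W.X →L[ℂ] L2Per n W.X := 1 + W.dom.subtypeL ∘L R
  have hT (g) : T g = W.L 0 (R g) := by
    have := hR1 g
    simp only [one_smul, LinearMap.sub_apply, Submodule.subtype_apply] at this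
    rw [eq_comm, eq_sub_iff_add_eq] at this
    simp [T, ← this]
  have hrange : T.range = W.ran0 := by
    apply le_antisymm
    · rintro _ ⟨g, rfl⟩
      exact ⟨R g, (hT g).symm⟩
    · rintro _ ⟨u, rfl⟩
      refine ⟨(W.L 0 - (1 : ℂ) • W.incl) u, ?_⟩
      exact (hT _).trans (by rw [hR2])
  have hk : IsClosed (T.ker : Set (L2Per n W.X)) := T.isClosed_ker
  have : CompleteSpace T.ker := hk.completeSpace_coe
  let f : (T.ker)ᗮ →L[ℂ] L2Per n W.X := T ∘L (T.ker)ᗮ.subtypeL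
  have hf : f.range = W.ran0 := by
    rw [← hrange]
    apply le_antisymm
    · rintro _ ⟨g, rfl⟩
      exact ⟨g, rfl⟩
    · rintro _ ⟨g, rfl⟩
      obtain ⟨y, hy, z, hz, rfl⟩ := T.ker.exists_add_mem_mem_orthogonal g
      refine ⟨⟨z, hz⟩, ?_⟩
      have hy' : T y = 0 := hy
      simp [f, hy']
  rw [← hf]
  refine f.closed_complemented_range_of_isCompl_of_ker_eq_bot W.ker0 ?_ ?_ ?_
  · rw [hf]; exact h3.1.symm
  · exact W.ker0.closed_of_finiteDimensional
  · rw [LinearMap.ker_eq_bot']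
    intro m hm
    have : (m : L2Per n W.X) ∈ T.ker := hm
    have := Submodule.disjoint_def.1 T.ker.orthogonal_disjoint _ this m.2
    exact Subtype.ext this

theorem isTopCompl_ker0_ran0 (h2 : W.D2) (h3 : W.D3) : Submodule.IsTopCompl W.ker0 W.ran0 := by
  have hfin : FiniteDimensional ℂ W.ker0 := by
    refine FiniteDimensional.of_finrank_pos ?_
    rw [h3.2]; omega
  exact Submodule.IsCompl.isTopCompl_of_isClosed h3.1 W.ker0.closed_of_finiteDimensional (isClosed_ran0 h2 h3)

end PeriodicWave
end Bloch

/-! ### The Green operator of `L_0` and real coordinates on its kernel. -/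

namespace Bloch
namespace PeriodicWave

variable {n d : ℕ} [NeZero d]

/-- A right inverse of `L_0 + Π₀`, where the projection `Π₀ = ι π` onto `ker L_0` along `ran L_0`
is written in real coordinates of `ker L_0`. -/
structure Green (W : PeriodicWave n d) where
  ι : (Fin (n + 1) → ℂ) →L[ℂ] L2Per n W.X
  π : L2Per n W.X →L[ℂ] (Fin (n + 1) → ℂ)
  g : L2Per n W.X →ₗ[ℂ] W.dom
  G : L2Per n W.X →L[ℂ] L2Per n W.X
  DG : L2Per n W.X →L[ℂ] L2Per n W.X
  G_apply : ∀ h, G h = g h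
  DG_apply : ∀ h, DG h = W.dx (g h)
  π_ι : ∀ v, π (ι v) = v
  ι_π : ∀ k ∈ W.ker0, ι (π k) = k
  ι_mem : ∀ v, ι v ∈ W.ker0
  π_L : ∀ u, π (W.L 0 u) = 0
  L_g : ∀ h, W.L 0 (g h) = h - ι (π h)
  g_L : ∀ u : W.dom, g (W.L 0 u + ι (π u)) = u
  π_conjL : ∀ h, π (conjL n W.X h) = star (π h)
  ι_star : ∀ v, ι (star v) = conjL n W.X (ι v)

variable {W : PeriodicWave n d}

theorem mem_ker0 {u : L2Per n W.X} : u ∈ W.ker0 ↔ ∃ h : u ∈ W.dom, W.L 0 ⟨u, h⟩ = 0 := by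
  constructor
  · rintro ⟨v, hv, rfl⟩
    exact ⟨v.2, hv⟩
  · rintro ⟨h, h0⟩
    exact ⟨⟨u, h⟩, h0, rfl⟩

theorem conjL_mem_ker0 {u : L2Per n W.X} (hu : u ∈ W.ker0) : conjL n W.X u ∈ W.ker0 := by
  obtain ⟨h, h0⟩ := mem_ker0.1 hu
  refine mem_ker0.2 ⟨W.conjL_mem_dom ⟨u, h⟩, ?_⟩
  have := W.L_zero_conjDom ⟨u, h⟩
  rw [h0, map_zero] at this
  exact this

theorem conjL_mem_ran0 {u : L2Per n W.X} (hu : u ∈ W.ran0) : conjL n W.X u ∈ W.ran0 := by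
  obtain ⟨v, rfl⟩ := hu
  exact ⟨W.conjDom v, W.L_zero_conjDom v⟩

theorem D3.finiteDimensional (h3 : W.D3) : FiniteDimensional ℂ W.ker0 := by
  refine FiniteDimensional.of_finrank_pos ?_
  rw [h3.2]; omega

theorem projectionOnto_conjL (h3 : W.D3) (h : L2Per n W.X) :
    (W.ker0.projectionOnto W.ran0 h3.1 (conjL n W.X h) : L2Per n W.X) =
      conjL n W.X (W.ker0.projectionOnto W.ran0 h3.1 h) := by
  obtain ⟨k, hk, r, hr, rfl⟩ : ∃ k ∈ W.ker0, ∃ r ∈ W.ran0, k + r = h := by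
    have : h ∈ W.ker0 ⊔ W.ran0 := h3.1.sup_eq_top ▸ Submodule.mem_top
    exact Submodule.mem_sup.1 this
  rw [map_add, map_add, map_add]
  rw [Submodule.projectionOnto_apply_of_mem_left h3.1 hk,
    Submodule.projectionOnto_apply_of_mem_right h3.1 hr,
    Submodule.projectionOnto_apply_of_mem_left h3.1 (conjL_mem_ker0 hk),
    Submodule.projectionOnto_apply_of_mem_right h3.1 (conjL_mem_ran0 hr)]
  simp

/-- `ker L_0` is stable under conjugation, so the real and imaginary parts of its elements span it;
a basis is extracted from the conjugation-invariant vectors. -/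
theorem exists_real_basis (h3 : W.D3) :
    ∃ b : Module.Basis (Fin (n + 1)) ℂ W.ker0, ∀ i, conjL n W.X (b i) = b i := by
  have := h3.finiteDimensional
  let s : Set W.ker0 := {k | conjL n W.X k = k}
  have hs : Submodule.span ℂ s = ⊤ := by
    rw [eq_top_iff]
    intro k _
    let kc : W.ker0 := ⟨conjL n W.X k, conjL_mem_ker0 k.2⟩
    have h1 : k + kc ∈ s := by
      change conjL n W.X ((k : L2Per n W.X) + conjL n W.X k) = (k : L2Per n W.X) + conjL n W.X k
      rw [map_add, conjL_conjL, add_comm]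
    have h2 : Complex.I • (k - kc) ∈ s := by
      change conjL n W.X (Complex.I • ((k : L2Per n W.X) - conjL n W.X k)) =
        Complex.I • ((k : L2Per n W.X) - conjL n W.X k)
      have hI : star Complex.I = -Complex.I := Complex.conj_I
      rw [conjL_smul, map_sub, conjL_conjL, hI]
      module
    have h3 : k = (1 / 2 : ℂ) • (k + kc) + (-(1 / 2) * Complex.I) • Complex.I • (k - kc) := by
      rw [smul_smul, mul_assoc, Complex.I_mul_I]
      module
    rw [h3]
    exact add_mem (Submodule.smul_mem _ _ (Submodule.subset_span h1))
      (Submodule.smul_mem _ _ (Submodule.subset_span h2))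
  obtain ⟨b, hbs, hspan, hli⟩ := exists_linearIndependent ℂ s
  let B : Module.Basis b ℂ W.ker0 := Module.Basis.mk hli (by
    rw [Subtype.range_coe, hspan, hs])
  have hfin : Fintype b := FiniteDimensional.fintypeBasisIndex B
  have hcard : Fintype.card b = n + 1 := by
    rw [← Module.finrank_eq_card_basis B, h3.2]
  refine ⟨B.reindex (Fintype.equivFinOfCardEq hcard), fun i => ?_⟩
  rw [Module.Basis.reindex_apply, Module.Basis.mk_apply]
  exact hbs (Subtype.mem _)

/-- `L_0 + Π₀` is bijective from the domain onto `L²` by (D3); its inverse is bounded because it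
factors through the resolvent at `1`. -/
theorem exists_green (h2 : W.D2) (h3 : W.D3) :
    ∃ 𝒢 : Green W, ∀ h, 𝒢.ι (𝒢.π h) = W.ker0.projectionOnto W.ran0 h3.1 h := by
  have := h3.finiteDimensional
  obtain ⟨b, hb⟩ := exists_real_basis h3
  obtain ⟨R, hR1, hR2⟩ := h2.one_mem_resolventSet
  have htop := isTopCompl_ker0_ran0 h2 h3
  let P : L2Per n W.X →L[ℂ] L2Per n W.X := W.ker0.projectionL W.ran0 htop
  have hPk {k} (hk : k ∈ W.ker0) : P k = k := Submodule.projectionL_apply_left htop ⟨k, hk⟩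
  have hPr (u) : P (W.L 0 u) = 0 :=
    Submodule.projectionL_apply_right htop ⟨W.L 0 u, ⟨u, rfl⟩⟩
  have hPm (h) : P h ∈ W.ker0 := Submodule.projectionL_apply_mem htop h
  have hL0 {k} (hk : k ∈ W.ker0) : W.L 0 ⟨k, W.ker0_le_dom hk⟩ = 0 := (mem_ker0.1 hk).2
  have hR1' (f) : W.L 0 (R f) = f + R f := by
    have := hR1 f
    simp only [one_smul, LinearMap.sub_apply, Submodule.subtype_apply] at this
    exact sub_eq_iff_eq_add.1 this
  -- `S = (L_0 + Π₀) R`, written with bounded operators by means of `L_0 R = 1 + R`. It is a bounded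
  -- bijection, so `R S⁻¹` is a bounded inverse of `L_0 + Π₀`.
  let S : L2Per n W.X →L[ℂ] L2Per n W.X :=
    1 + (1 + P) ∘L W.dom.subtypeL ∘L R
  have hS (f) : S f = W.L 0 (R f) + P (R f) := by
    rw [hR1']; simp [S, add_assoc]
  have hdec (h : L2Per n W.X) : ∃ u : W.dom, W.L 0 u + P u = h := by
    obtain ⟨k, hk, r, ⟨u, rfl⟩, rfl⟩ : ∃ k ∈ W.ker0, ∃ r ∈ W.ran0, k + r = h := by
      have : h ∈ W.ker0 ⊔ W.ran0 := h3.1.sup_eq_top ▸ Submodule.mem_top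
      exact Submodule.mem_sup.1 this
    refine ⟨u - ⟨P u, W.ker0_le_dom (hPm u)⟩ + ⟨k, W.ker0_le_dom hk⟩, ?_⟩
    rw [map_add, map_sub, hL0 (hPm _), hL0 hk]
    simp only [Submodule.coe_add, Submodule.coe_sub, map_add, map_sub, hPk (hPm _), hPk hk]
    abel
  have hinj : Function.Injective fun u : W.dom => W.L 0 u + P u := by
    have : Function.Injective (W.L 0 + (P : L2Per n W.X →ₗ[ℂ] L2Per n W.X) ∘ₗ W.incl) := by
      rw [← LinearMap.ker_eq_bot, LinearMap.ker_eq_bot']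
      intro u hu
      have hu' : W.L 0 u + P u = 0 := hu
      have h0 : P u = 0 := by
        have := congrArg P hu'
        rwa [map_add, hPr, zero_add, map_zero, hPk (hPm _)] at this
      rw [h0, add_zero] at hu'
      have := hPk (mem_ker0.2 ⟨u.2, hu'⟩)
      exact Subtype.ext (this.symm.trans h0)
    exact this
  have hSbij : Function.Bijective S := by
    constructor
    · intro f f' hf
      rw [hS, hS] at hf
      have h1 : R f = R f' := hinj hf
      rw [← hR1 f, ← hR1 f', h1]
    · intro h
      obtain ⟨u, hu⟩ := hdec h
      refine ⟨(W.L 0 - (1 : ℂ) • W.incl) u, ?_⟩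
      rw [hS, hR2, hu]
  let Se : L2Per n W.X ≃L[ℂ] L2Per n W.X := ContinuousLinearEquiv.ofBijective S
    (LinearMap.ker_eq_bot.2 hSbij.1) (LinearMap.range_eq_top.2 hSbij.2)
  let Rg : L2Per n W.X →L[ℂ] W.dom := R ∘L (Se.symm : L2Per n W.X →L[ℂ] L2Per n W.X)
  have hRg (h) : W.L 0 (Rg h) + P (Rg h) = h :=
    (hS (Se.symm h)).symm.trans (Se.apply_symm_apply h)
  have hgR (u : W.dom) : Rg (W.L 0 u + P u) = u := hinj (hRg _)
  let D : L2Per n W.X →ₗ[ℂ] L2Per n W.X := W.dx ∘ₗ (Rg : L2Per n W.X →ₗ[ℂ] W.dom)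
  -- Closed graph theorem: convergence of `u k` gives convergence of `Rg (u k)`, and the graph of
  -- the weak derivative is closed.
  have hD : Continuous D := by
    refine D.continuous_of_seq_closed_graph fun u x y hu hy => ?_
    have h1 : Filter.Tendsto (fun k => ((Rg (u k) : L2Per n W.X), D (u k))) Filter.atTop
        (nhds ((Rg x : L2Per n W.X), y)) :=
      (((continuous_subtype_val.comp Rg.continuous).tendsto x).comp hu).prodMk_nhds hy
    have h2 := isClosed_weakDerivGraph.mem_of_tendsto h1
      (Filter.Eventually.of_forall fun k => W.isWeakDeriv_dx (Rg (u k)))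
    exact (W.dx_eq h2).symm
  let e : W.ker0 ≃L[ℂ] (Fin (n + 1) → ℂ) := b.equivFunL
  let ι : (Fin (n + 1) → ℂ) →L[ℂ] L2Per n W.X :=
    W.ker0.subtypeL ∘L (e.symm : (Fin (n + 1) → ℂ) →L[ℂ] W.ker0)
  let π : L2Per n W.X →L[ℂ] (Fin (n + 1) → ℂ) :=
    (e : W.ker0 →L[ℂ] (Fin (n + 1) → ℂ)) ∘L W.ker0.projectionOntoL W.ran0 htop
  have hιπ (h) : ι (π h) = P h := by
    simp [ι, π, P]
  have hι (v) : ι v = ∑ i, v i • (b i : L2Per n W.X) := by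
    have : e.symm v = ∑ i, v i • b i := b.equivFun_symm_apply v
    simp [ι, this]
  have hιinj : Function.Injective ι := Subtype.val_injective.comp e.symm.injective
  have hι_star (v) : ι (star v) = conjL n W.X (ι v) := by
    rw [hι, hι, map_sum]
    refine Finset.sum_congr rfl fun i _ => ?_
    rw [conjL_smul, hb]; rfl
  have hπι (v) : π (ι v) = v := by
    apply hιinj
    rw [hιπ]
    exact hPk (e.symm v).2
  have hcoe (h) : P h = W.ker0.projectionOnto W.ran0 h3.1 h := by
    rfl
  refine ⟨{ ι := ι, π := π, g := Rg, G := W.dom.subtypeL ∘L Rg, DG := ⟨D, hD⟩,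
            G_apply := fun h => rfl
            DG_apply := fun h => rfl
            π_ι := hπι
            ι_π := fun k hk => (hιπ k).trans (hPk hk)
            ι_mem := fun v => (e.symm v).2
            π_L := fun u => ?_
            L_g := fun h => ?_
            g_L := fun u => ?_
            π_conjL := fun h => ?_
            ι_star := hι_star }, fun h => (hιπ h).trans (hcoe h)⟩
  · apply hιinj
    rw [hιπ, hPr, map_zero]
  · have h1 := hRg h
    have h2 : P (Rg h) = P h := by
      have := congrArg P h1
      rwa [map_add, hPr, zero_add, hPk (hPm _)] at this
    rw [h2] at h1
    rw [hιπ]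
    exact eq_sub_of_add_eq h1
  · rw [hιπ]
    exact hgR u
  · apply hιinj
    rw [hι_star, hιπ, hιπ, hcoe, hcoe]
    exact projectionOnto_conjL h3 h

end PeriodicWave
end Bloch

/-! ### The reduced pencil `Φ` and its relation to the spectrum of `L_{rω}`. -/

namespace Bloch
namespace PeriodicWave
namespace Green

open scoped Matrix Topology

variable {n d : ℕ} [NeZero d] {W : PeriodicWave n d} (𝒢 : Green W)

theorem g_ι (v : Fin (n + 1) → ℂ) : 𝒢.g (𝒢.ι v) = ⟨𝒢.ι v, W.ker0_le_dom (𝒢.ι_mem v)⟩ := by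
  have h := 𝒢.g_L ⟨𝒢.ι v, W.ker0_le_dom (𝒢.ι_mem v)⟩
  rwa [(mem_ker0.1 (𝒢.ι_mem v)).2, zero_add, 𝒢.π_ι] at h

theorem G_ι (v : Fin (n + 1) → ℂ) : 𝒢.G (𝒢.ι v) = 𝒢.ι v := by
  rw [𝒢.G_apply, 𝒢.g_ι]

theorem g_injective : Function.Injective 𝒢.g := by
  rw [← LinearMap.ker_eq_bot, LinearMap.ker_eq_bot']
  intro h hh
  have h1 := 𝒢.L_g h
  rw [hh, map_zero] at h1
  have h2 : h = 𝒢.ι (𝒢.π h) := sub_eq_zero.1 h1.symm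
  have h3 := 𝒢.G_ι (𝒢.π h)
  rw [← h2, 𝒢.G_apply, hh] at h3
  exact h3.symm

theorem exists_g_eq (u : W.dom) : ∃ h, 𝒢.g h = u := ⟨_, 𝒢.g_L u⟩

theorem π_g (h : L2Per n W.X) : 𝒢.π (𝒢.g h) = 𝒢.π h := by
  have h1 := 𝒢.g_injective (𝒢.g_L (𝒢.g h))
  have h2 := congrArg 𝒢.π h1
  rwa [map_add, 𝒢.π_L, zero_add, 𝒢.π_ι] at h2

theorem π_G (h : L2Per n W.X) : 𝒢.π (𝒢.G h) = 𝒢.π h := by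
  rw [𝒢.G_apply, 𝒢.π_g]

/-- The coefficients of `ω ↦ L¹_ω G`. -/
def L1coeff (j : Fin d) : L2Per n W.X →L[ℂ] L2Per n W.X :=
  Complex.I • ((if j = 0 then (2 : ℂ) • 𝒢.DG else 0) -
    (⟨W.A j, W.continuous_A j⟩ : L2Per n W.X →L[ℂ] L2Per n W.X) ∘L 𝒢.G)

/-- The bounded operator `L¹_ω G`. -/
def L1G (ω : RVec d) : L2Per n W.X →L[ℂ] L2Per n W.X := ∑ j, (ω j : ℂ) • 𝒢.L1coeff j

theorem L1G_apply (ω : RVec d) (h : L2Per n W.X) : 𝒢.L1G ω h = W.L1 ω (𝒢.g h) := by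
  have e : ∀ j, 𝒢.L1coeff j h =
      Complex.I • ((if j = 0 then (2 : ℂ) • W.dx (𝒢.g h) else 0) - W.A j (𝒢.g h)) := by
    intro j
    rw [← 𝒢.DG_apply, ← 𝒢.G_apply]
    unfold L1coeff
    split_ifs <;> rfl
  rw [L1G, _root_.sum_apply, L1_apply,
    ← Finset.add_sum_erase _ _ (Finset.mem_univ (0 : Fin d))]
  have e2 : ∑ j ∈ Finset.univ.erase (0 : Fin d), ((ω j : ℂ) • 𝒢.L1coeff j) h =
      -(Complex.I • ∑ j ∈ Finset.univ.erase (0 : Fin d), (ω j : ℂ) • W.A j (𝒢.g h)) := by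
    rw [Finset.smul_sum, ← Finset.sum_neg_distrib]
    refine Finset.sum_congr rfl fun j hj => ?_
    rw [_root_.smul_apply, e, if_neg (Finset.ne_of_mem_erase hj)]
    module
  rw [e2, _root_.smul_apply, e, if_pos rfl]
  module

/-- The remainder in `(L_{rω} - rμ + Π₀) G = 1 + r E`. A parameter is a triple `((ω, r), μ)`. -/
def E (p : (RVec d × ℝ) × ℂ) : L2Per n W.X →L[ℂ] L2Per n W.X :=
  𝒢.L1G p.1.1 - ((p.1.2 : ℂ) * ∑ j, (p.1.1 j : ℂ) ^ 2 + p.2) • 𝒢.G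

/-- The operator `(L_{rω} - rμ + Π₀) G`. -/
def M (p : (RVec d × ℝ) × ℂ) : L2Per n W.X →L[ℂ] L2Per n W.X := 1 + (p.1.2 : ℂ) • 𝒢.E p

/-- The reduced pencil on the coordinates of `ker L_0`, whose determinant vanishes exactly at the
scaled eigenvalues `μ = λ / r` of `L_{rω}`. -/
def Φ (p : (RVec d × ℝ) × ℂ) : Matrix (Fin (n + 1)) (Fin (n + 1)) ℂ :=
  Matrix.of fun i j => 𝒢.π (𝒢.E p (Ring.inverse (𝒢.M p) (𝒢.ι (Pi.single j 1)))) i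

theorem Φ_mulVec (p : (RVec d × ℝ) × ℂ) (v : Fin (n + 1) → ℂ) :
    𝒢.Φ p *ᵥ v = 𝒢.π (𝒢.E p (Ring.inverse (𝒢.M p) (𝒢.ι v))) := by
  let T : (Fin (n + 1) → ℂ) →ₗ[ℂ] (Fin (n + 1) → ℂ) :=
    (𝒢.π ∘L 𝒢.E p ∘L Ring.inverse (𝒢.M p) ∘L 𝒢.ι :)
  have : 𝒢.Φ p = LinearMap.toMatrix' T := by
    ext i j
    rw [LinearMap.toMatrix'_apply]
    rfl
  rw [this, LinearMap.toMatrix'_mulVec]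
  rfl

variable {𝒢}

theorem M_inverse {p : (RVec d × ℝ) × ℂ} (hp : IsUnit (𝒢.M p)) (h : L2Per n W.X) :
    𝒢.M p (Ring.inverse (𝒢.M p) h) = h :=
  congrArg (fun T : L2Per n W.X →L[ℂ] L2Per n W.X => T h) (Ring.mul_inverse_cancel _ hp)

theorem inverse_M {p : (RVec d × ℝ) × ℂ} (hp : IsUnit (𝒢.M p)) (h : L2Per n W.X) :
    Ring.inverse (𝒢.M p) (𝒢.M p h) = h :=
  congrArg (fun T : L2Per n W.X →L[ℂ] L2Per n W.X => T h) (Ring.inverse_mul_cancel _ hp)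

theorem M_apply (p : (RVec d × ℝ) × ℂ) (h : L2Per n W.X) :
    𝒢.M p h = h + (p.1.2 : ℂ) • 𝒢.E p h := rfl

theorem M_zero (ω : RVec d) (μ : ℂ) : 𝒢.M ((ω, 0), μ) = 1 := by
  simp [M]

/-- The factorization behind the reduction: up to the finite-rank term `ιπ`, the shifted operator
composed with `g` is the near-identity operator `M`. -/
theorem L_g_sub (ω : RVec d) (r : ℝ) (μ : ℂ) (h : L2Per n W.X) :
    W.L (r • ω) (𝒢.g h) - ((r : ℂ) * μ) • (𝒢.g h : L2Per n W.X) =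
      𝒢.M ((ω, r), μ) h - 𝒢.ι (𝒢.π h) := by
  rw [M_apply, L_smul, 𝒢.L_g]
  simp only [E, _root_.sub_apply, _root_.smul_apply, 𝒢.L1G_apply,
    𝒢.G_apply]
  module

/-- Apply `π` to `M M⁻¹ ι v = ι v` with `M = 1 + rE`. Thus `rΦ` is the Schur complement `1 - π M⁻¹
ι`, and the definition of `Φ` performs the division by `r` so that it survives at `r = 0`. -/
theorem smul_Φ_mulVec {p : (RVec d × ℝ) × ℂ} (hp : IsUnit (𝒢.M p)) (v : Fin (n + 1) → ℂ) :
    (p.1.2 : ℂ) • (𝒢.Φ p *ᵥ v) = v - 𝒢.π (Ring.inverse (𝒢.M p) (𝒢.ι v)) := by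
  have h := M_inverse hp (𝒢.ι v)
  rw [M_apply] at h
  have h2 := congrArg 𝒢.π h
  rw [map_add, map_smul, 𝒢.π_ι, ← Φ_mulVec] at h2
  exact eq_sub_of_add_eq' h2

theorem Φ_zero_mulVec (ω : RVec d) (μ : ℂ) (v : Fin (n + 1) → ℂ) :
    𝒢.Φ ((ω, 0), μ) *ᵥ v = 𝒢.π (𝒢.L1G ω (𝒢.ι v)) - μ • v := by
  rw [Φ_mulVec, M_zero, Ring.inverse_one]
  simp [E, π_G, π_ι]

/-- Elements of the kernel of the reduced pencil give right eigenfunctions. -/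
theorem L_g_inverse_ι {ω : RVec d} {r : ℝ} {μ : ℂ} (hp : IsUnit (𝒢.M ((ω, r), μ)))
    {k : Fin (n + 1) → ℂ} (hk : 𝒢.Φ ((ω, r), μ) *ᵥ k = 0) :
    W.L (r • ω) (𝒢.g (Ring.inverse (𝒢.M ((ω, r), μ)) (𝒢.ι k))) =
      ((r : ℂ) * μ) • (𝒢.g (Ring.inverse (𝒢.M ((ω, r), μ)) (𝒢.ι k)) : L2Per n W.X) := by
  have h := smul_Φ_mulVec hp k
  rw [hk, smul_zero, eq_comm, sub_eq_zero] at h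
  have h2 := L_g_sub (𝒢 := 𝒢) ω r μ (Ring.inverse (𝒢.M ((ω, r), μ)) (𝒢.ι k))
  rw [M_inverse hp, ← h, sub_self] at h2
  exact sub_eq_zero.1 h2

theorem π_G_inverse_ι {ω : RVec d} {r : ℝ} {μ : ℂ} (hp : IsUnit (𝒢.M ((ω, r), μ)))
    {k : Fin (n + 1) → ℂ} (hk : 𝒢.Φ ((ω, r), μ) *ᵥ k = 0) :
    𝒢.π (𝒢.G (Ring.inverse (𝒢.M ((ω, r), μ)) (𝒢.ι k))) = k := by
  have h := smul_Φ_mulVec hp k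
  rw [hk, smul_zero, eq_comm, sub_eq_zero] at h
  rw [π_G, ← h]

/-- The coordinates of an eigenfunction are in the kernel of the reduced pencil. -/
theorem smul_Φ_mulVec_π {ω : RVec d} {r : ℝ} {μ : ℂ} (hp : IsUnit (𝒢.M ((ω, r), μ)))
    {u : W.dom} (hu : W.L (r • ω) u = ((r : ℂ) * μ) • (u : L2Per n W.X)) :
    (r : ℂ) • (𝒢.Φ ((ω, r), μ) *ᵥ 𝒢.π u) = 0 := by
  obtain ⟨h, rfl⟩ := 𝒢.exists_g_eq u
  have h1 := L_g_sub (𝒢 := 𝒢) ω r μ h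
  rw [hu, sub_self] at h1
  have h2 : h = Ring.inverse (𝒢.M ((ω, r), μ)) (𝒢.ι (𝒢.π h)) := by
    rw [← sub_eq_zero.1 h1.symm, inverse_M hp]
  refine (smul_Φ_mulVec hp _).trans ?_
  rw [π_g, ← h2, sub_self]

/-- The coordinates `π u` of an eigenfunction lie in `ker Φ = 0`; writing `u = g h`, the
factorization reduces to `M h = 0`. -/
theorem eq_zero_of_det_ne_zero {ω : RVec d} {r : ℝ} {μ : ℂ} (hp : IsUnit (𝒢.M ((ω, r), μ)))
    (hr : r ≠ 0) (hdet : (𝒢.Φ ((ω, r), μ)).det ≠ 0) {u : W.dom}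
    (hu : W.L (r • ω) u = ((r : ℂ) * μ) • (u : L2Per n W.X)) : u = 0 := by
  have h0 := smul_Φ_mulVec_π hp hu
  have h1 := (smul_eq_zero.1 h0).resolve_left (by exact_mod_cast hr)
  have h2 := Matrix.eq_zero_of_mulVec_eq_zero hdet h1
  obtain ⟨h, rfl⟩ := 𝒢.exists_g_eq u
  have h3 := L_g_sub (𝒢 := 𝒢) ω r μ h
  rw [π_g] at h2
  rw [hu, sub_self, h2, map_zero, sub_zero] at h3
  have := inverse_M hp h
  rw [← h3, map_zero] at this
  rw [← this, map_zero]

theorem mem_resolventSet {ω : RVec d} {r : ℝ} {μ : ℂ} (hp : IsUnit (𝒢.M ((ω, r), μ)))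
    (hr : r ≠ 0) (hdet : (𝒢.Φ ((ω, r), μ)).det ≠ 0) :
    (r : ℂ) * μ ∈ W.resolventSet (r • ω) := by
  have hr' : (r : ℂ) ≠ 0 := by exact_mod_cast hr
  let gL : L2Per n W.X →L[ℂ] W.dom :=
    ⟨𝒢.g, by
      refine Continuous.subtype_mk (p := (· ∈ W.dom)) (f := fun h => 𝒢.G h) 𝒢.G.continuous
        (fun h => 𝒢.G_apply h ▸ (𝒢.g h).2) |>.congr fun h => ?_
      exact Subtype.ext (𝒢.G_apply h)⟩
  let Mi := Ring.inverse (𝒢.M ((ω, r), μ))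
  let T : (Fin (n + 1) → ℂ) →L[ℂ] (Fin (n + 1) → ℂ) :=
    LinearMap.toContinuousLinearMap (Matrix.mulVecLin ((r : ℂ)⁻¹ • (𝒢.Φ ((ω, r), μ))⁻¹))
  -- The equation to solve is `M h' - ιπ h' = h`. Put `w = π h'`, so `h' = M⁻¹ (h + ι w)`; applying
  -- `π` gives `rΦ w = π M⁻¹ h`, which `T = (rΦ)⁻¹` solves.
  let R : L2Per n W.X →L[ℂ] W.dom := gL ∘L Mi ∘L (1 + 𝒢.ι ∘L T ∘L 𝒢.π ∘L Mi)
  have hR (h) : (W.L (r • ω) - ((r : ℂ) * μ) • W.incl) (R h) = h := by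
    set w := T (𝒢.π (Mi h)) with hw
    have h1 : R h = 𝒢.g (Mi (h + 𝒢.ι w)) := rfl
    rw [h1]
    refine (L_g_sub ω r μ _).trans ?_
    have h2 : (r : ℂ) • (𝒢.Φ ((ω, r), μ) *ᵥ w) = 𝒢.π (Mi h) := by
      change (r : ℂ) • (𝒢.Φ ((ω, r), μ) *ᵥ (((r : ℂ)⁻¹ • (𝒢.Φ ((ω, r), μ))⁻¹) *ᵥ 𝒢.π (Mi h))) = _
      rw [Matrix.smul_mulVec, Matrix.mulVec_smul, smul_smul, mul_inv_cancel₀ hr', one_smul,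
        Matrix.mulVec_mulVec, Matrix.mul_nonsing_inv _ (isUnit_iff_ne_zero.2 hdet),
        Matrix.one_mulVec]
    have h3 := smul_Φ_mulVec hp w
    simp only at h3
    rw [h2] at h3
    have h4 : 𝒢.π (Mi (h + 𝒢.ι w)) = w := by
      rw [map_add, map_add, h3]
      exact sub_add_cancel _ _
    rw [h4, M_inverse hp]
    exact add_sub_cancel_right _ _
  -- A right inverse of an injective operator is two-sided.
  refine ⟨R, hR, fun u => ?_⟩
  have h1 := hR ((W.L (r • ω) - ((r : ℂ) * μ) • W.incl) u)
  have h2 : (W.L (r • ω) - ((r : ℂ) * μ) • W.incl)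
      (R ((W.L (r • ω) - ((r : ℂ) * μ) • W.incl) u) - u) = 0 := by
    rw [map_sub, h1, sub_self]
  exact sub_eq_zero.1 (eq_zero_of_det_ne_zero hp hr hdet (sub_eq_zero.1 h2))

theorem _root_.Bloch.PeriodicWave.mem_spec_of_eigenfunction {ξ : RVec d} {l : ℂ} {u : W.dom}
    (h0 : u ≠ 0) (hu : W.L ξ u = l • (u : L2Per n W.X)) : l ∈ W.spec ξ := by
  rintro ⟨R, _, hR⟩
  refine h0 ?_
  have : (W.L ξ - l • W.incl) u = 0 := sub_eq_zero.2 hu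
  rw [← hR u, this, map_zero]

theorem mem_spec {ω : RVec d} {r : ℝ} {μ : ℂ} (hp : IsUnit (𝒢.M ((ω, r), μ)))
    (hdet : (𝒢.Φ ((ω, r), μ)).det = 0) : (r : ℂ) * μ ∈ W.spec (r • ω) := by
  obtain ⟨k, hk0, hk⟩ := Matrix.exists_mulVec_eq_zero_iff.2 hdet
  refine mem_spec_of_eigenfunction (fun h0 => hk0 ?_) (L_g_inverse_ι hp hk)
  rw [← π_G_inverse_ι hp hk, 𝒢.G_apply, h0]
  exact map_zero _

theorem mem_spec_iff {ω : RVec d} {r : ℝ} {μ : ℂ} (hp : IsUnit (𝒢.M ((ω, r), μ)))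
    (hr : r ≠ 0) : (r : ℂ) * μ ∈ W.spec (r • ω) ↔ (𝒢.Φ ((ω, r), μ)).det = 0 :=
  ⟨fun h => by_contra fun hd => h (mem_resolventSet hp hr hd), mem_spec hp⟩

variable (𝒢) in
/-- The functional `h ↦ ℓ · π M⁻¹ h`. -/
def leftFunctional (p : (RVec d × ℝ) × ℂ) (l : Fin (n + 1) → ℂ) : L2Per n W.X →L[ℂ] ℂ :=
  ∑ i, l i • (ContinuousLinearMap.proj i ∘L 𝒢.π ∘L Ring.inverse (𝒢.M p))

theorem leftFunctional_apply (p : (RVec d × ℝ) × ℂ) (l : Fin (n + 1) → ℂ) (h : L2Per n W.X) :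
    𝒢.leftFunctional p l h = l ⬝ᵥ 𝒢.π (Ring.inverse (𝒢.M p) h) := by
  simp [leftFunctional, dotProduct]

/-- On `u = g h` the factorization leaves `l · π M⁻¹ (M h - ιπ h) = l · rΦ π h`, which vanishes for
a left null vector `l` of `Φ`. -/
theorem leftFunctional_L {ω : RVec d} {r : ℝ} {μ : ℂ} (hp : IsUnit (𝒢.M ((ω, r), μ)))
    {l : Fin (n + 1) → ℂ} (hl : l ᵥ* 𝒢.Φ ((ω, r), μ) = 0) (u : W.dom) :
    𝒢.leftFunctional ((ω, r), μ) l (W.L (r • ω) u) =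
      ((r : ℂ) * μ) * 𝒢.leftFunctional ((ω, r), μ) l u := by
  obtain ⟨h, rfl⟩ := 𝒢.exists_g_eq u
  have h1 := L_g_sub (𝒢 := 𝒢) ω r μ h
  rw [sub_eq_iff_eq_add] at h1
  rw [h1, map_add, map_smul, smul_eq_mul, add_eq_right, leftFunctional_apply, map_sub, map_sub,
    inverse_M hp, ← smul_Φ_mulVec hp, dotProduct_smul, Matrix.dotProduct_mulVec, hl,
    zero_dotProduct, smul_zero]

end Green
end PeriodicWave
end Bloch

/-- The implicit function theorem for a simple zero of a function of a complex variable depending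
on real parameters. -/
theorem exists_contDiffAt_root {F : Type*} [NormedAddCommGroup F] [NormedSpace ℝ F]
    [CompleteSpace F] {f : F × ℂ → ℂ} {p : F} {μ c : ℂ} (hf : ContDiffAt ℝ ⊤ f (p, μ))
    (h0 : f (p, μ) = 0) (hc : c ≠ 0) (hd : HasDerivAt (fun z => f (p, z)) c μ) :
    ∃ b : F → ℂ, ContDiffAt ℝ ⊤ b p ∧ b p = μ ∧
      ∀ᶠ v in nhds (p, μ), f v = 0 ↔ v.2 = b v.1 := by
  -- The partial derivative in `z` is multiplication by `c ≠ 0`, an invertible real-linear map of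
  -- `ℂ`.
  have hinv : (fderiv ℝ f (p, μ) ∘L .inr ℝ F ℂ).IsInvertible := by
    have h1 : HasFDerivAt (fun z => f (p, z)) (fderiv ℝ f (p, μ) ∘L .inr ℝ F ℂ) μ :=
      ((hf.differentiableAt (by simp)).hasFDerivAt).comp μ (hasFDerivAt_prodMk_right p μ)
    have h2 := hd.hasFDerivAt.restrictScalars ℝ
    rw [h1.unique h2]
    refine ⟨((LinearEquiv.smulOfNeZero ℂ ℂ c hc).restrictScalars ℝ).toContinuousLinearEquiv, ?_⟩
    ext z
    simp [mul_comm]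
  refine ⟨hf.implicitFunction (by simp) hinv, hf.contDiffAt_implicitFunction _ hinv,
    hf.implicitFunction_apply_self _ hinv, ?_⟩
  filter_upwards [hf.eventually_apply_eq_iff_implicitFunction (by simp) hinv] with v hv
  rw [← h0, hv, eq_comm]

/-! ### Smoothness of the pencil, a priori bounds on its roots, and the real matrix `-iA₀`. -/

namespace Bloch
namespace PeriodicWave
namespace Green

open scoped Matrix Topology

variable {n d : ℕ} [NeZero d] {W : PeriodicWave n d} {𝒢 : Green W}

theorem contDiff_L1G {k : WithTop ℕ∞} : ContDiff ℝ k 𝒢.L1G := by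
  unfold L1G
  refine ContDiff.sum fun j _ => ContDiff.fun_smul ?_ contDiff_const
  exact Complex.ofRealCLM.contDiff.comp (EuclideanSpace.proj (𝕜 := ℝ) j).contDiff

theorem contDiff_E {k : WithTop ℕ∞} : ContDiff ℝ k 𝒢.E := by
  unfold E
  refine ContDiff.sub (contDiff_L1G.comp contDiff_fst.fst) (ContDiff.fun_smul ?_ contDiff_const)
  refine ContDiff.add (ContDiff.mul (Complex.ofRealCLM.contDiff.comp contDiff_fst.snd)
    (ContDiff.sum fun j _ => ContDiff.pow ?_ 2)) contDiff_snd
  exact Complex.ofRealCLM.contDiff.comp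
    ((EuclideanSpace.proj (𝕜 := ℝ) j).contDiff.comp contDiff_fst.fst)

theorem contDiff_M {k : WithTop ℕ∞} : ContDiff ℝ k 𝒢.M := by
  unfold M
  exact contDiff_const.add
    ((Complex.ofRealCLM.contDiff.comp contDiff_fst.snd).smul contDiff_E)

theorem contDiffAt_inverse_M {k : WithTop ℕ∞} {p : (RVec d × ℝ) × ℂ} (hp : IsUnit (𝒢.M p)) :
    ContDiffAt ℝ k (fun p => Ring.inverse (𝒢.M p)) p := by
  obtain ⟨u, hu⟩ := hp
  have h := (contDiffAt_ringInverse ℂ (n := k) u).restrict_scalars ℝ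
  rw [hu] at h
  exact h.comp p contDiff_M.contDiffAt

theorem eventually_isUnit_M {p : (RVec d × ℝ) × ℂ} (hp : IsUnit (𝒢.M p)) :
    ∀ᶠ p' in 𝓝 p, IsUnit (𝒢.M p') :=
  (contDiff_M (𝒢 := 𝒢) (k := 0)).continuous.continuousAt.eventually_mem
    (Units.isOpen.mem_nhds hp)

theorem _root_.Bloch.contDiffAt_apply {F G H : Type*} [NormedAddCommGroup F] [NormedSpace ℝ F]
    [NormedAddCommGroup G] [NormedSpace ℂ G] [NormedAddCommGroup H] [NormedSpace ℂ H]
    {k : WithTop ℕ∞} {T : F → G →L[ℂ] H} {v : F → G} {p : F} (hT : ContDiffAt ℝ k T p)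
    (hv : ContDiffAt ℝ k v p) : ContDiffAt ℝ k (fun p => T p (v p)) p :=
  ((ContinuousLinearMap.restrictScalarsL ℂ G H ℝ ℝ).contDiff.contDiffAt.comp p hT).clm_apply hv

theorem contDiffAt_Φ {k : WithTop ℕ∞} {p : (RVec d × ℝ) × ℂ} (hp : IsUnit (𝒢.M p)) (i j) :
    ContDiffAt ℝ k (fun p => 𝒢.Φ p i j) p := by
  have h1 : ContDiffAt ℝ k (fun p => Ring.inverse (𝒢.M p) (𝒢.ι (Pi.single j 1))) p :=
    ((ContinuousLinearMap.apply ℂ (L2Per n W.X) (𝒢.ι (Pi.single j 1))).restrictScalars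
      ℝ).contDiff.contDiffAt.comp p (contDiffAt_inverse_M hp)
  have h2 : ContDiffAt ℝ k
      (fun p => 𝒢.E p (Ring.inverse (𝒢.M p) (𝒢.ι (Pi.single j 1)))) p := by
    exact contDiffAt_apply contDiff_E.contDiffAt h1
  have h3 : ContDiff ℝ k fun h => 𝒢.π h i :=
    ((ContinuousLinearMap.proj i ∘L 𝒢.π : L2Per n W.X →L[ℂ] ℂ).restrictScalars ℝ).contDiff
  exact h3.contDiffAt.comp p h2

end Green
end PeriodicWave
end Bloch

namespace Bloch
namespace PeriodicWave
namespace Green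

open scoped Matrix Topology

variable {n d : ℕ} [NeZero d] {W : PeriodicWave n d} {𝒢 : Green W}

/-- Spectrum in a fixed small ball is `O(r)`. `M` depends on `μ` only through `rμ`, so it is
uniformly invertible when `r` and `rμ` are small, however large `μ` is. If `Φ k = 0` then `π M⁻¹ ι k
= k`, hence `(r + μ) k = π L¹_ω G M⁻¹ ι k`, which bounds `μ`. -/
theorem exists_bound_of_det_Φ_eq_zero : ∃ δ > 0, ∃ C : ℝ, ∀ ω : RVec d, ‖ω‖ = 1 → ∀ (r : ℝ) (μ : ℂ),
    |r| < δ → ‖(r : ℂ) * μ‖ < δ →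
      IsUnit (𝒢.M ((ω, r), μ)) ∧ ((𝒢.Φ ((ω, r), μ)).det = 0 → ‖μ‖ ≤ C) := by
  -- `M` rewritten as a function of `z = (r, rμ)`, continuous and equal to `1` at `z = 0`.
  let N : (ℝ × ℂ) → RVec d → (L2Per n W.X →L[ℂ] L2Per n W.X) := fun z ω =>
    1 + ((z.1 : ℂ) • 𝒢.L1G ω - ((z.1 : ℂ) ^ 2 * ∑ j, (ω j : ℂ) ^ 2 + z.2) • 𝒢.G)
  have hNM (ω r μ) : 𝒢.M ((ω, r), μ) = N (r, (r : ℂ) * μ) ω := by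
    simp only [M, E, N]
    module
  have hL1 : Continuous 𝒢.L1G := (contDiff_L1G (k := 0)).continuous
  have hN : Continuous fun q : (ℝ × ℂ) × RVec d => N q.1 q.2 := by
    simp only [N]
    have h1 : ∀ j, Continuous fun q : (ℝ × ℂ) × RVec d => (q.2 j : ℂ) := fun j =>
      Complex.continuous_ofReal.comp ((EuclideanSpace.proj (𝕜 := ℝ) j).continuous.comp continuous_snd)
    have h2 : Continuous fun q : (ℝ × ℂ) × RVec d => ((q.1.1 : ℝ) : ℂ) :=
      Complex.continuous_ofReal.comp continuous_fst.fst
    fun_prop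
  have hS : IsCompact (Metric.sphere (0 : RVec d) 1) := isCompact_sphere 0 1
  obtain ⟨B, hB⟩ := hS.exists_bound_of_continuousOn hL1.continuousOn
  have hev : ∀ᶠ z in 𝓝 ((0 : ℝ), (0 : ℂ)), ∀ ω ∈ Metric.sphere (0 : RVec d) 1,
      IsUnit (N z ω) ∧ ‖Ring.inverse (N z ω)‖ < 2 := by
    refine hS.eventually_forall_of_forall_eventually fun ω _ => ?_
    have h1 : N ((0 : ℝ), (0 : ℂ)) ω = 1 := by
      simp [N]
      exact zero_smul ℂ _
    have hu : IsUnit (N ((0 : ℝ), (0 : ℂ)) ω) := h1 ▸ isUnit_one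
    have hc : ContinuousAt (fun q : (ℝ × ℂ) × RVec d => N q.1 q.2) (((0 : ℝ), (0 : ℂ)), ω) :=
      hN.continuousAt
    refine (hc.eventually_mem (Units.isOpen.mem_nhds hu)).and ?_
    have hi : ContinuousAt (fun q : (ℝ × ℂ) × RVec d => ‖Ring.inverse (N q.1 q.2)‖)
        (((0 : ℝ), (0 : ℂ)), ω) := by
      refine ContinuousAt.norm (ContinuousAt.comp (g := Ring.inverse) ?_ hc)
      exact NormedRing.inverse_continuousAt hu.unit
    refine hi.eventually_lt continuousAt_const ?_
    simp only [h1, Ring.inverse_one]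
    exact ContinuousLinearMap.norm_id_le.trans_lt (by norm_num)
  obtain ⟨δ, hδ, H⟩ := Metric.eventually_nhds_iff.1 hev
  refine ⟨min δ 1, by positivity, 1 + ‖𝒢.π‖ * (B * (2 * ‖𝒢.ι‖)), fun ω hω r μ hr hμ => ?_⟩
  have hz : dist (r, (r : ℂ) * μ) ((0 : ℝ), (0 : ℂ)) < δ := by
    rw [Prod.dist_eq, max_lt_iff, dist_zero_right, dist_zero_right]
    exact ⟨hr.trans_le (min_le_left _ _), hμ.trans_le (min_le_left _ _)⟩
  have hωS : ω ∈ Metric.sphere (0 : RVec d) 1 := by simpa using hω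
  obtain ⟨hu, hinv⟩ := H hz ω hωS
  rw [← hNM] at hu hinv
  refine ⟨hu, fun hdet => ?_⟩
  obtain ⟨k, hk0, hk⟩ := Matrix.exists_mulVec_eq_zero_iff.2 hdet
  have h1 := smul_Φ_mulVec hu k
  rw [hk, smul_zero, eq_comm, sub_eq_zero] at h1
  rw [Φ_mulVec] at hk
  simp only [E, _root_.sub_apply, _root_.smul_apply, map_sub, map_smul, π_G, ← h1] at hk
  rw [sub_eq_zero, sum_sq_eq_norm_sq, hω] at hk
  have h2 : ‖(r : ℂ) + μ‖ * ‖k‖ ≤ ‖𝒢.π‖ * (B * (2 * ‖𝒢.ι‖)) * ‖k‖ := by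
    have h3 : ‖(r : ℂ) + μ‖ * ‖k‖ = ‖𝒢.π (𝒢.L1G ω (Ring.inverse (𝒢.M ((ω, r), μ)) (𝒢.ι k)))‖ := by
      rw [hk, norm_smul]; simp
    rw [h3]
    have hB0 : 0 ≤ B := (norm_nonneg _).trans (hB ω hωS)
    calc _ ≤ ‖𝒢.π‖ * ‖𝒢.L1G ω (Ring.inverse (𝒢.M ((ω, r), μ)) (𝒢.ι k))‖ := 𝒢.π.le_opNorm _
      _ ≤ ‖𝒢.π‖ * (B * (2 * (‖𝒢.ι‖ * ‖k‖))) := by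
          refine mul_le_mul_of_nonneg_left ?_ (norm_nonneg _)
          refine (𝒢.L1G ω).le_of_opNorm_le_of_le (hB ω hωS) ?_
          exact ContinuousLinearMap.le_of_opNorm_le_of_le _ hinv.le (𝒢.ι.le_opNorm k)
      _ = _ := by ring
  have h4 := le_of_mul_le_mul_right h2 (norm_pos_iff.2 hk0)
  have h5 : ‖(r : ℂ)‖ ≤ 1 := by
    rw [Complex.norm_real]
    exact (hr.trans_le (min_le_right _ _)).le
  calc ‖μ‖ = ‖((r : ℂ) + μ) - r‖ := by rw [add_sub_cancel_left]
    _ ≤ ‖(r : ℂ) + μ‖ + ‖(r : ℂ)‖ := norm_sub_le _ _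
    _ ≤ _ := by linarith

variable (𝒢) in
/-- The matrix of `Π₀ L¹_ω` on `ker L_0` in real coordinates. -/
def A₀ (ω : RVec d) : Matrix (Fin (n + 1)) (Fin (n + 1)) ℂ := 𝒢.Φ ((ω, 0), 0)

theorem A₀_mulVec (ω : RVec d) (v : Fin (n + 1) → ℂ) :
    𝒢.A₀ ω *ᵥ v = 𝒢.π (𝒢.L1G ω (𝒢.ι v)) := by
  rw [A₀, Φ_zero_mulVec, zero_smul, sub_zero]

theorem Φ_zero (ω : RVec d) (μ : ℂ) : 𝒢.Φ ((ω, 0), μ) = 𝒢.A₀ ω - Matrix.scalar _ μ := by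
  refine Matrix.ext_of_mulVec_single fun i => ?_
  rw [Φ_zero_mulVec, Matrix.sub_mulVec, A₀_mulVec]
  congr 1
  ext j
  simp [Pi.single_apply]

theorem A₀_neg (ω : RVec d) : 𝒢.A₀ (-ω) = -𝒢.A₀ ω := by
  refine Matrix.ext_of_mulVec_single fun i => ?_
  rw [A₀_mulVec, Matrix.neg_mulVec, A₀_mulVec]
  have : 𝒢.L1G (-ω) = -𝒢.L1G ω := by simp [L1G]
  rw [this]
  simp

theorem A₀_mulVec_star (ω : RVec d) (v : Fin (n + 1) → ℂ) :
    𝒢.A₀ ω *ᵥ star v = -star (𝒢.A₀ ω *ᵥ v) := by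
  rw [A₀_mulVec, A₀_mulVec, ← 𝒢.π_conjL, 𝒢.ι_star, 𝒢.L1G_apply, 𝒢.L1G_apply, ← map_neg,
    ← L1_conjDom, 𝒢.g_ι]
  congr 2
  apply Subtype.ext
  have h2 : (𝒢.g (𝒢.ι (star v)) : L2Per n W.X) = 𝒢.ι (star v) :=
    congrArg Subtype.val (𝒢.g_ι (star v))
  rw [𝒢.ι_star] at h2
  exact h2

variable (𝒢) in
/-- The real matrix `-i A₀(ω)`. -/
def realA₀ (ω : RVec d) : Matrix (Fin (n + 1)) (Fin (n + 1)) ℝ :=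
  Matrix.of fun i j => (𝒢.A₀ ω i j).im

/-- The coordinates are compatible with conjugation and `L¹_ω` anticommutes with it, so the entries
of `A₀` are purely imaginary. -/
theorem A₀_eq (ω : RVec d) : 𝒢.A₀ ω = Complex.I • (𝒢.realA₀ ω).map (↑) := by
  ext i j
  have h := congrFun (A₀_mulVec_star (𝒢 := 𝒢) ω (Pi.single j 1)) i
  have hs : star (Pi.single j 1 : Fin (n + 1) → ℂ) = Pi.single j 1 := by
    ext k; by_cases hk : k = j <;> simp [hk]
  rw [hs] at h
  simp only [Matrix.mulVec_single_one, Pi.neg_apply, Pi.star_apply, Matrix.col_apply] at h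
  have hre : (𝒢.A₀ ω i j).re = 0 := by
    have := congrArg Complex.re h
    simp at this
    linarith
  apply Complex.ext <;> simp [realA₀, hre]

theorem contDiff_realA₀ {k : WithTop ℕ∞} (i j) : ContDiff ℝ k fun ω => 𝒢.realA₀ ω i j := by
  rw [contDiff_iff_contDiffAt]
  intro ω
  have hu : IsUnit (𝒢.M ((ω, 0), 0)) := M_zero (𝒢 := 𝒢) ω 0 ▸ isUnit_one
  have h1 := contDiffAt_Φ (k := k) hu i j
  have h2 : ContDiffAt ℝ k (fun ω : RVec d => ((ω, (0 : ℝ)), (0 : ℂ))) ω := by fun_prop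
  exact Complex.imCLM.contDiff.contDiffAt.comp ω
    (ContDiffAt.comp (g := fun p => 𝒢.Φ p i j) ω h1 h2)

end Green
end PeriodicWave
end Bloch

/-! ### Roots of the pencil: simple, purely imaginary at `r = 0`, and globally labelled. -/

namespace Bloch
namespace PeriodicWave
namespace Green

open scoped Matrix Topology

variable {n d : ℕ} [NeZero d] {W : PeriodicWave n d} {𝒢 : Green W} {h3 : W.D3}

variable (𝒢) in
/-- The coordinates of `ker L_0`. -/
def kerEquiv : W.ker0 ≃ₗ[ℂ] (Fin (n + 1) → ℂ) where
  toFun k := 𝒢.π k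
  map_add' k l := map_add 𝒢.π (k : L2Per n W.X) l
  map_smul' c k := map_smul 𝒢.π c (k : L2Per n W.X)
  invFun v := ⟨𝒢.ι v, 𝒢.ι_mem v⟩
  left_inv k := Subtype.ext (𝒢.ι_π k k.2)
  right_inv v := 𝒢.π_ι v

theorem kerEquiv_reduced
    (hG : ∀ h, 𝒢.ι (𝒢.π h) = W.ker0.projectionOnto W.ran0 h3.1 h) (ω : RVec d) (k : W.ker0) :
    𝒢.kerEquiv (reduced h3 ω k) = 𝒢.A₀ ω *ᵥ 𝒢.kerEquiv k := by
  change 𝒢.π (W.ker0.projectionOnto W.ran0 h3.1 (W.L1 ω ⟨k, W.ker0_le_dom k.2⟩)) =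
    𝒢.A₀ ω *ᵥ 𝒢.π k
  rw [← hG, 𝒢.π_ι, A₀_mulVec, 𝒢.ι_π k k.2, 𝒢.L1G_apply]
  congr 2
  apply Subtype.ext
  have h := congrArg Subtype.val (𝒢.g_ι (𝒢.π k))
  simp only [𝒢.ι_π k k.2] at h
  exact h.symm

theorem charpoly_reduced [FiniteDimensional ℂ W.ker0]
    (hG : ∀ h, 𝒢.ι (𝒢.π h) = W.ker0.projectionOnto W.ran0 h3.1 h) (ω : RVec d) :
    (𝒢.A₀ ω).charpoly = (reduced h3 ω).charpoly := by
  rw [← 𝒢.kerEquiv.charpoly_conj, ← Matrix.charpoly_toLin']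
  congr 1
  refine LinearMap.ext fun v => ?_
  rw [LinearEquiv.conj_apply_apply, kerEquiv_reduced hG, LinearEquiv.apply_symm_apply,
    Matrix.toLin'_apply]

theorem finrank_eigenspace_reduced (hH3 : H3 h3) {ω : RVec d} (hω : ‖ω‖ = 1) {l : ℂ}
    (hl : (reduced h3 ω).HasEigenvalue l) :
    Module.finrank ℂ ((reduced h3 ω).eigenspace l) = 1 := by
  have := h3.finiteDimensional
  refine le_antisymm ?_ ?_
  · rw [← hH3 ω hω l hl]
    exact Submodule.finrank_mono ((reduced h3 ω).genEigenspace_le_maximal l 1)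
  · have h0 : (reduced h3 ω).eigenspace l ≠ ⊥ := hl
    exact Submodule.one_le_finrank_iff.2 h0

theorem rootMultiplicity_charpoly_A₀ (hH3 : H3 h3)
    (hG : ∀ h, 𝒢.ι (𝒢.π h) = W.ker0.projectionOnto W.ran0 h3.1 h) {ω : RVec d} (hω : ‖ω‖ = 1)
    {l : ℂ} (hl : (𝒢.A₀ ω).charpoly.IsRoot l) : (𝒢.A₀ ω).charpoly.rootMultiplicity l = 1 := by
  have := h3.finiteDimensional
  rw [charpoly_reduced (h3 := h3) hG] at hl ⊢
  rw [← LinearMap.finrank_maxGenEigenspace_eq]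
  exact hH3 ω hω l (Module.End.hasEigenvalue_iff_isRoot_charpoly _ _ |>.2 hl)

theorem det_Φ_zero (ω : RVec d) (μ : ℂ) :
    (𝒢.Φ ((ω, 0), μ)).det = (-1) ^ (n + 1) * (𝒢.A₀ ω).charpoly.eval μ := by
  rw [Φ_zero, Matrix.eval_charpoly, ← neg_sub, Matrix.det_neg, Fintype.card_fin]

theorem det_Φ_zero_eq_zero_iff (ω : RVec d) (μ : ℂ) :
    (𝒢.Φ ((ω, 0), μ)).det = 0 ↔ (𝒢.A₀ ω).charpoly.IsRoot μ := by
  rw [det_Φ_zero, mul_eq_zero, or_iff_right (pow_ne_zero _ (by norm_num))]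
  rfl

theorem contDiffAt_det_Φ {k : WithTop ℕ∞} {p : (RVec d × ℝ) × ℂ} (hp : IsUnit (𝒢.M p)) :
    ContDiffAt ℝ k (fun p => (𝒢.Φ p).det) p := by
  simp only [Matrix.det_apply]
  refine ContDiffAt.sum fun σ _ => ContDiffAt.const_smul _ ?_
  exact contDiffAt_prod fun i _ => contDiffAt_Φ hp _ _

/-- At `r = 0` the determinant is, up to sign, the characteristic polynomial of `A₀`, whose root is
simple by (H3); its derivative in `μ` is therefore nonzero. -/
theorem exists_local_root (hH3 : H3 h3)
    (hG : ∀ h, 𝒢.ι (𝒢.π h) = W.ker0.projectionOnto W.ran0 h3.1 h) {ω : RVec d} (hω : ‖ω‖ = 1)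
    {l : ℂ} (hl : (𝒢.A₀ ω).charpoly.IsRoot l) :
    ∃ b : RVec d × ℝ → ℂ, ContDiffAt ℝ ⊤ b (ω, 0) ∧ b (ω, 0) = l ∧
      ∀ᶠ v in 𝓝 ((ω, (0 : ℝ)), l), (𝒢.Φ v).det = 0 ↔ v.2 = b v.1 := by
  have hu : IsUnit (𝒢.M ((ω, 0), l)) := M_zero (𝒢 := 𝒢) ω l ▸ isUnit_one
  have hd := ((𝒢.A₀ ω).charpoly.hasDerivAt l).const_mul ((-1 : ℂ) ^ (n + 1))
  simp only [← det_Φ_zero] at hd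
  refine exists_contDiffAt_root (f := fun p => (𝒢.Φ p).det) (contDiffAt_det_Φ hu)
    ((det_Φ_zero_eq_zero_iff ω l).2 hl) ?_ hd
  refine mul_ne_zero (pow_ne_zero _ (by norm_num)) fun h0 => ?_
  have := (Polynomial.one_lt_rootMultiplicity_iff_isRoot
    (Matrix.charpoly_monic (𝒢.A₀ ω)).ne_zero).2 ⟨hl, h0⟩
  rw [rootMultiplicity_charpoly_A₀ hH3 hG hω hl] at this
  exact lt_irrefl _ this

/-- Continue the root to a branch `b(ω, r)`. For small `r > 0` the number `r b(ω, r)` is in the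
spectrum of `L_{rω}`, so `Re b < 0` by (D1); let `r → 0`. -/
theorem re_root_nonpos (hD1 : W.D1) (hH3 : H3 h3)
    (hG : ∀ h, 𝒢.ι (𝒢.π h) = W.ker0.projectionOnto W.ran0 h3.1 h) {ω : RVec d} (hω : ‖ω‖ = 1)
    {l : ℂ} (hl : (𝒢.A₀ ω).charpoly.IsRoot l) : l.re ≤ 0 := by
  obtain ⟨b, hb, hbl, hroot⟩ := exists_local_root hH3 hG hω hl
  have hu : IsUnit (𝒢.M ((ω, 0), l)) := M_zero (𝒢 := 𝒢) ω l ▸ isUnit_one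
  have hc : Filter.Tendsto (fun r : ℝ => ((ω, r), b (ω, r))) (𝓝[>] 0) (𝓝 ((ω, (0 : ℝ)), l)) := by
    have h1 : ContinuousAt (fun r : ℝ => ((ω, r), b (ω, r))) 0 := by
      have h2 : ContinuousAt (fun r : ℝ => (ω, r)) 0 := by fun_prop
      exact h2.prodMk (ContinuousAt.comp (g := b) (f := fun r : ℝ => (ω, r)) hb.continuousAt h2)
    have h3 : Filter.Tendsto (fun r : ℝ => ((ω, r), b (ω, r))) (𝓝[>] 0) (𝓝 ((ω, (0 : ℝ)), b (ω, 0))) :=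
      h1.tendsto.mono_left nhdsWithin_le_nhds
    rwa [hbl] at h3
  have hre : Filter.Tendsto (fun r : ℝ => (b (ω, r)).re) (𝓝[>] 0) (𝓝 l.re) :=
    (Complex.continuous_re.tendsto l).comp ((continuous_snd.tendsto _).comp hc)
  refine le_of_tendsto hre ?_
  have hpi : 0 < Real.pi / W.X := div_pos Real.pi_pos W.X_pos
  have hsmall : ∀ᶠ r : ℝ in 𝓝[>] 0, r < Real.pi / W.X :=
    nhdsWithin_le_nhds (gt_mem_nhds hpi)
  filter_upwards [hc.eventually hroot, hc.eventually (eventually_isUnit_M hu), hsmall,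
    self_mem_nhdsWithin] with r h1 h2 h3 h4
  have h4 : 0 < r := h4
  have h5 := mem_spec h2 (h1.2 rfl)
  have hω0 : ω ≠ 0 := by rintro rfl; simp at hω
  have h6 : |(r • ω) 0| ≤ Real.pi / W.X := by
    rw [PiLp.smul_apply, smul_eq_mul, abs_mul, abs_of_pos h4]
    have : |ω 0| ≤ 1 := hω ▸ (Real.norm_eq_abs (ω 0) ▸ PiLp.norm_apply_le ω 0)
    nlinarith
  have h7 := hD1 (r • ω) h6 (smul_ne_zero h4.ne' hω0) _ h5
  rw [Complex.re_ofReal_mul] at h7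
  nlinarith

/-- `-l` is a root at the antipode `-ω`, where the same one-sided bound applies. -/
theorem re_root_eq_zero (hD1 : W.D1) (hH3 : H3 h3)
    (hG : ∀ h, 𝒢.ι (𝒢.π h) = W.ker0.projectionOnto W.ran0 h3.1 h) {ω : RVec d} (hω : ‖ω‖ = 1)
    {l : ℂ} (hl : (𝒢.A₀ ω).charpoly.IsRoot l) : l.re = 0 := by
  refine le_antisymm (re_root_nonpos hD1 hH3 hG hω hl) ?_
  have h1 : (𝒢.A₀ (-ω)).charpoly.IsRoot (-l) := by
    rw [Polynomial.IsRoot.def, Matrix.eval_charpoly] at hl ⊢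
    rw [A₀_neg, map_neg, neg_sub_neg, ← neg_sub, Matrix.det_neg, hl, mul_zero]
  have h2 := re_root_nonpos hD1 hH3 hG (by rwa [norm_neg]) h1
  simpa using h2

/-- The eigenvalues of `Π₀ L¹_ω` are purely imaginary and distinct. -/
theorem exists_strictMono_roots (hD1 : W.D1) (hH3 : H3 h3)
    (hG : ∀ h, 𝒢.ι (𝒢.π h) = W.ker0.projectionOnto W.ran0 h3.1 h) {ω : RVec d} (hω : ‖ω‖ = 1) :
    ∃ a : Fin (n + 1) → ℝ, StrictMono a ∧
      ∀ μ : ℂ, (𝒢.A₀ ω).charpoly.IsRoot μ ↔ ∃ j, μ = a j * Complex.I := by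
  set P := (𝒢.A₀ ω).charpoly with hP
  have hP0 : P ≠ 0 := (Matrix.charpoly_monic (𝒢.A₀ ω)).ne_zero
  have hnodup : P.roots.Nodup := by
    rw [Multiset.nodup_iff_count_le_one]
    intro a
    rw [Polynomial.count_roots]
    by_cases ha : P.IsRoot a
    · exact (rootMultiplicity_charpoly_A₀ hH3 hG hω ha).le
    · rw [Polynomial.rootMultiplicity_eq_zero ha]; exact zero_le_one
  have hcard : P.roots.toFinset.card = n + 1 := by
    rw [Multiset.toFinset_card_of_nodup hnodup, IsAlgClosed.card_roots_eq_natDegree, hP,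
      Matrix.charpoly_natDegree_eq_dim, Fintype.card_fin]
  have hmem {μ} : μ ∈ P.roots.toFinset ↔ P.IsRoot μ := by
    rw [Multiset.mem_toFinset, Polynomial.mem_roots hP0]
  have him {μ} (h : P.IsRoot μ) : μ = μ.im * Complex.I := by
    apply Complex.ext
    · simpa using re_root_eq_zero hD1 hH3 hG hω h
    · simp
  have hinj : Set.InjOn Complex.im (P.roots.toFinset : Set ℂ) := by
    intro x hx y hy hxy
    rw [him (hmem.1 hx), him (hmem.1 hy), hxy]
  have hT : (P.roots.toFinset.image Complex.im).card = n + 1 := by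
    rw [Finset.card_image_of_injOn hinj, hcard]
  refine ⟨(P.roots.toFinset.image Complex.im).orderEmbOfFin hT,
    (OrderEmbedding.strictMono _), fun μ => ?_⟩
  have hrange := Finset.range_orderEmbOfFin _ hT
  constructor
  · intro h
    have : μ.im ∈ Set.range ((P.roots.toFinset.image Complex.im).orderEmbOfFin hT) := by
      rw [hrange]
      exact Finset.mem_coe.2 (Finset.mem_image_of_mem _ (hmem.2 h))
    obtain ⟨j, hj⟩ := this
    exact ⟨j, by rw [hj]; exact him h⟩
  · rintro ⟨j, rfl⟩
    have : (P.roots.toFinset.image Complex.im).orderEmbOfFin hT j ∈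
        P.roots.toFinset.image Complex.im := Finset.orderEmbOfFin_mem _ hT j
    obtain ⟨z, hz, hzj⟩ := Finset.mem_image.1 this
    rw [← hzj, ← him (hmem.1 hz)]
    exact hmem.1 hz

end Green
end PeriodicWave
end Bloch

/-- The enumeration of a finite set by increasing imaginary part is unique; this makes local
labellings of the roots agree on overlaps. -/
theorem eq_of_strictMono_im {N : ℕ} {b b' : Fin N → ℂ} (hb : StrictMono fun j => (b j).im)
    (hb' : StrictMono fun j => (b' j).im) (h : ∀ μ, (∃ j, μ = b j) ↔ ∃ j, μ = b' j) : b = b' := by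
  have hr : (fun j => (b j).im) = fun j => (b' j).im := by
    refine (StrictMono.range_inj hb hb').1 ?_
    ext x
    constructor
    · rintro ⟨j, rfl⟩
      obtain ⟨i, hi⟩ := (h (b j)).1 ⟨j, rfl⟩
      exact ⟨i, congrArg Complex.im hi.symm⟩
    · rintro ⟨j, rfl⟩
      obtain ⟨i, hi⟩ := (h (b' j)).2 ⟨j, rfl⟩
      exact ⟨i, congrArg Complex.im hi.symm⟩
  ext1 j
  obtain ⟨i, hi⟩ := (h (b j)).1 ⟨j, rfl⟩
  have h1 : (b' j).im = (b' i).im := by rw [← hi]; exact (congrFun hr j).symm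
  rw [hi, hb'.injective h1]

namespace Bloch
namespace PeriodicWave
namespace Green

open scoped Matrix Topology

variable {n d : ℕ} [NeZero d] {W : PeriodicWave n d} {𝒢 : Green W} {h3 : W.D3}

/-- Near `r = 0` the scaled eigenvalues are smooth functions. -/
theorem exists_local_roots (hD1 : W.D1) (hH3 : H3 h3)
    (hG : ∀ h, 𝒢.ι (𝒢.π h) = W.ker0.projectionOnto W.ran0 h3.1 h) {C : ℝ}
    (hC : ∀ ω : RVec d, ‖ω‖ = 1 → ∀ μ, (𝒢.Φ ((ω, 0), μ)).det = 0 → ‖μ‖ < C)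
    {ω : RVec d} (hω : ‖ω‖ = 1) :
    ∃ b : RVec d × ℝ → Fin (n + 1) → ℂ, ContDiffAt ℝ ⊤ b (ω, 0) ∧
      ∀ᶠ p in 𝓝 (ω, (0 : ℝ)), (StrictMono fun j => (b p j).im) ∧
        ∀ μ, ((𝒢.Φ (p, μ)).det = 0 ∧ ‖μ‖ ≤ C) ↔ ∃ j, μ = b p j := by
  obtain ⟨a, ha, hroot⟩ := exists_strictMono_roots hD1 hH3 hG hω
  have hr (j) : (𝒢.A₀ ω).charpoly.IsRoot (a j * Complex.I) := (hroot _).2 ⟨j, rfl⟩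
  choose b hb hb0 hbr using fun j => exists_local_root hH3 hG hω (hr j)
  refine ⟨fun p j => b j p, contDiffAt_pi.2 hb, ?_⟩
  have hcont (j) : ContinuousAt (b j) (ω, 0) := (hb j).continuousAt
  have h1 : ∀ᶠ p in 𝓝 (ω, (0 : ℝ)), ∀ i j, i < j → (b i p).im < (b j p).im := by
    simp only [Filter.eventually_all]
    intro i j hij
    refine (Complex.continuous_im.continuousAt.comp (hcont i)).eventually_lt
      (Complex.continuous_im.continuousAt.comp (hcont j)) ?_
    simp only [Function.comp_apply, hb0]
    simpa using ha hij
  have h2 : ∀ᶠ p in 𝓝 (ω, (0 : ℝ)), ∀ j, ‖b j p‖ < C := by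
    refine Filter.eventually_all.2 fun j => ?_
    refine (hcont j).norm.eventually_lt continuousAt_const ?_
    rw [hb0]
    exact hC ω hω _ ((det_Φ_zero_eq_zero_iff _ _).2 (hr j))
  have h4 : ∀ᶠ p in 𝓝 (ω, (0 : ℝ)), ∀ j, (𝒢.Φ (p, b j p)).det = 0 := by
    refine Filter.eventually_all.2 fun j => ?_
    have hc : Filter.Tendsto (fun p => (p, b j p)) (𝓝 (ω, (0 : ℝ)))
        (𝓝 ((ω, (0 : ℝ)), a j * Complex.I)) := by
      rw [← hb0 j]
      exact continuousAt_id.prodMk (hcont j)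
    filter_upwards [hc.eventually (hbr j)] with p hp
    exact hp.2 rfl
  -- No further roots enter the ball: near each of its points either the local branch is the only
  -- root or the determinant stays nonzero, and compactness makes this uniform in `μ`.
  have h5 : ∀ᶠ p in 𝓝 (ω, (0 : ℝ)), ∀ μ ∈ Metric.closedBall (0 : ℂ) C,
      (𝒢.Φ (p, μ)).det = 0 → ∃ j, μ = b j p := by
    refine (isCompact_closedBall (0 : ℂ) C).eventually_forall_of_forall_eventually fun μ _ => ?_
    by_cases hμ : (𝒢.A₀ ω).charpoly.IsRoot μ
    · obtain ⟨j, rfl⟩ := (hroot μ).1 hμ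
      filter_upwards [hbr j] with v hv h0
      exact ⟨j, hv.1 h0⟩
    · have hu : IsUnit (𝒢.M ((ω, 0), μ)) := M_zero (𝒢 := 𝒢) ω μ ▸ isUnit_one
      have hcd : ContinuousAt (fun p => (𝒢.Φ p).det) ((ω, 0), μ) :=
        (contDiffAt_det_Φ (k := 0) hu).continuousAt
      filter_upwards [hcd.eventually_ne (fun h => hμ ((det_Φ_zero_eq_zero_iff _ _).1 h))]
        with v hv h0
      exact absurd h0 hv
  filter_upwards [h1, h2, h4, h5] with p p1 p2 p4 p5
  refine ⟨fun i j hij => p1 i j hij, fun μ => ⟨fun h => ?_, ?_⟩⟩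
  · exact p5 μ (by simpa using h.2) h.1
  · rintro ⟨j, rfl⟩
    exact ⟨p4 j, (p2 j).le⟩

/-- The scaled eigenvalues, labelled by increasing imaginary part. -/
theorem exists_roots (hD1 : W.D1) (hH3 : H3 h3)
    (hG : ∀ h, 𝒢.ι (𝒢.π h) = W.ker0.projectionOnto W.ran0 h3.1 h) {C : ℝ}
    (hC : ∀ ω : RVec d, ‖ω‖ = 1 → ∀ μ, (𝒢.Φ ((ω, 0), μ)).det = 0 → ‖μ‖ < C) :
    ∃ m : RVec d × ℝ → Fin (n + 1) → ℂ, ∀ ω : RVec d, ‖ω‖ = 1 → ∀ᶠ p in 𝓝 (ω, (0 : ℝ)),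
      ContDiffAt ℝ ⊤ m p ∧ (StrictMono fun j => (m p j).im) ∧
        ∀ μ, ((𝒢.Φ (p, μ)).det = 0 ∧ ‖μ‖ ≤ C) ↔ ∃ j, μ = m p j := by
  classical
  let Q (p : RVec d × ℝ) (b : Fin (n + 1) → ℂ) : Prop :=
    (StrictMono fun j => (b j).im) ∧
      ∀ μ, ((𝒢.Φ (p, μ)).det = 0 ∧ ‖μ‖ ≤ C) ↔ ∃ j, μ = b j
  have hQ {p b b'} (h : Q p b) (h' : Q p b') : b = b' :=
    eq_of_strictMono_im h.1 h'.1 fun μ => (h.2 μ).symm.trans (h'.2 μ)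
  let m (p : RVec d × ℝ) : Fin (n + 1) → ℂ := if h : ∃ b, Q p b then h.choose else 0
  have hm {p b} (h : Q p b) : m p = b := by
    have hex : ∃ b, Q p b := ⟨b, h⟩
    simp only [m, dif_pos hex]
    exact hQ hex.choose_spec h
  refine ⟨m, fun ω hω => ?_⟩
  -- The branches carry the analytic order `⊤`, not just `∞`: analyticity at a point spreads to a
  -- neighbourhood, whereas for `C^∞` at a point the neighbourhood could shrink with the order.
  obtain ⟨b, hb, hev⟩ := exists_local_roots hD1 hH3 hG hC hω
  filter_upwards [hb.eventually (by simp), hev.eventually_nhds] with p h1 h2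
  have h3 : m =ᶠ[𝓝 p] b := h2.mono fun p' hp' => hm hp'
  refine ⟨h1.congr_of_eventuallyEq h3, ?_⟩
  rw [h3.self_of_nhds]
  exact h2.self_of_nhds

end Green
end PeriodicWave
end Bloch

/-! ### Sections of real line fields over two caps and their complex gluing. -/

namespace LineField

open scoped Topology RealInnerProductSpace

/-- Discrete parallel transport of a vector along segments gives a smooth nonvanishing section of
the ranges of a smooth family of projections. -/
theorem exists_section_of_segments {V E : Type*} [NormedAddCommGroup V] [NormedSpace ℝ V]
    [NormedAddCommGroup E] [NormedSpace ℝ E] {T : V → E →L[ℝ] E}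
    (hT : ∀ x ≠ 0, ContDiffAt ℝ (⊤ : ℕ∞) T x) (hidem : ∀ x ≠ 0, ∀ v, T x (T x v) = T x v)
    {C : Set V} (hC : IsCompact C) {y : V} {u : E} (hu0 : u ≠ 0) (hu : T y u = u)
    (hseg : ∀ x ∈ C, ∀ t ∈ Set.Icc (0 : ℝ) 1, AffineMap.lineMap y x t ≠ (0 : V)) :
    ∃ v : V → E, ∀ x ∈ C, ContDiffAt ℝ (⊤ : ℕ∞) v x ∧ v x ≠ 0 ∧ T x (v x) = v x := by
  let F : V × ℝ → E →L[ℝ] E := fun q => T (AffineMap.lineMap y q.1 q.2)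
  have hline : ContDiff ℝ (⊤ : ℕ∞) fun q : V × ℝ => (AffineMap.lineMap y q.1 q.2 : V) := by
    simp only [AffineMap.lineMap_apply, vsub_eq_sub, vadd_eq_add]
    fun_prop
  have hF : ∀ x ∈ C, ∀ t ∈ Set.Icc (0 : ℝ) 1, ContDiffAt ℝ (⊤ : ℕ∞) F (x, t) :=
    fun x hx t ht => (hT _ (hseg x hx t ht)).comp (x, t) hline.contDiffAt
  have hK : IsCompact (C ×ˢ Set.Icc (0 : ℝ) 1) := hC.prod isCompact_Icc
  have hFc : ContinuousOn F (C ×ˢ Set.Icc (0 : ℝ) 1) := fun q hq =>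
    (hF q.1 hq.1 q.2 hq.2).continuousAt.continuousWithinAt
  -- The mesh is so fine that consecutive projections along every segment differ by less than `1` in
  -- norm; each projection then cannot kill a nonzero vector of the preceding range.
  obtain ⟨δ, hδ, hunif⟩ := Metric.uniformContinuousOn_iff.1 (hK.uniformContinuousOn_of_continuous hFc) 1
    one_pos
  obtain ⟨m, hm⟩ := exists_nat_one_div_lt hδ
  set τ : ℕ → ℝ := fun i => i / (m + 1 : ℝ) with hτ
  have hm0 : (0 : ℝ) < m + 1 := by positivity
  have hτI : ∀ i ≤ m + 1, τ i ∈ Set.Icc (0 : ℝ) 1 := fun i hi =>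
    ⟨by positivity, by rw [hτ]; simp only; rw [div_le_one hm0]; exact_mod_cast hi⟩
  let v : ℕ → V → E := fun i => Nat.rec (fun _ => u) (fun i w x => F (x, τ (i + 1)) (w x)) i
  have hv (i : ℕ) (x : V) : v (i + 1) x = F (x, τ (i + 1)) (v i x) := rfl
  have key : ∀ i ≤ m + 1, ∀ x ∈ C,
      ContDiffAt ℝ (⊤ : ℕ∞) (v i) x ∧ v i x ≠ 0 ∧ F (x, τ i) (v i x) = v i x := by
    intro i
    induction i with
    | zero =>
      intro _ x hx
      refine ⟨contDiffAt_const, hu0, ?_⟩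
      simpa [F, τ, v] using hu
    | succ i ih =>
      intro hi x hx
      obtain ⟨h1, h2, h3⟩ := ih (by omega) x hx
      have hi1 := hτI (i + 1) hi
      refine ⟨?_, fun h0 => ?_, ?_⟩
      · have h4 : ContDiffAt ℝ (⊤ : ℕ∞) (fun x => F (x, τ (i + 1))) x :=
          (hF x hx _ hi1).comp (f := fun x => (x, τ (i + 1))) x (by fun_prop)
        exact h4.clm_apply h1
      · have h4 : dist (F (x, τ i)) (F (x, τ (i + 1))) < 1 := by
          refine hunif _ ⟨hx, hτI i (by omega)⟩ _ ⟨hx, hi1⟩ ?_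
          rw [Prod.dist_eq, dist_self, max_eq_right dist_nonneg, Real.dist_eq]
          refine lt_of_eq_of_lt ?_ hm
          have : τ i - τ (i + 1) = -(1 / (m + 1 : ℝ)) := by
            simp only [hτ]; push_cast; field_simp; ring
          rw [this, abs_neg, abs_of_pos (by positivity)]
        rw [hv] at h0
        -- If the next projection killed `v i x`, the difference of the two would fix it, although
        -- its norm is below `1`.
        have h5 : (F (x, τ i) - F (x, τ (i + 1))) (v i x) = v i x := by
          rw [_root_.sub_apply, h3, h0, sub_zero]
        have h6 := (F (x, τ i) - F (x, τ (i + 1))).le_opNorm (v i x)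
        rw [h5, ← dist_eq_norm] at h6
        have h7 : 0 < ‖v i x‖ := norm_pos_iff.2 h2
        nlinarith
      · rw [hv]
        exact hidem _ (hseg x hx _ hi1) _
  refine ⟨v (m + 1), fun x hx => ?_⟩
  obtain ⟨h1, h2, h3⟩ := key (m + 1) le_rfl x hx
  refine ⟨h1, h2, ?_⟩
  have : τ (m + 1) = 1 := by simp only [hτ]; push_cast; exact div_self hm0.ne'
  simpa [F, this] using h3

variable {d N : ℕ}

/-- The spherical cap on which `σ x₀ ≥ -1/2`. -/
def cap (d : ℕ) [NeZero d] (σ : ℝ) : Set (EuclideanSpace ℝ (Fin d)) :=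
  {x | ‖x‖ = 1 ∧ -(1 / 2) ≤ σ * x 0}

theorem isCompact_cap [NeZero d] (σ : ℝ) : IsCompact (cap d σ) := by
  have h : cap d σ = Metric.sphere 0 1 ∩ {x | -(1 / 2) ≤ σ * x 0} := by
    ext x; simp [cap]
  rw [h]
  refine (isCompact_sphere _ _).inter_right (isClosed_le continuous_const ?_)
  exact continuous_const.mul (EuclideanSpace.proj (𝕜 := ℝ) (0 : Fin d)).continuous

/-- The cap is star-shaped from its pole `y = σ e₀` in the needed sense: a chord from `y` passes
through `0` only when it ends at `-y`, where `σ x₀ = -1` is below `-1/2`. -/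
theorem exists_section_cap [NeZero d] {E : Type*} [NormedAddCommGroup E] [NormedSpace ℝ E]
    {T : EuclideanSpace ℝ (Fin d) → E →L[ℝ] E}
    (hT : ∀ x ≠ 0, ContDiffAt ℝ (⊤ : ℕ∞) T x) (hidem : ∀ x ≠ 0, ∀ v, T x (T x v) = T x v)
    (hne : ∀ x ≠ 0, ∃ v ≠ 0, T x v = v) {σ : ℝ} (hσ : |σ| = 1) :
    ∃ v : EuclideanSpace ℝ (Fin d) → E, ∀ x ∈ cap d σ,
      ContDiffAt ℝ (⊤ : ℕ∞) v x ∧ v x ≠ 0 ∧ T x (v x) = v x := by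
  have hσ2 : σ * σ = 1 := by rw [← abs_mul_abs_self, hσ, one_mul]
  let y : EuclideanSpace ℝ (Fin d) := EuclideanSpace.single 0 σ
  have hyn : ‖y‖ = 1 := by simp [y, hσ]
  have hy0 : y ≠ 0 := by rintro h; rw [h, norm_zero] at hyn; exact zero_ne_one hyn
  obtain ⟨u, hu0, hu⟩ := hne y hy0
  refine exists_section_of_segments hT hidem (isCompact_cap σ) hu0 hu fun x hx t ht h0 => ?_
  rw [AffineMap.lineMap_apply_module] at h0
  have h1 : (1 - t) = t := by
    have h2 : ‖(1 - t) • y‖ = ‖t • x‖ := by rw [eq_neg_of_add_eq_zero_left h0, norm_neg]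
    rwa [norm_smul, norm_smul, hyn, hx.1, mul_one, mul_one, Real.norm_of_nonneg ht.1,
      Real.norm_of_nonneg (by linarith [ht.2])] at h2
  have h3 := congrArg (fun z : EuclideanSpace ℝ (Fin d) => z 0) h0
  simp only [PiLp.add_apply, PiLp.smul_apply, smul_eq_mul, PiLp.zero_apply, h1] at h3
  have h4 : y 0 = σ := by simp [y]
  rw [h4] at h3
  have h5 : t = 1 / 2 := by linarith
  have h6 := hx.2
  rw [h5] at h3
  have h7 : x 0 = -σ := by linarith
  rw [h7] at h6
  linarith

/-- A complex section over the sphere glued from real sections over two caps. -/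
theorem exists_glued_section [NeZero d] {vp vm : EuclideanSpace ℝ (Fin d) → EuclideanSpace ℝ (Fin N)}
    {gp gm : EuclideanSpace ℝ (Fin d) → ℂ}
    (hvp : ∀ x ∈ cap d 1, ContDiffAt ℝ (⊤ : ℕ∞) vp x ∧ vp x ≠ 0)
    (hvm : ∀ x ∈ cap d (-1), ContDiffAt ℝ (⊤ : ℕ∞) vm x ∧ vm x ≠ 0)
    (hgp : ∀ x ∈ cap d 1, ContDiffAt ℝ (⊤ : ℕ∞) gp x ∧ gp x ≠ 0)
    (hgm : ∀ x ∈ cap d (-1), ContDiffAt ℝ (⊤ : ℕ∞) gm x ∧ gm x ≠ 0)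
    (hband : ∀ x ∈ cap d 1 ∩ cap d (-1), ∃ σ : ℝ, gm x = σ * gp x ∧ 0 < σ * ⟪vp x, vm x⟫) :
    ∃ s : EuclideanSpace ℝ (Fin d) → Fin N → ℂ, ∀ x, ‖x‖ = 1 →
      ContDiffAt ℝ (⊤ : ℕ∞) s x ∧ s x ≠ 0 ∧
      ∃ a b : ℂ, (a ≠ 0 → x ∈ cap d 1) ∧ (b ≠ 0 → x ∈ cap d (-1)) ∧
        s x = fun i => a * vp x i + b * vm x i := by
  -- The cutoff is `0` for `x₀ ≤ -1/4` and `1` for `x₀ ≥ 1/4`, so it is already constant near and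
  -- beyond the edges `x₀ = ±1/2` of the overlap band.
  let χ : EuclideanSpace ℝ (Fin d) → ℝ := fun x => Real.smoothTransition (2 * x 0 + 1 / 2)
  have hproj : ContDiff ℝ (⊤ : ℕ∞) fun x : EuclideanSpace ℝ (Fin d) => x 0 :=
    (EuclideanSpace.proj (𝕜 := ℝ) (0 : Fin d)).contDiff
  have hχ : ContDiff ℝ (⊤ : ℕ∞) χ :=
    Real.smoothTransition.contDiff.comp ((contDiff_const.mul hproj).add contDiff_const)
  have hχC : ContDiff ℝ (⊤ : ℕ∞) fun x => (χ x : ℂ) := Complex.ofRealCLM.contDiff.comp hχ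
  have hχ0 {x : EuclideanSpace ℝ (Fin d)} (hx : x 0 ≤ -(1 / 4)) : χ x = 0 :=
    Real.smoothTransition.zero_of_nonpos (by linarith)
  have hχ1 {x : EuclideanSpace ℝ (Fin d)} (hx : 1 / 4 ≤ x 0) : χ x = 1 :=
    Real.smoothTransition.one_of_one_le (by linarith)
  let sp : EuclideanSpace ℝ (Fin d) → Fin N → ℂ := fun x i => gp x * vp x i
  let sm : EuclideanSpace ℝ (Fin d) → Fin N → ℂ := fun x i => gm x * vm x i
  have hcoord {v : EuclideanSpace ℝ (Fin d) → EuclideanSpace ℝ (Fin N)} {x}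
      (hv : ContDiffAt ℝ (⊤ : ℕ∞) v x) (i) : ContDiffAt ℝ (⊤ : ℕ∞) (fun x => (v x i : ℂ)) x :=
    (Complex.ofRealCLM ∘L EuclideanSpace.proj (𝕜 := ℝ) i).contDiff.contDiffAt.comp x hv
  have hsp : ∀ x ∈ cap d 1, ContDiffAt ℝ (⊤ : ℕ∞) sp x := fun x hx =>
    contDiffAt_pi.2 fun i => (hgp x hx).1.mul (hcoord (hvp x hx).1 i)
  have hsm : ∀ x ∈ cap d (-1), ContDiffAt ℝ (⊤ : ℕ∞) sm x := fun x hx =>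
    contDiffAt_pi.2 fun i => (hgm x hx).1.mul (hcoord (hvm x hx).1 i)
  let s : EuclideanSpace ℝ (Fin d) → Fin N → ℂ := fun x i =>
    (χ x : ℂ) * (gp x * vp x i) + (1 - (χ x : ℂ)) * (gm x * vm x i)
  have hs {x} (h1 : ContDiffAt ℝ (⊤ : ℕ∞) sp x) (h2 : ContDiffAt ℝ (⊤ : ℕ∞) sm x) :
      ContDiffAt ℝ (⊤ : ℕ∞) s x :=
    contDiffAt_pi.2 fun i => (hχC.contDiffAt.mul (contDiffAt_pi.1 h1 i)).add
      ((contDiffAt_const.sub hχC.contDiffAt).mul (contDiffAt_pi.1 h2 i))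
  refine ⟨s, fun x hx => ?_⟩
  have hne {g : ℂ} {v : EuclideanSpace ℝ (Fin N)} (hg : g ≠ 0) (hv : v ≠ 0) :
      (fun i => g * (v i : ℂ)) ≠ (0 : Fin N → ℂ) := by
    intro h
    refine hv ?_
    ext i
    have := congrFun h i
    simpa [hg] using this
  rcases lt_or_ge (1 / 2) (x 0) with h | h
  · have hxp : x ∈ cap d 1 := ⟨hx, by linarith⟩
    have hev : s =ᶠ[𝓝 x] sp := by
      filter_upwards [hproj.continuous.continuousAt.eventually (lt_mem_nhds h)] with z hz
      ext i
      simp only [s, sp, hχ1 (show 1 / 4 ≤ z 0 by linarith)]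
      simp
    refine ⟨(hsp x hxp).congr_of_eventuallyEq hev, ?_, gp x, 0, fun _ => hxp,
      fun h => absurd rfl h, ?_⟩
    · rw [hev.self_of_nhds]
      exact hne (hgp x hxp).2 (hvp x hxp).2
    · rw [hev.self_of_nhds]
      simp [sp]
  rcases lt_or_ge (x 0) (-(1 / 2)) with h' | h'
  · have hxm : x ∈ cap d (-1) := ⟨hx, by linarith⟩
    have hev : s =ᶠ[𝓝 x] sm := by
      filter_upwards [hproj.continuous.continuousAt.eventually (gt_mem_nhds h')] with z hz
      ext i
      simp only [s, sm, hχ0 (show z 0 ≤ -(1 / 4) by linarith)]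
      simp
    refine ⟨(hsm x hxm).congr_of_eventuallyEq hev, ?_, 0, gm x, fun h => absurd rfl h,
      fun _ => hxm, ?_⟩
    · rw [hev.self_of_nhds]
      exact hne (hgm x hxm).2 (hvm x hxm).2
    · rw [hev.self_of_nhds]
      simp [sm]
  have hxp : x ∈ cap d 1 := ⟨hx, by linarith⟩
  have hxm : x ∈ cap d (-1) := ⟨hx, by linarith⟩
  obtain ⟨σ, hσ, hpos⟩ := hband x ⟨hxp, hxm⟩
  -- On the band both terms share the phase `gp x`, up to the real factor `σ`. The remaining real
  -- vector is nonzero because its inner product with `vp x` is positive.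
  have hform : s x = fun i => gp x *
      (((χ x) • vp x + ((1 - χ x) * σ) • vm x : EuclideanSpace ℝ (Fin N)) i : ℂ) := by
    ext i
    simp only [s, hσ, PiLp.add_apply, PiLp.smul_apply, smul_eq_mul]
    push_cast
    ring
  refine ⟨hs (hsp x hxp) (hsm x hxm), ?_, χ x * gp x, (1 - χ x) * gm x, fun _ => hxp,
    fun _ => hxm, ?_⟩
  · rw [hform]
    refine hne (hgp x hxp).2 fun h0 => ?_
    have h1 := congrArg (fun z => ⟪vp x, z⟫) h0
    simp only [inner_add_right, inner_smul_right, inner_zero_right, real_inner_self_eq_norm_sq]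
      at h1
    have h2 : 0 < ‖vp x‖ ^ 2 := by have := norm_pos_iff.2 (hvp x hxp).2; positivity
    have h3 : 0 ≤ χ x := Real.smoothTransition.nonneg _
    have h4 : χ x ≤ 1 := Real.smoothTransition.le_one _
    rcases h3.eq_or_lt with h5 | h5
    · rw [← h5] at h1
      nlinarith
    · nlinarith [mul_pos h5 h2, mul_nonneg (sub_nonneg.2 h4) hpos.le]
  · ext i
    simp only [s]
    ring

end LineField

/-! ### The overlap band in cylindrical coordinates and the phases over the circle. -/

namespace LineField

open scoped Topology RealInnerProductSpace

variable {m N : ℕ}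

/-- Cylindrical coordinates on the sphere. -/
def cyl (m : ℕ) (q : ℝ × EuclideanSpace ℝ (Fin m)) : EuclideanSpace ℝ (Fin (m + 1)) :=
  WithLp.toLp 2 (Fin.cons q.1 fun i => √(1 - q.1 ^ 2) * q.2 i)

theorem continuous_cyl : Continuous (cyl m) := by
  refine (PiLp.continuous_toLp 2 _).comp (continuous_pi fun i => ?_)
  refine Fin.cases ?_ (fun i => ?_) i
  · simpa using continuous_fst
  · simp only [Fin.cons_succ]
    have h : Continuous fun q : ℝ × EuclideanSpace ℝ (Fin m) => q.2 i :=
      (EuclideanSpace.proj (𝕜 := ℝ) i).continuous.comp continuous_snd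
    fun_prop

theorem cyl_zero (q : ℝ × EuclideanSpace ℝ (Fin m)) : cyl m q 0 = q.1 := rfl

theorem cyl_succ (q : ℝ × EuclideanSpace ℝ (Fin m)) (i : Fin m) :
    cyl m q i.succ = √(1 - q.1 ^ 2) * q.2 i := rfl

theorem mem_cap_iff {x : EuclideanSpace ℝ (Fin (m + 1))} :
    x ∈ cap (m + 1) 1 ∩ cap (m + 1) (-1) ↔ ‖x‖ = 1 ∧ x 0 ∈ Set.Icc (-(1 / 2)) (1 / 2 : ℝ) := by
  constructor
  · rintro ⟨⟨h1, h2⟩, _, h3⟩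
    exact ⟨h1, by linarith, by linarith⟩
  · rintro ⟨h1, h2, h3⟩
    exact ⟨⟨h1, by linarith⟩, h1, by linarith⟩

theorem cyl_mem {q : ℝ × EuclideanSpace ℝ (Fin m)} (h1 : q.1 ∈ Set.Icc (-(1 / 2)) (1 / 2 : ℝ))
    (h2 : ‖q.2‖ = 1) : cyl m q ∈ cap (m + 1) 1 ∩ cap (m + 1) (-1) := by
  refine mem_cap_iff.2 ⟨?_, h1⟩
  have h3 : (0 : ℝ) ≤ 1 - q.1 ^ 2 := by nlinarith [h1.1, h1.2]
  have h4 : ‖cyl m q‖ ^ 2 = 1 := by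
    rw [EuclideanSpace.real_norm_sq_eq, Fin.sum_univ_succ]
    simp only [cyl_zero, cyl_succ, mul_pow, Real.sq_sqrt h3, ← Finset.mul_sum]
    rw [← EuclideanSpace.real_norm_sq_eq, h2]
    ring
  exact (pow_eq_one_iff_of_nonneg (norm_nonneg _) two_ne_zero).1 h4

theorem exists_cyl_eq {x : EuclideanSpace ℝ (Fin (m + 1))}
    (hx : x ∈ cap (m + 1) 1 ∩ cap (m + 1) (-1)) :
    ∃ q : ℝ × EuclideanSpace ℝ (Fin m), q.1 ∈ Set.Icc (-(1 / 2)) (1 / 2 : ℝ) ∧ ‖q.2‖ = 1 ∧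
      cyl m q = x := by
  obtain ⟨h1, h2⟩ := mem_cap_iff.1 hx
  have h3 : (0 : ℝ) < 1 - x 0 ^ 2 := by nlinarith [h2.1, h2.2]
  have h4 := Real.sqrt_pos.2 h3
  have h5 : ∑ i : Fin m, x i.succ ^ 2 = 1 - x 0 ^ 2 := by
    have : ‖x‖ ^ 2 = 1 := by rw [h1, one_pow]
    rw [EuclideanSpace.real_norm_sq_eq, Fin.sum_univ_succ] at this
    linarith
  refine ⟨(x 0, WithLp.toLp 2 fun i => x i.succ / √(1 - x 0 ^ 2)), h2, ?_, ?_⟩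
  · have h6 : ‖(WithLp.toLp 2 fun i => x i.succ / √(1 - x 0 ^ 2) : EuclideanSpace ℝ (Fin m))‖ ^ 2
        = 1 := by
      rw [EuclideanSpace.real_norm_sq_eq]
      simp only [div_pow, Real.sq_sqrt h3.le, ← Finset.sum_div, h5]
      exact div_self h3.ne'
    exact (pow_eq_one_iff_of_nonneg (norm_nonneg _) two_ne_zero).1 h6
  · ext i
    refine Fin.cases rfl (fun i => ?_) i
    rw [cyl_succ]
    exact mul_div_cancel₀ _ h4.ne'

/-- A nonvanishing continuous function on the band has constant sign on the part lying over a
connected set of directions. -/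
theorem exists_sign {h : EuclideanSpace ℝ (Fin (m + 1)) → ℝ}
    (hc : ContinuousOn h (cap (m + 1) 1 ∩ cap (m + 1) (-1)))
    (h0 : ∀ x ∈ cap (m + 1) 1 ∩ cap (m + 1) (-1), h x ≠ 0)
    {A : Set (EuclideanSpace ℝ (Fin m))} (hA : IsPreconnected A) (hA1 : ∀ η ∈ A, ‖η‖ = 1) :
    ∃ σ : ℝ, |σ| = 1 ∧ ∀ q : ℝ × EuclideanSpace ℝ (Fin m),
      q.1 ∈ Set.Icc (-(1 / 2)) (1 / 2 : ℝ) → q.2 ∈ A → 0 < σ * h (cyl m q) := by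
  set S := Set.Icc (-(1 / 2)) (1 / 2 : ℝ) ×ˢ A with hS
  have hSc : IsPreconnected S := isPreconnected_Icc.prod hA
  have hmaps : ∀ q ∈ S, cyl m q ∈ cap (m + 1) 1 ∩ cap (m + 1) (-1) := fun q hq =>
    cyl_mem hq.1 (hA1 _ hq.2)
  have hcont : ContinuousOn (fun q => h (cyl m q)) S :=
    hc.comp continuous_cyl.continuousOn hmaps
  by_cases hpos : ∀ q ∈ S, 0 < h (cyl m q)
  · exact ⟨1, by simp, fun q h1 h2 => by simpa using hpos q ⟨h1, h2⟩⟩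
  · push Not at hpos
    obtain ⟨q, hq, hq0⟩ := hpos
    refine ⟨-1, by simp, fun q' h1 h2 => ?_⟩
    by_contra hneg
    have hq' : 0 ≤ h (cyl m q') := by linarith
    obtain ⟨z, hz, hz0⟩ := hSc.intermediate_value hq ⟨h1, h2⟩ hcont ⟨hq0, hq'⟩
    exact h0 _ (hmaps z hz) hz0

/-- `exp (log w / 2)` is the principal square root. Passing from `w` to `-w` multiplies it by `i`
below the real axis and by `-i` above; this change of sign undoes the Möbius twist. -/
theorem exp_half_log_neg_of_im_neg {w : ℂ} (hw : w.im < 0) :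
    Complex.exp (Complex.log (-w) / 2) = Complex.I * Complex.exp (Complex.log w / 2) := by
  have h1 : Complex.log (-w) = Complex.log w + Real.pi * Complex.I := by
    rw [Complex.log, Complex.log, norm_neg, Complex.arg_neg_eq_arg_add_pi_of_im_neg hw]
    push_cast
    ring
  rw [h1, add_div, Complex.exp_add, mul_comm, show (Real.pi : ℂ) * Complex.I / 2 =
    (Real.pi / 2 : ℂ) * Complex.I by ring, Complex.exp_pi_div_two_mul_I]

theorem exp_half_log_neg_of_im_pos {w : ℂ} (hw : 0 < w.im) :
    Complex.exp (Complex.log (-w) / 2) = -(Complex.I * Complex.exp (Complex.log w / 2)) := by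
  have h := exp_half_log_neg_of_im_neg (w := -w) (by simpa using hw)
  rw [neg_neg] at h
  rw [h, ← mul_assoc, Complex.I_mul_I]
  ring

/-- Phase factors which make the transition function of the two caps positive. -/
theorem exists_phases {h : EuclideanSpace ℝ (Fin (m + 1)) → ℝ}
    (hc : ContinuousOn h (cap (m + 1) 1 ∩ cap (m + 1) (-1)))
    (h0 : ∀ x ∈ cap (m + 1) 1 ∩ cap (m + 1) (-1), h x ≠ 0) :
    ∃ gp gm : EuclideanSpace ℝ (Fin (m + 1)) → ℂ,
      (∀ x ∈ cap (m + 1) 1, ContDiffAt ℝ (⊤ : ℕ∞) gp x ∧ gp x ≠ 0) ∧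
      (∀ x ∈ cap (m + 1) (-1), ContDiffAt ℝ (⊤ : ℕ∞) gm x ∧ gm x ≠ 0) ∧
      ∀ x ∈ cap (m + 1) 1 ∩ cap (m + 1) (-1), ∃ σ : ℝ, gm x = σ * gp x ∧ 0 < σ * h x := by
  have hconst : (∃ σ : ℝ, |σ| = 1 ∧ ∀ x ∈ cap (m + 1) 1 ∩ cap (m + 1) (-1), 0 < σ * h x) →
      ∃ gp gm : EuclideanSpace ℝ (Fin (m + 1)) → ℂ,
        (∀ x ∈ cap (m + 1) 1, ContDiffAt ℝ (⊤ : ℕ∞) gp x ∧ gp x ≠ 0) ∧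
        (∀ x ∈ cap (m + 1) (-1), ContDiffAt ℝ (⊤ : ℕ∞) gm x ∧ gm x ≠ 0) ∧
        ∀ x ∈ cap (m + 1) 1 ∩ cap (m + 1) (-1), ∃ σ : ℝ, gm x = σ * gp x ∧ 0 < σ * h x := by
    rintro ⟨σ, hσ, H⟩
    refine ⟨fun _ => 1, fun _ => σ, fun x _ => ⟨contDiffAt_const, one_ne_zero⟩,
      fun x _ => ⟨contDiffAt_const, ?_⟩, fun x hx => ⟨σ, by simp, H x hx⟩⟩
    have : σ ≠ 0 := by rintro rfl; simp at hσ
    exact Complex.ofReal_ne_zero.2 this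
  -- The band lies over the unit sphere of `ℝᵐ`. That sphere is connected or empty unless `m = 1`,
  -- when it has two points and the sign of `h` may differ between the two halves.
  by_cases hm : m = 1
  · subst hm
    have hsing (t : ℝ) (ht : |t| = 1) := exists_sign hc h0
      (isPreconnected_singleton (x := (EuclideanSpace.single 0 t : EuclideanSpace ℝ (Fin 1))))
      (by rintro η rfl; simp [ht])
    obtain ⟨σR, hσR, HR⟩ := hsing 1 (by simp)
    obtain ⟨σL, hσL, HL⟩ := hsing (-1) (by simp)
    have hR {x : EuclideanSpace ℝ (Fin 2)} (hx : x ∈ cap 2 1 ∩ cap 2 (-1)) :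
        (0 < x 1 ∧ 0 < σR * h x) ∨ (x 1 < 0 ∧ 0 < σL * h x) := by
      obtain ⟨q, hq1, hq2, rfl⟩ := exists_cyl_eq hx
      have hpos : 0 < √(1 - q.1 ^ 2) := Real.sqrt_pos.2 (by nlinarith [hq1.1, hq1.2])
      have h1 : cyl 1 q 1 = √(1 - q.1 ^ 2) * q.2 0 := rfl
      have h2 : q.2 = EuclideanSpace.single 0 (q.2 0) := by
        ext i; fin_cases i; simp
      have h3 : |q.2 0| = 1 := by
        rw [h2] at hq2; simpa using hq2
      rw [h1]
      rcases (abs_eq zero_le_one).1 h3 with h4 | h4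
      · left
        rw [h4] at h2 ⊢
        exact ⟨by linarith, HR q hq1 h2⟩
      · right
        rw [h4] at h2 ⊢
        exact ⟨by linarith, HL q hq1 h2⟩
    by_cases heq : σL = σR
    · refine hconst ⟨σR, hσR, fun x hx => ?_⟩
      rcases hR hx with h1 | h1
      · exact h1.2
      · exact heq ▸ h1.2
    have hLR : σL = -σR := by
      rcases (abs_eq zero_le_one).1 hσR with h1 | h1 <;>
        rcases (abs_eq zero_le_one).1 hσL with h2 | h2
      · exact absurd (h2.trans h1.symm) heq
      · rw [h1, h2]
      · rw [h1, h2, neg_neg]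
      · exact absurd (h2.trans h1.symm) heq
    -- Opposite signs: `w = e^{-iθ}` on the circle, and the phases are the square roots of `w` and
    -- of `-w`, the latter times `-iσR`. Their ratio is `σR` where `x₁ > 0` and `-σR = σL` where `x₁
    -- < 0`.
    let w : EuclideanSpace ℝ (Fin 2) → ℂ := fun x => x 0 - x 1 * Complex.I
    have hw : ContDiff ℝ (⊤ : ℕ∞) w := by
      have hp (i : Fin 2) : ContDiff ℝ (⊤ : ℕ∞) fun x : EuclideanSpace ℝ (Fin 2) => (x i : ℂ) :=
        (Complex.ofRealCLM ∘L EuclideanSpace.proj (𝕜 := ℝ) i).contDiff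
      exact (hp 0).sub ((hp 1).mul contDiff_const)
    have hwre (x) : (w x).re = x 0 := by simp [w]
    have hwim (x) : (w x).im = -x 1 := by simp [w]
    -- On the cap of `σ` the value `σ w` is real only at the pole, where it is `1`; the excluded
    -- antipode is where the branch cut of the logarithm meets the circle.
    have hslit {x : EuclideanSpace ℝ (Fin 2)} {σ : ℝ} (hσ : |σ| = 1) (hx : x ∈ cap 2 σ) :
        σ * w x ∈ Complex.slitPlane := by
      rw [Complex.mem_slitPlane_iff, Complex.re_ofReal_mul, Complex.im_ofReal_mul, hwre, hwim]
      have hσ0 : σ ≠ 0 := by rintro rfl; simp at hσ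
      by_cases h1 : x 1 = 0
      · left
        have h2 : ‖x‖ ^ 2 = 1 := by rw [hx.1, one_pow]
        rw [EuclideanSpace.real_norm_sq_eq, Fin.sum_univ_two, h1] at h2
        have h3 : (σ * x 0) ^ 2 = 1 := by
          rw [mul_pow, ← sq_abs σ, hσ]; linarith
        have h4 := hx.2
        nlinarith
      · right
        exact mul_ne_zero hσ0 (neg_ne_zero.2 h1)
    have hsm {σ : ℝ} (hσ : |σ| = 1) {x : EuclideanSpace ℝ (Fin 2)} (hx : x ∈ cap 2 σ) :
        ContDiffAt ℝ (⊤ : ℕ∞) (fun x => Complex.exp (Complex.log (σ * w x) / 2)) x := by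
      have h1 : ContDiffAt ℝ (⊤ : ℕ∞) (fun x => σ * w x) x :=
        (contDiff_const.mul hw).contDiffAt
      have h2 : ContDiffAt ℝ (⊤ : ℕ∞) Complex.log (σ * w x) :=
        (Complex.contDiffAt_log (hslit hσ hx)).restrict_scalars ℝ
      exact ((ContDiffAt.comp (g := Complex.log) x h2 h1).div_const 2).cexp
    refine ⟨fun x => Complex.exp (Complex.log ((1 : ℝ) * w x) / 2),
      fun x => σR * (-Complex.I) * Complex.exp (Complex.log ((-1 : ℝ) * w x) / 2),
      fun x hx => ⟨hsm (by simp) hx, Complex.exp_ne_zero _⟩,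
      fun x hx => ⟨contDiffAt_const.mul (hsm (by simp) hx), ?_⟩, fun x hx => ?_⟩
    · have : σR ≠ 0 := by rintro rfl; simp at hσR
      have : (σR : ℂ) ≠ 0 := by exact_mod_cast this
      exact mul_ne_zero (mul_ne_zero this (neg_ne_zero.2 Complex.I_ne_zero))
        (Complex.exp_ne_zero _)
    · simp only [Complex.ofReal_one, one_mul, Complex.ofReal_neg, neg_mul]
      rcases hR hx with ⟨h1, h2⟩ | ⟨h1, h2⟩
      · refine ⟨σR, ?_, h2⟩
        rw [exp_half_log_neg_of_im_neg (by rw [hwim]; linarith)]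
        linear_combination (-(σR : ℂ) * Complex.exp (Complex.log (w x) / 2)) * Complex.I_mul_I
      · refine ⟨σL, ?_, h2⟩
        rw [exp_half_log_neg_of_im_pos (by rw [hwim]; linarith), hLR]
        push_cast
        linear_combination ((σR : ℂ) * Complex.exp (Complex.log (w x) / 2)) * Complex.I_mul_I
  · have hsph : IsPreconnected (Metric.sphere (0 : EuclideanSpace ℝ (Fin m)) 1) := by
      rcases Nat.lt_or_ge 1 m with h1 | h1
      · refine isPreconnected_sphere ?_ 0 1
        rw [← Module.finrank_eq_rank, finrank_euclideanSpace_fin]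
        exact_mod_cast h1
      · have : m = 0 := by omega
        subst this
        refine Set.Subsingleton.isPreconnected ?_
        exact Set.subsingleton_of_subsingleton
    obtain ⟨σ, hσ, H⟩ := exists_sign hc h0 hsph (by simp)
    refine hconst ⟨σ, hσ, fun x hx => ?_⟩
    obtain ⟨q, hq1, hq2, rfl⟩ := exists_cyl_eq hx
    exact H q hq1 (by simpa using hq2)

end LineField

namespace LineField

open scoped Topology RealInnerProductSpace Matrix

/-- A smooth family of real lines over the sphere has a smooth nonvanishing complex section. -/
theorem exists_section {d N : ℕ} [NeZero d]
    {P : EuclideanSpace ℝ (Fin d) → Matrix (Fin N) (Fin N) ℝ}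
    (hP : ∀ ω, ‖ω‖ = 1 → ∀ i j, ContDiffAt ℝ (⊤ : ℕ∞) (fun ω => P ω i j) ω)
    (hidem : ∀ ω, ‖ω‖ = 1 → P ω * P ω = P ω)
    (hrank : ∀ ω, ‖ω‖ = 1 → ∃ v ≠ 0, P ω *ᵥ v = v ∧ ∀ x, P ω *ᵥ x = x → ∃ c : ℝ, x = c • v) :
    ∃ s : EuclideanSpace ℝ (Fin d) → Fin N → ℂ, ∀ ω, ‖ω‖ = 1 →
      ContDiffAt ℝ (⊤ : ℕ∞) s ω ∧ s ω ≠ 0 ∧ (P ω).map (↑) *ᵥ s ω = s ω := by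
  obtain ⟨m, rfl⟩ := Nat.exists_eq_succ_of_ne_zero (NeZero.ne d)
  have hnorm {x : EuclideanSpace ℝ (Fin (m + 1))} (hx : x ≠ 0) : ‖‖x‖⁻¹ • x‖ = 1 := norm_smul_inv_norm hx
  -- The extension homogeneous of degree `0` lets the projections be transported along chords, which
  -- leave the sphere.
  let T : EuclideanSpace ℝ (Fin (m + 1)) → EuclideanSpace ℝ (Fin N) →L[ℝ] EuclideanSpace ℝ (Fin N) := fun x =>
    Matrix.toEuclideanCLM (𝕜 := ℝ) (P (‖x‖⁻¹ • x))
  have hTv (x v) : (T x v).ofLp = P (‖x‖⁻¹ • x) *ᵥ v.ofLp := Matrix.ofLp_toEuclideanCLM _ _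
  have hT : ∀ x ≠ 0, ContDiffAt ℝ (⊤ : ℕ∞) T x := by
    intro x hx
    have h1 : T = fun x => ∑ i, ∑ j, P (‖x‖⁻¹ • x) i j •
        Matrix.toEuclideanCLM (𝕜 := ℝ) (Matrix.single i j (1 : ℝ)) := by
      ext1 x
      simp only [T]
      conv_lhs => rw [Matrix.matrix_eq_sum_single (P (‖x‖⁻¹ • x))]
      simp only [map_sum, ← map_smul, Matrix.smul_single, smul_eq_mul, mul_one]
    rw [h1]
    refine ContDiffAt.sum fun i _ => ContDiffAt.sum fun j _ => ContDiffAt.smul_const ?_ _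
    have h2 : ContDiffAt ℝ (⊤ : ℕ∞) (fun x : EuclideanSpace ℝ (Fin (m + 1)) => ‖x‖⁻¹ • x) x :=
      ((contDiffAt_norm ℝ hx).inv (norm_ne_zero_iff.2 hx)).fun_smul contDiffAt_id
    exact ContDiffAt.comp (g := fun ω => P ω i j) x (hP _ (hnorm hx) i j) h2
  have hTi : ∀ x ≠ 0, ∀ v, T x (T x v) = T x v := fun x hx v => by
    apply WithLp.ofLp_injective 2
    rw [hTv, hTv, Matrix.mulVec_mulVec, hidem _ (hnorm hx)]
  have hTne : ∀ x ≠ 0, ∃ v ≠ 0, T x v = v := fun x hx => by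
    obtain ⟨v, hv0, hv, _⟩ := hrank _ (hnorm hx)
    refine ⟨WithLp.toLp 2 v, fun h => hv0 (congrArg WithLp.ofLp h), ?_⟩
    apply WithLp.ofLp_injective 2
    rw [hTv, hv]
  have hTP {x v} (hx : ‖x‖ = 1) : T x v = v ↔ P x *ᵥ v.ofLp = v.ofLp := by
    have h1 := hTv x v
    rw [hx, inv_one, one_smul] at h1
    rw [← h1]
    exact (WithLp.ofLp_injective 2).eq_iff.symm
  obtain ⟨vp, hvp⟩ := exists_section_cap hT hTi hTne (σ := 1) (by simp)
  obtain ⟨vm, hvm⟩ := exists_section_cap hT hTi hTne (σ := -1) (by simp)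
  have hc : ContinuousOn (fun x => ⟪vp x, vm x⟫) (cap (m + 1) 1 ∩ cap (m + 1) (-1)) :=
    fun x hx => ((hvp x hx.1).1.continuousAt.inner (𝕜 := ℝ)
      (hvm x hx.2).1.continuousAt).continuousWithinAt
  have h0 : ∀ x ∈ cap (m + 1) 1 ∩ cap (m + 1) (-1), ⟪vp x, vm x⟫ ≠ 0 := by
    intro x hx
    obtain ⟨_, hp0, hp⟩ := hvp x hx.1
    obtain ⟨_, hm0, hm⟩ := hvm x hx.2
    obtain ⟨v, _, _, hv⟩ := hrank x hx.1.1
    obtain ⟨a, ha⟩ := hv _ ((hTP hx.1.1).1 hp)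
    obtain ⟨b, hb⟩ := hv _ ((hTP hx.1.1).1 hm)
    have ha' : vp x = a • WithLp.toLp 2 v := WithLp.ofLp_injective 2 ha
    have hb' : vm x = b • WithLp.toLp 2 v := WithLp.ofLp_injective 2 hb
    rw [ha'] at hp0 ⊢
    rw [hb'] at hm0 ⊢
    rw [inner_smul_left, inner_smul_right]
    have h1 := smul_ne_zero_iff.1 hp0
    have h2 := smul_ne_zero_iff.1 hm0
    exact mul_ne_zero (by simpa using h1.1) (mul_ne_zero h2.1 (inner_self_ne_zero.2 h1.2))
  obtain ⟨gp, gm, hgp, hgm, hσ⟩ := exists_phases hc h0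
  obtain ⟨s, hs⟩ := exists_glued_section (fun x hx => ⟨(hvp x hx).1, (hvp x hx).2.1⟩)
    (fun x hx => ⟨(hvm x hx).1, (hvm x hx).2.1⟩) hgp hgm hσ
  refine ⟨s, fun ω hω => ?_⟩
  obtain ⟨h1, h2, a, b, ha, hb, hab⟩ := hs ω hω
  refine ⟨h1, h2, ?_⟩
  have hmap (v : EuclideanSpace ℝ (Fin N)) (hv : T ω v = v) :
      (P ω).map (↑) *ᵥ (fun i => (v i : ℂ)) = fun i => (v i : ℂ) := by
    have h3 := (hTP hω).1 hv
    ext i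
    have h4 := congrArg (fun t : ℝ => (t : ℂ)) (congrFun h3 i)
    simpa [Matrix.mulVec, dotProduct] using h4
  have hterm {c : ℂ} {v : EuclideanSpace ℝ (Fin N)} (hv : c ≠ 0 → T ω v = v) :
      (P ω).map (↑) *ᵥ (c • fun i => (v i : ℂ)) = c • fun i => (v i : ℂ) := by
    by_cases hc0 : c = 0
    · simp [hc0]
    · rw [Matrix.mulVec_smul, hmap v (hv hc0)]
  have hsum : s ω = (a • fun i => (vp ω i : ℂ)) + b • fun i => (vm ω i : ℂ) := by
    rw [hab]; rfl
  rw [hsum, Matrix.mulVec_add, hterm fun h => (hvp ω (ha h)).2.2,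
    hterm fun h => (hvm ω (hb h)).2.2]

end LineField

/-! ### Spectral projections of matrices with simple eigenvalues through the adjugate. -/

namespace Matrix

open scoped Topology

variable {N : ℕ}

theorem charpoly_eq_prod_of_isRoot {B : Matrix (Fin N) (Fin N) ℂ} {b : Fin N → ℂ}
    (hb : Function.Injective b) (hroot : ∀ i, B.charpoly.IsRoot (b i)) :
    B.charpoly = ∏ i, (Polynomial.X - Polynomial.C (b i)) := by
  have hmon := B.charpoly_monic
  have hdeg : B.charpoly.natDegree = N := by
    rw [Matrix.charpoly_natDegree_eq_dim, Fintype.card_fin]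
  have hdvd : ∏ i, (Polynomial.X - Polynomial.C (b i)) ∣ B.charpoly := by
    refine Finset.prod_dvd_of_coprime (fun i _ j _ hij => ?_)
      fun i _ => Polynomial.dvd_iff_isRoot.2 (hroot i)
    exact Polynomial.isCoprime_X_sub_C_of_isUnit_sub
      (isUnit_iff_ne_zero.2 (sub_ne_zero.2 (hb.ne hij)))
  refine Polynomial.eq_of_monic_of_dvd_of_natDegree_le
    (Polynomial.monic_prod_of_monic _ _ fun i _ => Polynomial.monic_X_sub_C _) hmon hdvd ?_
  rw [hdeg, Polynomial.natDegree_prod_of_monic _ _ fun i _ => Polynomial.monic_X_sub_C _]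
  simp

variable {𝕜 : Type*} [NontriviallyNormedField 𝕜]

theorem det_sub_scalar_of_charpoly_eq_prod {B : Matrix (Fin N) (Fin N) 𝕜} {b : Fin N → 𝕜}
    (hB : B.charpoly = ∏ i, (Polynomial.X - Polynomial.C (b i))) (x : 𝕜) :
    (B - Matrix.scalar _ x).det = ∏ i, (b i - x) := by
  rw [← neg_sub, Matrix.det_neg, ← Matrix.eval_charpoly, hB, Polynomial.eval_prod,
    Fintype.card_fin]
  simp only [Polynomial.eval_sub, Polynomial.eval_X, Polynomial.eval_C]
  have h : ∏ i, (b i - x) = ∏ i, (-1) * (x - b i) := by simp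
  rw [h, Finset.prod_mul_distrib, Finset.prod_const, Finset.card_univ, Fintype.card_fin]

/-- The adjugate of `B - bⱼ` on an eigenvector for the simple eigenvalue `bⱼ`. -/
theorem adjugate_mulVec_eigenvector {B : Matrix (Fin N) (Fin N) 𝕜} {b : Fin N → 𝕜}
    (hB : B.charpoly = ∏ i, (Polynomial.X - Polynomial.C (b i))) {j : Fin N} {s : Fin N → 𝕜}
    (hs : B.mulVec s = b j • s) :
    (B - Matrix.scalar _ (b j)).adjugate.mulVec s =
      (∏ i ∈ Finset.univ.erase j, (b i - b j)) • s := by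
  have hsub : Continuous fun x : 𝕜 => B - Matrix.scalar (Fin N) x := by
    refine continuous_const.sub (continuous_matrix fun i k => ?_)
    simp only [Matrix.scalar_apply, Matrix.diagonal_apply]
    split_ifs <;> fun_prop
  have h1 : Continuous fun x : 𝕜 => (B - Matrix.scalar _ x).adjugate.mulVec s :=
    hsub.matrix_adjugate.matrix_mulVec continuous_const
  have h2 : Continuous fun x : 𝕜 => (∏ i ∈ Finset.univ.erase j, (b i - x)) • s := by fun_prop
  -- For `x ≠ bⱼ` apply `adj(B - x)(B - x) = det(B - x)` to `s` and cancel `bⱼ - x`; both sides are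
  -- continuous in `x`, so the identity persists at `bⱼ`.
  refine congrFun (h1.ext_on (dense_compl_singleton (b j)) h2 fun x hx => ?_) (b j)
  have hx' : b j - x ≠ 0 := sub_ne_zero.2 (Ne.symm hx)
  have h3 : (B - Matrix.scalar _ x).mulVec s = (b j - x) • s := by
    rw [Matrix.sub_mulVec, hs, sub_smul]
    congr 1
    ext i
    simp [Matrix.mulVec_diagonal]
  have h4 : (B - Matrix.scalar _ x).adjugate.mulVec ((B - Matrix.scalar _ x).mulVec s) =
      (∏ i, (b i - x)) • s := by
    rw [Matrix.mulVec_mulVec, Matrix.adjugate_mul, det_sub_scalar_of_charpoly_eq_prod hB,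
      Matrix.smul_mulVec, Matrix.one_mulVec]
  rw [h3, Matrix.mulVec_smul, ← Finset.mul_prod_erase _ _ (Finset.mem_univ j), mul_smul] at h4
  exact smul_right_injective _ hx' h4

/-- Eigenvectors of a simple eigenvalue are parallel. -/
theorem exists_smul_eq_of_eigenvectors {B : Matrix (Fin N) (Fin N) 𝕜} {b : Fin N → 𝕜}
    (hb : Function.Injective b)
    (hB : B.charpoly = ∏ i, (Polynomial.X - Polynomial.C (b i))) {j : Fin N} {v x : Fin N → 𝕜}
    (hv0 : v ≠ 0) (hv : B.mulVec v = b j • v) (hx : B.mulVec x = b j • x) :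
    ∃ c : 𝕜, x = c • v := by
  classical
  have hmul : B.charpoly.rootMultiplicity (b j) = 1 := by
    have h : B.charpoly = ((Finset.univ.val.map b).map fun a => Polynomial.X - Polynomial.C a).prod := by
      rw [hB, Multiset.map_map]
      rfl
    rw [← Polynomial.count_roots, h, Polynomial.roots_multiset_prod_X_sub_C]
    exact Multiset.count_eq_one_of_mem (Finset.univ.nodup.map hb)
      (Multiset.mem_map_of_mem b (Finset.mem_univ_val j))
  have hle := LinearMap.finrank_eigenspace_le (Matrix.toLin' B) (b j)
  rw [Matrix.charpoly_toLin', hmul] at hle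
  have hvm : v ∈ Module.End.eigenspace (Matrix.toLin' B) (b j) := by
    rw [Module.End.mem_eigenspace_iff, Matrix.toLin'_apply, hv]
  have hxm : x ∈ Module.End.eigenspace (Matrix.toLin' B) (b j) := by
    rw [Module.End.mem_eigenspace_iff, Matrix.toLin'_apply, hx]
  have h1 : Module.finrank 𝕜 (Module.End.eigenspace (Matrix.toLin' B) (b j)) = 1 := by
    refine le_antisymm hle (Submodule.one_le_finrank_iff.2 fun h => hv0 ?_)
    rw [h] at hvm
    exact (Submodule.mem_bot 𝕜).1 hvm
  obtain ⟨c, hc⟩ := exists_smul_eq_of_finrank_eq_one h1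
    (x := (⟨v, hvm⟩ : Module.End.eigenspace (Matrix.toLin' B) (b j))) (by simpa using hv0) ⟨x, hxm⟩
  exact ⟨c, (congrArg Subtype.val hc).symm⟩

theorem contDiffAt_det {F : Type*} [NormedAddCommGroup F] [NormedSpace ℝ F] {k : WithTop ℕ∞}
    {𝕂 : Type*} [RCLike 𝕂] {A : F → Matrix (Fin N) (Fin N) 𝕂} {p : F}
    (hA : ∀ i j, ContDiffAt ℝ k (fun p => A p i j) p) : ContDiffAt ℝ k (fun p => (A p).det) p := by
  simp only [Matrix.det_apply]
  exact ContDiffAt.sum fun σ _ => ContDiffAt.const_smul _ (contDiffAt_prod fun i _ => hA _ _)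

theorem contDiffAt_adjugate {F : Type*} [NormedAddCommGroup F] [NormedSpace ℝ F] {k : WithTop ℕ∞}
    {𝕂 : Type*} [RCLike 𝕂] {A : F → Matrix (Fin N) (Fin N) 𝕂} {p : F}
    (hA : ∀ i j, ContDiffAt ℝ k (fun p => A p i j) p) (i j : Fin N) :
    ContDiffAt ℝ k (fun p => (A p).adjugate i j) p := by
  simp only [Matrix.adjugate_apply]
  refine contDiffAt_det fun a b => ?_
  simp only [Matrix.updateRow_apply]
  split_ifs
  · exact contDiffAt_const
  · exact hA a b

theorem contDiffAt_mulVec {F : Type*} [NormedAddCommGroup F] [NormedSpace ℝ F] {k : WithTop ℕ∞}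
    {𝕂 : Type*} [RCLike 𝕂] {A : F → Matrix (Fin N) (Fin N) 𝕂} {v : F → Fin N → 𝕂} {p : F}
    (hA : ∀ i j, ContDiffAt ℝ k (fun p => A p i j) p) (hv : ContDiffAt ℝ k v p) :
    ContDiffAt ℝ k (fun p => (A p).mulVec (v p)) p :=
  contDiffAt_pi.2 fun i => by
    simp only [Matrix.mulVec, dotProduct]
    exact ContDiffAt.sum fun j _ => (hA i j).mul (contDiffAt_pi.1 hv j)

theorem contDiffAt_vecMul {F : Type*} [NormedAddCommGroup F] [NormedSpace ℝ F] {k : WithTop ℕ∞}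
    {𝕂 : Type*} [RCLike 𝕂] {A : F → Matrix (Fin N) (Fin N) 𝕂} {v : F → Fin N → 𝕂} {p : F}
    (hA : ∀ i j, ContDiffAt ℝ k (fun p => A p i j) p) (hv : ContDiffAt ℝ k v p) :
    ContDiffAt ℝ k (fun p => (A p).vecMul (v p)) p :=
  contDiffAt_pi.2 fun i => by
    simp only [Matrix.vecMul, dotProduct]
    exact ContDiffAt.sum fun j _ => (contDiffAt_pi.1 hv j).mul (hA j i)

/-- A smooth family of real matrices with real simple eigenvalues has smooth nonvanishing complex
eigenvectors over the sphere. -/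
theorem exists_eigenvector_section {d : ℕ} [NeZero d]
    {R : EuclideanSpace ℝ (Fin d) → Matrix (Fin N) (Fin N) ℝ}
    {a : EuclideanSpace ℝ (Fin d) → Fin N → ℝ}
    (hR : ∀ ω, ‖ω‖ = 1 → ∀ i j, ContDiffAt ℝ (⊤ : ℕ∞) (fun ω => R ω i j) ω)
    (ha : ∀ ω, ‖ω‖ = 1 → ContDiffAt ℝ (⊤ : ℕ∞) a ω)
    (hinj : ∀ ω, ‖ω‖ = 1 → Function.Injective (a ω))
    (hchar : ∀ ω, ‖ω‖ = 1 → (R ω).charpoly = ∏ i, (Polynomial.X - Polynomial.C (a ω i)))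
    (j : Fin N) :
    ∃ s : EuclideanSpace ℝ (Fin d) → Fin N → ℂ, ∀ ω, ‖ω‖ = 1 →
      ContDiffAt ℝ (⊤ : ℕ∞) s ω ∧ s ω ≠ 0 ∧ ((R ω).map (↑)).mulVec (s ω) = (a ω j : ℂ) • s ω := by
  let c : EuclideanSpace ℝ (Fin d) → ℝ := fun ω => ∏ i ∈ Finset.univ.erase j, (a ω i - a ω j)
  have hc {ω} (hω : ‖ω‖ = 1) : c ω ≠ 0 := Finset.prod_ne_zero_iff.2 fun i hi =>
    sub_ne_zero.2 ((hinj ω hω).ne (Finset.ne_of_mem_erase hi))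
  -- The spectral projection of the simple eigenvalue `aⱼ`: the adjugate of `R - aⱼ` maps into the
  -- eigenline and acts on it as multiplication by `c`. This formula is visibly smooth and real.
  let P : EuclideanSpace ℝ (Fin d) → Matrix (Fin N) (Fin N) ℝ := fun ω =>
    (c ω)⁻¹ • (R ω - Matrix.scalar _ (a ω j)).adjugate
  have hdet {ω} (hω : ‖ω‖ = 1) : (R ω - Matrix.scalar _ (a ω j)).det = 0 := by
    rw [det_sub_scalar_of_charpoly_eq_prod (hchar ω hω)]
    exact Finset.prod_eq_zero (Finset.mem_univ j) (sub_self _)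
  have hRP {ω} (hω : ‖ω‖ = 1) : R ω * P ω = a ω j • P ω := by
    have h1 : (R ω - Matrix.scalar _ (a ω j)) * P ω = 0 := by
      rw [Matrix.mul_smul, Matrix.mul_adjugate, hdet hω, zero_smul, smul_zero]
    rw [Matrix.sub_mul, sub_eq_zero] at h1
    rw [h1]
    ext i k
    simp [Matrix.scalar_apply]
  have hPe {ω} (hω : ‖ω‖ = 1) {x} (hx : (R ω).mulVec x = a ω j • x) : (P ω).mulVec x = x := by
    rw [Matrix.smul_mulVec, adjugate_mulVec_eigenvector (hchar ω hω) hx, smul_smul,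
      inv_mul_cancel₀ (hc hω), one_smul]
  have heP {ω} (hω : ‖ω‖ = 1) (x) : (R ω).mulVec ((P ω).mulVec x) = a ω j • (P ω).mulVec x := by
    rw [Matrix.mulVec_mulVec, hRP hω, Matrix.smul_mulVec]
  have hP1 (ω) (hω : ‖ω‖ = 1) (i k) : ContDiffAt ℝ (⊤ : ℕ∞) (fun ω => P ω i k) ω := by
    have haj (i) : ContDiffAt ℝ (⊤ : ℕ∞) (fun ω => a ω i) ω := contDiffAt_pi.1 (ha ω hω) i
    refine ContDiffAt.mul ?_ ?_
    · exact (contDiffAt_prod fun i _ => (haj i).sub (haj j)).inv (hc hω)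
    · refine contDiffAt_adjugate (fun i k => ?_) i k
      simp only [Matrix.sub_apply, Matrix.scalar_apply, Matrix.diagonal_apply]
      refine (hR ω hω i k).sub ?_
      split_ifs
      · exact haj j
      · exact contDiffAt_const
  have hP2 (ω) (hω : ‖ω‖ = 1) : P ω * P ω = P ω := by
    refine Matrix.ext_of_mulVec_single fun i => ?_
    rw [← Matrix.mulVec_mulVec, hPe hω (heP hω _)]
  have hP3 (ω) (hω : ‖ω‖ = 1) :
      ∃ v ≠ 0, (P ω).mulVec v = v ∧ ∀ x, (P ω).mulVec x = x → ∃ c : ℝ, x = c • v := by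
    obtain ⟨v, hv0, hv⟩ := Matrix.exists_mulVec_eq_zero_iff.2 (hdet hω)
    have hv' : (R ω).mulVec v = a ω j • v := by
      rw [Matrix.sub_mulVec, sub_eq_zero] at hv
      rw [hv]
      ext i
      simp [Matrix.mulVec_diagonal]
    refine ⟨v, hv0, hPe hω hv', fun x hx => ?_⟩
    refine exists_smul_eq_of_eigenvectors (hinj ω hω) (hchar ω hω) hv0 hv' ?_
    rw [← hx]
    exact heP hω x
  obtain ⟨s, hs⟩ := LineField.exists_section hP1 hP2 hP3
  refine ⟨s, fun ω hω => ?_⟩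
  obtain ⟨h1, h2, h3⟩ := hs ω hω
  refine ⟨h1, h2, ?_⟩
  have h4 : (R ω).map (↑) * (P ω).map (↑) = (a ω j : ℂ) • (P ω).map (Complex.ofReal) := by
    have := congrArg (fun B : Matrix (Fin N) (Fin N) ℝ => B.map Complex.ofRealHom) (hRP hω)
    simp only [Matrix.map_mul] at this
    refine this.trans ?_
    ext i k
    simp
  rw [← h3, Matrix.mulVec_mulVec, h4, Matrix.smul_mulVec]

end Matrix

/-! ### Construction of an eigensystem. -/

namespace Bloch
namespace PeriodicWave
namespace Green

open scoped Matrix Topology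

variable {n d : ℕ} [NeZero d] {W : PeriodicWave n d} {𝒢 : Green W} {h3 : W.D3}

theorem charpoly_realA₀ {ω : RVec d} {a : Fin (n + 1) → ℝ} (ha : StrictMono a)
    (hroot : ∀ j, (𝒢.A₀ ω).charpoly.IsRoot (a j * Complex.I)) :
    (𝒢.realA₀ ω).charpoly = ∏ i, (Polynomial.X - Polynomial.C (a i)) := by
  have h1 : ((𝒢.realA₀ ω).map Complex.ofRealHom).charpoly =
      ∏ i, (Polynomial.X - Polynomial.C (a i : ℂ)) := by
    refine Matrix.charpoly_eq_prod_of_isRoot (Complex.ofReal_injective.comp ha.injective)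
      fun j => ?_
    have h := hroot j
    rw [Polynomial.IsRoot.def, Matrix.eval_charpoly, A₀_eq] at h
    have e : Matrix.scalar (Fin (n + 1)) (a j * Complex.I : ℂ) -
        Complex.I • (𝒢.realA₀ ω).map (↑) =
        Complex.I • (Matrix.scalar _ (a j : ℂ) - (𝒢.realA₀ ω).map Complex.ofRealHom) := by
      ext i k
      simp only [Matrix.sub_apply, Matrix.scalar_apply, Matrix.smul_apply, Matrix.map_apply,
        Matrix.diagonal_apply, smul_eq_mul, Complex.ofRealHom_eq_coe]
      split_ifs <;> ring
    rw [e, Matrix.det_smul] at h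
    rw [Polynomial.IsRoot.def, Matrix.eval_charpoly]
    exact (mul_eq_zero.1 h).resolve_left (pow_ne_zero _ Complex.I_ne_zero)
  apply Polynomial.map_injective Complex.ofRealHom Complex.ofReal_injective
  rw [← Matrix.charpoly_map, h1, Polynomial.map_prod]
  simp

/-- The right eigenfunction built from a vector `s`. -/
def rightVec (𝒢 : Green W) (p : (RVec d × ℝ) × ℂ) (s : Fin (n + 1) → ℂ) : L2Per n W.X :=
  𝒢.G (Ring.inverse (𝒢.M p) (𝒢.ι ((𝒢.Φ p).adjugate *ᵥ s)))

/-- The left eigenfunctional built from a vector `s`. -/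
def leftDual (𝒢 : Green W) (p : (RVec d × ℝ) × ℂ) (s : Fin (n + 1) → ℂ) : L2Per n W.X →L[ℂ] ℂ :=
  𝒢.leftFunctional p (star s ᵥ* (𝒢.Φ p).adjugate)

/-- The normalizing factor at `r = 0`. Both adjugates act on the eigenvector `s` as the same product
of eigenvalue differences, and `star s ⬝ᵥ s` is its squared norm, so the pairing is nonzero even
though `star s` itself need not be a left eigenvector. -/
theorem leftDual_rightVec_zero {ω : RVec d} {b : Fin (n + 1) → ℂ}
    (hb : (𝒢.A₀ ω).charpoly = ∏ i, (Polynomial.X - Polynomial.C (b i))) {j : Fin (n + 1)}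
    {s : Fin (n + 1) → ℂ} (hs : 𝒢.A₀ ω *ᵥ s = b j • s) :
    𝒢.leftDual ((ω, 0), b j) s (𝒢.rightVec ((ω, 0), b j) s) =
      (∏ i ∈ Finset.univ.erase j, (b i - b j)) ^ 2 * (star s ⬝ᵥ s) := by
  rw [leftDual, leftFunctional_apply, rightVec, M_zero, Ring.inverse_one,
    _root_.one_apply_eq_self, _root_.one_apply_eq_self, G_ι, π_ι, Φ_zero, ← Matrix.dotProduct_mulVec,
    Matrix.adjugate_mulVec_eigenvector hb hs, Matrix.mulVec_smul,
    Matrix.adjugate_mulVec_eigenvector hb hs, smul_smul, dotProduct_smul, smul_eq_mul]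
  ring

theorem rightVec_mem {ω : RVec d} {r : ℝ} {μ : ℂ} (hp : IsUnit (𝒢.M ((ω, r), μ)))
    (hdet : (𝒢.Φ ((ω, r), μ)).det = 0) (s : Fin (n + 1) → ℂ) :
    ∃ h : 𝒢.rightVec ((ω, r), μ) s ∈ W.dom, W.L (r • ω) ⟨𝒢.rightVec ((ω, r), μ) s, h⟩ =
      ((r : ℂ) * μ) • 𝒢.rightVec ((ω, r), μ) s := by
  have hk : 𝒢.Φ ((ω, r), μ) *ᵥ ((𝒢.Φ ((ω, r), μ)).adjugate *ᵥ s) = 0 := by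
    rw [Matrix.mulVec_mulVec, Matrix.mul_adjugate, hdet, zero_smul, Matrix.zero_mulVec]
  have h1 := L_g_inverse_ι hp hk
  have h2 := 𝒢.G_apply (Ring.inverse (𝒢.M ((ω, r), μ))
    (𝒢.ι ((𝒢.Φ ((ω, r), μ)).adjugate *ᵥ s)))
  rw [rightVec, h2]
  exact ⟨Subtype.property _, h1⟩

theorem leftDual_L {ω : RVec d} {r : ℝ} {μ : ℂ} (hp : IsUnit (𝒢.M ((ω, r), μ)))
    (hdet : (𝒢.Φ ((ω, r), μ)).det = 0) (s : Fin (n + 1) → ℂ) (u : W.dom) :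
    𝒢.leftDual ((ω, r), μ) s (W.L (r • ω) u) =
      ((r : ℂ) * μ) * 𝒢.leftDual ((ω, r), μ) s u := by
  refine leftFunctional_L hp ?_ u
  rw [Matrix.vecMul_vecMul, Matrix.adjugate_mul, hdet, zero_smul, Matrix.vecMul_zero]

section Smooth

variable {F : Type*} [NormedAddCommGroup F] [NormedSpace ℝ F] {k : WithTop ℕ∞}
  {m : F → (RVec d × ℝ) × ℂ} {s : F → Fin (n + 1) → ℂ} {x : F}

theorem contDiffAt_rightVec (hm : ContDiffAt ℝ k m x) (hs : ContDiffAt ℝ k s x)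
    (hp : IsUnit (𝒢.M (m x))) : ContDiffAt ℝ k (fun y => 𝒢.rightVec (m y) (s y)) x := by
  have h1 (i j) : ContDiffAt ℝ k (fun y => 𝒢.Φ (m y) i j) x :=
    ContDiffAt.comp (g := fun p => 𝒢.Φ p i j) x (contDiffAt_Φ hp i j) hm
  have h2 := Matrix.contDiffAt_mulVec (Matrix.contDiffAt_adjugate h1) hs
  have h3 : ContDiffAt ℝ k (fun y => 𝒢.ι ((𝒢.Φ (m y)).adjugate *ᵥ s y)) x :=
    contDiffAt_apply (contDiffAt_const (c := 𝒢.ι)) h2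
  have h4 : ContDiffAt ℝ k (fun y => Ring.inverse (𝒢.M (m y))) x :=
    ContDiffAt.comp (g := fun p => Ring.inverse (𝒢.M p)) x (contDiffAt_inverse_M hp) hm
  exact contDiffAt_apply (contDiffAt_const (c := 𝒢.G)) (contDiffAt_apply h4 h3)

theorem contDiffAt_leftDual (hm : ContDiffAt ℝ k m x) (hs : ContDiffAt ℝ k s x)
    (hp : IsUnit (𝒢.M (m x))) : ContDiffAt ℝ k (fun y => 𝒢.leftDual (m y) (s y)) x := by
  have h1 (i j) : ContDiffAt ℝ k (fun y => 𝒢.Φ (m y) i j) x :=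
    ContDiffAt.comp (g := fun p => 𝒢.Φ p i j) x (contDiffAt_Φ hp i j) hm
  have hstar : ContDiffAt ℝ k (fun y => star (s y)) x := contDiffAt_pi.2 fun i =>
    Complex.conjCLE.contDiff.contDiffAt.comp x (contDiffAt_pi.1 hs i)
  have h2 := Matrix.contDiffAt_vecMul (Matrix.contDiffAt_adjugate h1) hstar
  have h4 : ContDiffAt ℝ k (fun y => Ring.inverse (𝒢.M (m y))) x :=
    ContDiffAt.comp (g := fun p => Ring.inverse (𝒢.M p)) x (contDiffAt_inverse_M hp) hm
  unfold leftDual leftFunctional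
  refine ContDiffAt.sum fun i _ => ContDiffAt.fun_smul (contDiffAt_pi.1 h2 i) ?_
  exact ((ContinuousLinearMap.compL ℂ _ _ ℂ (ContinuousLinearMap.proj i ∘L 𝒢.π)).restrictScalars
    ℝ).contDiff.contDiffAt.comp x h4

end Smooth

end Green

/-- The Riesz representation of functionals as a real linear map. -/
def riesz (n : ℕ) (X : ℝ) [Fact (0 < X)] : (L2Per n X →L[ℂ] ℂ) →L[ℝ] L2Per n X where
  toFun := (InnerProductSpace.toDual ℂ (L2Per n X)).symm
  map_add' := map_add _
  map_smul' c f := by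
    have h := (InnerProductSpace.toDual ℂ (L2Per n X)).symm.map_smulₛₗ (c : ℂ) f
    rw [Complex.conj_ofReal, Complex.coe_smul, Complex.coe_smul] at h
    exact h
  cont := (InnerProductSpace.toDual ℂ (L2Per n X)).symm.continuous

theorem inner_riesz {n : ℕ} {X : ℝ} [Fact (0 < X)] (f : L2Per n X →L[ℂ] ℂ) (u : L2Per n X) :
    inner ℂ (riesz n X f) u = f u :=
  InnerProductSpace.toDual_symm_apply

open Green in
open scoped Matrix Topology ComplexOrder in
set_option maxHeartbeats 400000 in
/-- Existence of eigensystems. -/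
theorem exists_eigensystem {n d : ℕ} [NeZero d] {W : PeriodicWave n d} (hD1 : W.D1) (hD2 : W.D2)
    {h3 : W.D3} (hH3 : H3 h3) :
    ∃ (ε δ : ℝ) (lam : Fin (n + 1) → RVec d → ℝ → ℂ)
      (q qt : Fin (n + 1) → RVec d → ℝ → L2Per n W.X), W.IsEigensystem ε δ lam q qt := by
  obtain ⟨𝒢, hG⟩ := exists_green hD2 h3
  obtain ⟨δ, hδ, C₀, hbound⟩ := exists_bound_of_det_Φ_eq_zero (𝒢 := 𝒢)
  -- `C` exceeds the a priori bound strictly, so the roots at `r = 0` are interior to the ball of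
  -- radius `C` and stay in it for small `r`.
  set C : ℝ := |C₀| + 1 with hCdef
  have hC₀ : C₀ < C := (le_abs_self C₀).trans_lt (lt_add_one _)
  have hCpos : 0 < C := by positivity
  obtain ⟨m, hm⟩ := exists_roots hD1 hH3 hG (C := C) fun ω hω μ hμ =>
    ((hbound ω hω 0 μ (by simpa using hδ) (by simpa using hδ)).2 hμ).trans_lt hC₀
  have hm0 {ω : RVec d} (hω : ‖ω‖ = 1) := (hm ω hω).self_of_nhds
  have hroot {ω : RVec d} (hω : ‖ω‖ = 1) (j) : (𝒢.A₀ ω).charpoly.IsRoot (m (ω, 0) j) :=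
    (det_Φ_zero_eq_zero_iff _ _).1 (((hm0 hω).2.2 _).2 ⟨j, rfl⟩).1
  let a (ω : RVec d) (j : Fin (n + 1)) : ℝ := (m (ω, 0) j).im
  have hma {ω : RVec d} (hω : ‖ω‖ = 1) (j) : m (ω, 0) j = a ω j * Complex.I := by
    apply Complex.ext <;> simp [a, re_root_eq_zero hD1 hH3 hG hω (hroot hω j)]
  have hmi {ω : RVec d} (hω : ‖ω‖ = 1) : Function.Injective (m (ω, 0)) := fun i j hij =>
    (hm0 hω).2.1.injective (congrArg Complex.im hij)
  have hcharC {ω : RVec d} (hω : ‖ω‖ = 1) : (𝒢.A₀ ω).charpoly =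
      ∏ i, (Polynomial.X - Polynomial.C (m (ω, 0) i)) :=
    Matrix.charpoly_eq_prod_of_isRoot (hmi hω) (hroot hω)
  have ha (ω : RVec d) (hω : ‖ω‖ = 1) : ContDiffAt ℝ (⊤ : ℕ∞) a ω := by
    refine contDiffAt_pi.2 fun j => Complex.imCLM.contDiff.contDiffAt.comp ω ?_
    have h1 : ContDiffAt ℝ (⊤ : ℕ∞) m (ω, 0) := (hm0 hω).1.of_le le_top
    have h2 : ContDiffAt ℝ (⊤ : ℕ∞) (fun ω : RVec d => (ω, (0 : ℝ))) ω := by fun_prop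
    exact ContDiffAt.comp (g := fun p => m p j) ω (contDiffAt_pi.1 h1 j) h2
  choose s hs using Matrix.exists_eigenvector_section (R := 𝒢.realA₀) (a := a)
    (fun ω _ i j => (contDiff_realA₀ i j).contDiffAt) ha (fun ω hω => (hm0 hω).2.1.injective)
    (fun ω hω => charpoly_realA₀ (hm0 hω).2.1 fun j => hma hω j ▸ hroot hω j)
  have hsA {ω : RVec d} (hω : ‖ω‖ = 1) (j) : 𝒢.A₀ ω *ᵥ s j ω = m (ω, 0) j • s j ω := by
    rw [A₀_eq, Matrix.smul_mulVec, (hs j ω hω).2.2, smul_smul, hma hω, mul_comm]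
  let qr (j : Fin (n + 1)) (p : RVec d × ℝ) : L2Per n W.X := 𝒢.rightVec (p, m p j) (s j p.1)
  let ql (j : Fin (n + 1)) (p : RVec d × ℝ) : L2Per n W.X →L[ℂ] ℂ :=
    𝒢.leftDual (p, m p j) (s j p.1)
  let τ (j : Fin (n + 1)) (p : RVec d × ℝ) : ℂ := ql j p (qr j p)
  have hτ0 {ω : RVec d} (hω : ‖ω‖ = 1) (j) : τ j (ω, 0) ≠ 0 := by
    have h := leftDual_rightVec_zero (hcharC hω) (hsA hω j)
    refine (congrArg (· ≠ 0) h).mpr (mul_ne_zero (pow_ne_zero _ (Finset.prod_ne_zero_iff.2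
      fun i hi => sub_ne_zero.2 ((hmi hω).ne (Finset.ne_of_mem_erase hi)))) ?_)
    rw [Ne, dotProduct_star_self_eq_zero]
    exact (hs j ω hω).2.1
  have hsm {p : RVec d × ℝ} (hp : ‖p.1‖ = 1) (hmp : ContDiffAt ℝ ⊤ m p) (j) :
      ContDiffAt ℝ (⊤ : ℕ∞) (fun p => (p, m p j)) p ∧
        ContDiffAt ℝ (⊤ : ℕ∞) (fun p : RVec d × ℝ => s j p.1) p :=
    ⟨contDiffAt_id.prodMk (contDiffAt_pi.1 (hmp.of_le le_top) j),
      (hs j p.1 hp).1.comp p contDiffAt_fst⟩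
  have hqr {p : RVec d × ℝ} (hp : ‖p.1‖ = 1) (hmp : ContDiffAt ℝ ⊤ m p) (j)
      (hu : IsUnit (𝒢.M (p, m p j))) : ContDiffAt ℝ (⊤ : ℕ∞) (qr j) p :=
    contDiffAt_rightVec (hsm hp hmp j).1 (hsm hp hmp j).2 hu
  have hql {p : RVec d × ℝ} (hp : ‖p.1‖ = 1) (hmp : ContDiffAt ℝ ⊤ m p) (j)
      (hu : IsUnit (𝒢.M (p, m p j))) : ContDiffAt ℝ (⊤ : ℕ∞) (ql j) p :=
    contDiffAt_leftDual (hsm hp hmp j).1 (hsm hp hmp j).2 hu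
  have hτ {p : RVec d × ℝ} (hp : ‖p.1‖ = 1) (hmp : ContDiffAt ℝ ⊤ m p) (j)
      (hu : IsUnit (𝒢.M (p, m p j))) : ContDiffAt ℝ (⊤ : ℕ∞) (τ j) p :=
    contDiffAt_apply (hql hp hmp j hu) (hqr hp hmp j hu)
  let Good (p : RVec d × ℝ) : Prop := (ContDiffAt ℝ ⊤ m p ∧ (StrictMono fun j => (m p j).im) ∧
    ∀ μ, ((𝒢.Φ (p, μ)).det = 0 ∧ ‖μ‖ ≤ C) ↔ ∃ j, μ = m p j) ∧ ∀ j, τ j p ≠ 0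
  -- Compactness of the sphere turns neighbourhoods of the points `(ω, 0)` into a single range of
  -- `r`.
  have hgood : ∀ᶠ r : ℝ in 𝓝 0, ∀ ω ∈ Metric.sphere (0 : RVec d) 1, Good (ω, r) := by
    refine (isCompact_sphere (0 : RVec d) 1).eventually_forall_of_forall_eventually fun ω hω => ?_
    have hω' : ‖ω‖ = 1 := by simpa using hω
    have h1 : ∀ᶠ p in 𝓝 (ω, (0 : ℝ)), ∀ j, τ j p ≠ 0 := by
      refine Filter.eventually_all.2 fun j => ?_
      have hu : IsUnit (𝒢.M ((ω, 0), m (ω, 0) j)) := by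
        rw [M_zero]
        exact isUnit_one
      exact (hτ (p := (ω, 0)) hω' (hm0 hω').1 j hu).continuousAt.eventually_ne (hτ0 hω' j)
    have h2 : ∀ᶠ p in 𝓝 (ω, (0 : ℝ)), Good p := (hm ω hω').and h1
    have h4 : Filter.Tendsto (Prod.swap : ℝ × RVec d → RVec d × ℝ) (𝓝 (0, ω)) (𝓝 (ω, 0)) :=
      continuous_swap.tendsto ((0 : ℝ), ω)
    exact h4.eventually h2
  obtain ⟨ε₀, hε₀, hgood⟩ := Metric.eventually_nhds_iff.1 hgood
  -- `r < δ` puts `r` in the range of the a priori bound; `r < δ / C` keeps `|rμⱼ| < δ` for all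
  -- roots with `|μⱼ| ≤ C`.
  let ε : ℝ := min ε₀ (min δ (δ / C))
  have hεpos : 0 < ε := lt_min hε₀ (lt_min hδ (by positivity))
  have hrδ {r : ℝ} (hr : r ∈ Set.Ico 0 ε) : |r| < δ := by
    rw [abs_of_nonneg hr.1]
    exact hr.2.trans_le ((min_le_right _ _).trans (min_le_left _ _))
  have hg {r : ℝ} (hr : r ∈ Set.Ico 0 ε) {ω : RVec d} (hω : ‖ω‖ = 1) : Good (ω, r) := by
    refine hgood (y := r) ?_ ω (by simpa using hω)
    rw [dist_zero_right, Real.norm_eq_abs, abs_of_nonneg hr.1]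
    exact hr.2.trans_le (min_le_left _ _)
  have hdet {r : ℝ} (hr : r ∈ Set.Ico 0 ε) {ω : RVec d} (hω : ‖ω‖ = 1) (j) :=
    ((hg hr hω).1.2.2 (m (ω, r) j)).2 ⟨j, rfl⟩
  have hrm {r : ℝ} (hr : r ∈ Set.Ico 0 ε) {ω : RVec d} (hω : ‖ω‖ = 1) (j) :
      ‖(r : ℂ) * m (ω, r) j‖ < δ := by
    rw [norm_mul, Complex.norm_real, Real.norm_eq_abs, abs_of_nonneg hr.1]
    calc r * ‖m (ω, r) j‖ ≤ r * C := mul_le_mul_of_nonneg_left (hdet hr hω j).2 hr.1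
      _ < ε * C := mul_lt_mul_of_pos_right hr.2 hCpos
      _ ≤ δ / C * C := by
        refine mul_le_mul_of_nonneg_right ?_ hCpos.le
        exact (min_le_right _ _).trans (min_le_right _ _)
      _ = δ := div_mul_cancel₀ _ hCpos.ne'
  have hu {r : ℝ} (hr : r ∈ Set.Ico 0 ε) {ω : RVec d} (hω : ‖ω‖ = 1) (j) :
      IsUnit (𝒢.M ((ω, r), m (ω, r) j)) := (hbound ω hω r _ (hrδ hr) (hrm hr hω j)).1
  have hnorm {r : ℝ} (hr : r ∈ Set.Ico 0 ε) {ω : RVec d} (hω : ‖ω‖ = 1) (j) :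
      inner ℂ ((star (τ j (ω, r)))⁻¹ • riesz n W.X (ql j (ω, r))) (qr j (ω, r)) = (1 : ℂ) := by
    rw [inner_smul_left, inner_riesz, map_inv₀, ← starRingEnd_apply, Complex.conj_conj]
    exact inv_mul_cancel₀ ((hg hr hω).2 j)
  refine ⟨ε, δ, fun j ω r => r * m (ω, r) j, fun j ω r => qr j (ω, r),
    fun j ω r => (star (τ j (ω, r)))⁻¹ • riesz n W.X (ql j (ω, r)), ⟨hεpos, hδ, fun j => ?_,
    fun j => ?_, fun j => ?_, fun j ω hω r hr => ?_, fun j ω hω r hr => ?_, fun j ω hω r hr => ?_,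
    fun ω hω r hr => ?_, fun ω hω r hr => ?_⟩⟩
  · refine ⟨fun p => m p j, ?_, fun ω hω r hr => rfl⟩
    rintro ⟨ω, r⟩ ⟨hω, hr⟩
    have hω' : ‖ω‖ = 1 := by simpa using hω
    exact (contDiffAt_pi.1 ((hg hr hω').1.1.of_le le_top) j).contDiffWithinAt
  · rintro ⟨ω, r⟩ ⟨hω, hr⟩
    have hω' : ‖ω‖ = 1 := by simpa using hω
    exact (hqr (p := (ω, r)) hω' (hg hr hω').1.1 j (hu hr hω' j)).contDiffWithinAt
  · rintro ⟨ω, r⟩ ⟨hω, hr⟩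
    have hω' : ‖ω‖ = 1 := by simpa using hω
    have h1 := hτ (p := (ω, r)) hω' (hg hr hω').1.1 j (hu hr hω' j)
    have h2 := hql (p := (ω, r)) hω' (hg hr hω').1.1 j (hu hr hω' j)
    have h4 : ContDiffAt ℝ (⊤ : ℕ∞) (fun p => (star (τ j p))⁻¹) (ω, r) :=
      ContDiffAt.inv (Complex.conjCLE.contDiff.contDiffAt.comp _ h1)
        (star_ne_zero.2 ((hg hr hω').2 j))
    exact (h4.smul ((riesz n W.X).contDiff.contDiffAt.comp _ h2)).contDiffWithinAt
  · refine ⟨fun h0 => ?_, rightVec_mem (hu hr hω j) (hdet hr hω j).1 _⟩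
    have := hnorm hr hω j
    rw [h0, inner_zero_right] at this
    exact zero_ne_one this
  · refine ⟨fun h0 => ?_, fun u => ?_⟩
    · have := hnorm hr hω j
      rw [h0, inner_zero_left] at this
      exact zero_ne_one this
    · rw [inner_smul_left, inner_smul_left, inner_riesz, inner_riesz]
      refine (congrArg (_ * ·) (leftDual_L (hu hr hω j) (hdet hr hω j).1 _ u)).trans ?_
      exact mul_left_comm _ _ _
  · exact hnorm hr hω j
  · intro i j hij
    have hr' : (r : ℂ) ≠ 0 := by exact_mod_cast hr.1.ne'
    have h := mul_left_cancel₀ hr' hij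
    exact (hg ⟨hr.1.le, hr.2⟩ hω).1.2.1.injective (congrArg Complex.im h)
  · have hr0 : r ≠ 0 := hr.1.ne'
    have hr' : (r : ℂ) ≠ 0 := by exact_mod_cast hr0
    have hrI : r ∈ Set.Ico 0 ε := ⟨hr.1.le, hr.2⟩
    ext l
    simp only [Set.mem_inter_iff, mem_ball_zero_iff, Set.mem_range]
    constructor
    -- No spectrum is missed: a spectral point in the `δ`-ball is `rμ` with `μ` a root of the
    -- determinant, the a priori bound gives `|μ| ≤ C`, and the roots in that ball are exactly the
    -- `μⱼ`.
    · rintro ⟨hl, hlδ⟩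
      obtain ⟨μ, rfl⟩ : ∃ μ : ℂ, l = r * μ := ⟨l / r, (mul_div_cancel₀ l hr').symm⟩
      obtain ⟨h1, h2⟩ := hbound ω hω r μ (hrδ hrI) hlδ
      have h4 := (mem_spec_iff h1 hr0).1 hl
      obtain ⟨j, hj⟩ := ((hg hrI hω).1.2.2 μ).1 ⟨h4, (h2 h4).trans hC₀.le⟩
      exact ⟨j, by rw [hj]⟩
    · rintro ⟨j, rfl⟩
      exact ⟨mem_spec (hu hrI hω j) (hdet hrI hω j).1, hrm hrI hω j⟩

end PeriodicWave
end Bloch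

/-! ### The function `ū'`, its equation, and means over a period. -/

namespace Bloch

section Classical

variable {n : ℕ} {X : ℝ} [Fact (0 < X)]

/-- A continuous periodic function as an element of `L²`. -/
def perLp {F : ℝ → CVec n} (hF : Continuous F) (hp : Function.Periodic F X) : L2Per n X :=
  ((ContinuousMap.mk hp.lift (hF.quotient_lift _) : C(AddCircle X, CVec n)).memLp (p := 2) volume ℂ).toLp

theorem perLp_coe {F : ℝ → CVec n} (hF : Continuous F) (hp : Function.Periodic F X) :
    perLp hF hp =ᵐ[volume] hp.lift :=
  MemLp.coeFn_toLp _

theorem integral_smul_perLp {F : ℝ → CVec n} (hF : Continuous F) (hp : Function.Periodic F X)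
    (φ : ℝ → ℂ) :
    ∫ x in (0 : ℝ)..X, φ x • perLp hF hp (x : AddCircle X) = ∫ x in (0 : ℝ)..X, φ x • F x := by
  apply intervalIntegral.integral_congr_ae
  filter_upwards [ae_coe (perLp_coe hF hp)] with x hx hxI
  rw [hx hxI]
  rfl

theorem isWeakDeriv_perLp {F F' : ℝ → CVec n} (hF : Continuous F) (hp : Function.Periodic F X)
    (hF' : Continuous F') (hp' : Function.Periodic F' X) (h : ∀ x, HasDerivAt F (F' x) x) :
    IsWeakDeriv (perLp hF hp) (perLp hF' hp') := by
  intro φ hφ hper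
  rw [integral_smul_perLp, integral_smul_perLp]
  have hd : Continuous (deriv φ) := hφ.continuous_deriv (by simp)
  have hφ' (x) : HasDerivAt φ (deriv φ x) x :=
    (hφ.differentiable (by simp) x).hasDerivAt
  have hi1 : IntervalIntegrable (fun x => φ x • F' x) volume 0 X :=
    (hφ.continuous.smul hF').intervalIntegrable _ _
  have hi2 : IntervalIntegrable (fun x => deriv φ x • F x) volume 0 X :=
    (hd.smul hF).intervalIntegrable _ _
  have h1 := intervalIntegral.integral_eq_sub_of_hasDerivAt (a := 0) (b := X)
    (f := fun x => φ x • F x) (fun x _ => (hφ' x).smul (h x)) (hi1.add hi2)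
  have h2 : φ X • F X - φ 0 • F 0 = 0 := by
    rw [← zero_add X, hper, hp, sub_self]
  rw [intervalIntegral.integral_add hi1 hi2, h2] at h1
  rw [eq_neg_iff_add_eq_zero, add_comm]
  exact h1

theorem eq_zero_of_perLp_eq_zero {F : ℝ → CVec n} (hF : Continuous F)
    (hp : Function.Periodic F X) (h : perLp hF hp = 0) (x : ℝ) : F x = 0 := by
  have h1 := perLp_coe hF hp
  rw [h] at h1
  have h2 : (hp.lift : AddCircle X → CVec n) =ᵐ[volume] fun _ => 0 :=
    h1.symm.trans (Lp.coeFn_zero _ _ _)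
  have hc : Continuous (hp.lift : AddCircle X → CVec n) := hF.quotient_lift _
  have h3 := (hc.ae_eq_iff_eq volume continuous_const).1 h2
  exact congrFun h3 (x : AddCircle X)

theorem mulOp_perLp {B : C(AddCircle X, CVec n →L[ℂ] CVec n)} {F F' : ℝ → CVec n}
    (hF : Continuous F) (hp : Function.Periodic F X) (hF' : Continuous F')
    (hp' : Function.Periodic F' X) (h : ∀ x : ℝ, B x (F x) = F' x) :
    mulOp B (perLp hF hp) = perLp hF' hp' := by
  apply Lp.ext
  filter_upwards [mulOp_coe B (perLp hF hp), perLp_coe hF hp, perLp_coe hF' hp'] with y h1 h2 h3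
  rw [h1, h2, h3]
  induction y using QuotientAddGroup.induction_on with
  | H x => exact h x

/-- Vanishing Fourier coefficients. -/
theorem eq_zero_of_forall_fourier (v : L2Per n X)
    (h : ∀ k : ℤ, ∫ x in (0 : ℝ)..X, fourier (-k) (x : AddCircle X) • v (x : AddCircle X) = 0) :
    v = 0 := by
  have hX : 0 < X := Fact.out
  have hcomp (i : Fin n) : ∀ᵐ y : AddCircle X, (v y) i = 0 := by
    have hm : MemLp (fun y : AddCircle X => (v y) i) 2 AddCircle.haarAddCircle := by
      have h1 : MemLp (fun y : AddCircle X => (v y) i) 2 volume :=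
        (EuclideanSpace.proj (𝕜 := ℂ) i).comp_memLp' (Lp.memLp v)
      have h2 := AddCircle.volume_eq_smul_haarAddCircle (T := X)
      refine MemLp.of_measure_le_smul (c := (ENNReal.ofReal X)⁻¹) ?_ ?_ h1
      · simp [hX]
      · rw [h2, smul_smul, ENNReal.inv_mul_cancel (by simp [hX]) (by simp), one_smul]
    have hz : hm.toLp _ = 0 := by
      apply fourierBasis.repr.injective
      ext k
      rw [fourierBasis_repr, fourierCoeff_congr_ae hm.coeFn_toLp,
        fourierCoeff_eq_intervalIntegral _ k 0, zero_add]
      have hk' := congrArg (EuclideanSpace.proj (𝕜 := ℂ) i) (h k)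
      rw [← ContinuousLinearMap.intervalIntegral_comp_comm _
        (intervalIntegrable_smul v (by fun_prop))] at hk'
      simp only [map_smul, map_zero] at hk'
      rw [map_zero]
      exact (congrArg ((1 / X : ℝ) • ·) hk').trans (smul_zero _)
    have hv := hm.coeFn_toLp
    rw [hz] at hv
    have h0 : ∀ᵐ y ∂(AddCircle.haarAddCircle : Measure (AddCircle X)), (v y) i = 0 := by
      filter_upwards [hv, Lp.coeFn_zero ℂ 2 (AddCircle.haarAddCircle : Measure (AddCircle X))]
        with y h1 h2
      rw [← h1, h2, Pi.zero_apply]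
    have h2 := Measure.ae_smul_measure h0 (ENNReal.ofReal X)
    rwa [← AddCircle.volume_eq_smul_haarAddCircle] at h2
  rw [Lp.eq_zero_iff_ae_eq_zero]
  filter_upwards [ae_all_iff.2 hcomp] with y hy
  ext i
  exact hy i

/-- A mean-free eigenfunction of `∂ₓ` with real eigenvalue vanishes. -/
theorem eq_zero_of_isWeakDeriv_smul {v : L2Per n X} {β : ℂ} (hβ : β.im = 0)
    (h : IsWeakDeriv v (β • v)) (h0 : periodIntegral n X v = 0) : v = 0 := by
  have hX : 0 < X := Fact.out
  -- On the `k`-th Fourier mode `∂ₓ` is multiplication by `2πik/X`, which for `k ≠ 0` is not real;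
  -- the mode `k = 0` is the mean.
  refine eq_zero_of_forall_fourier v fun k => ?_
  rcases eq_or_ne k 0 with rfl | hk
  · simpa [periodIntegral_apply] using h0
  have hsm : ContDiff ℝ (⊤ : ℕ∞) fun x : ℝ => fourier (-k) (x : AddCircle X) := by
    simp only [fourier_coe_apply]
    have h1 : ContDiff ℝ (⊤ : ℕ∞) fun x : ℝ => (x : ℂ) := Complex.ofRealCLM.contDiff
    fun_prop
  have h1 := h _ hsm fun x => by simp
  have hd : deriv (fun x : ℝ => fourier (-k) (x : AddCircle X)) = fun x : ℝ =>
      (2 * Real.pi * Complex.I * (-k : ℤ) / X) * fourier (-k) (x : AddCircle X) :=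
    funext fun x => (hasDerivAt_fourier X (-k) x).deriv
  rw [hd, integral_smul_smul] at h1
  simp only [mul_smul] at h1
  rw [intervalIntegral.integral_smul, ← neg_smul, ← sub_eq_zero, ← sub_smul] at h1
  refine (smul_eq_zero.1 h1).resolve_left fun h2 => ?_
  have h4 := congrArg Complex.im h2
  have e : (2 * Real.pi * Complex.I * (-k : ℤ) / X : ℂ) =
      ((-(2 * Real.pi * k / X) : ℝ) : ℂ) * Complex.I := by
    push_cast
    ring
  rw [e] at h4
  simp [hβ, hX.ne', Real.pi_ne_zero, hk] at h4

/-- Multiplication by a constant matrix commutes with the weak derivative. -/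
theorem IsWeakDeriv.mulOp_const {B : C(AddCircle X, CVec n →L[ℂ] CVec n)}
    {B₀ : CVec n →L[ℂ] CVec n} (hB : ∀ y, B y = B₀) {u v : L2Per n X} (h : IsWeakDeriv u v) :
    IsWeakDeriv (mulOp B u) (mulOp B v) := by
  have key (w : L2Per n X) {φ : ℝ → ℂ} (hφ : Continuous φ) :
      ∫ x in (0 : ℝ)..X, φ x • mulOp B w (x : AddCircle X) =
        B₀ (∫ x in (0 : ℝ)..X, φ x • w (x : AddCircle X)) := by
    rw [← ContinuousLinearMap.intervalIntegral_comp_comm _ (intervalIntegrable_smul w hφ)]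
    apply intervalIntegral.integral_congr_ae
    filter_upwards [ae_coe (mulOp_coe B w)] with x hx hxI
    rw [hx hxI, hB, map_smul]
  intro φ hφ hper
  rw [key u (hφ.continuous_deriv (by simp)), key v hφ.continuous, h φ hφ hper, map_neg]

end Classical

end Bloch

namespace Bloch

/-- The inclusion `ℝⁿ → ℂⁿ`. -/
def ofRealVec (n : ℕ) : RVec n →L[ℝ] CVec n :=
  LinearMap.toContinuousLinearMap
    { toFun := fun v => WithLp.toLp 2 fun i => (v i : ℂ)
      map_add' := fun v w => by ext i; simp
      map_smul' := fun c v => by ext i; simp }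

theorem ofRealVec_apply {n : ℕ} (v : RVec n) (i : Fin n) : ofRealVec n v i = (v i : ℂ) := rfl

theorem ofRealVec_injective {n : ℕ} : Function.Injective (ofRealVec n) := fun v w h => by
  ext i
  have := congrArg (fun z : CVec n => z i) h
  simpa [ofRealVec_apply] using this

namespace PeriodicWave

variable {n d : ℕ} [NeZero d] (W : PeriodicWave n d)

theorem jacobian_ofRealVec (j : Fin d) (u v : RVec n) :
    W.jacobian j u (ofRealVec n v) = ofRealVec n (fderiv ℝ (W.f j) u v) := by
  ext i
  rw [jacobian_apply, ofRealVec_apply]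
  conv_rhs => rw [← (EuclideanSpace.basisFun (Fin n) ℝ).sum_repr v]
  simp [ofRealVec_apply, mul_comm]

theorem continuous_ubar : Continuous W.ubar :=
  continuous_iff_continuousAt.2 fun x => (W.profile x).continuousAt

theorem deriv_ubar : deriv W.ubar = fun x => W.f 0 (W.ubar x) - W.qbar :=
  funext fun x => (W.profile x).deriv

theorem contDiffOn_f_two (j : Fin d) : ContDiffOn ℝ 2 (W.f j) W.U :=
  (W.contDiffOn_f j).of_le (by
    have := W.le_K
    exact_mod_cast (by omega : 2 ≤ W.K + 1))

theorem contDiff_ubar : ContDiff ℝ 2 W.ubar := by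
  have hd : Differentiable ℝ W.ubar := fun x => (W.profile x).differentiableAt
  have h (k : WithTop ℕ∞) (hk : k ≤ 2) (hu : ContDiff ℝ k W.ubar) : ContDiff ℝ k (deriv W.ubar) := by
    rw [W.deriv_ubar]
    exact (((W.contDiffOn_f_two 0).of_le hk).comp_contDiff hu W.ubar_mem).sub contDiff_const
  have h1 : ContDiff ℝ 1 W.ubar := by
    rw [contDiff_one_iff_deriv]
    exact ⟨hd, (h 0 (by simp) (contDiff_zero.2 W.continuous_ubar)).continuous⟩
  have h2 : ContDiff ℝ (1 + 1) W.ubar := contDiff_succ_iff_deriv.2 ⟨hd, by simp, h 1 (by norm_num) h1⟩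
  exact h2.of_le (by norm_num)

theorem contDiff_deriv_ubar : ContDiff ℝ 1 (deriv W.ubar) := by
  have h : ContDiff ℝ (1 + 1) W.ubar := W.contDiff_ubar.of_le (by norm_num)
  exact (contDiff_succ_iff_deriv.1 h).2.2

theorem periodic_deriv : Function.Periodic (deriv W.ubar) W.X := fun x => by
  rw [W.deriv_ubar]
  simp only [W.periodic_ubar x]

/-- `ū'` as an element of `L²`. -/
def ubarLp : L2Per n W.X :=
  perLp (F := fun x => ofRealVec n (deriv W.ubar x))
    ((ofRealVec n).continuous.comp W.contDiff_deriv_ubar.continuous) W.periodic_deriv_ubar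

theorem ubarLp_coe : W.ubarLp =ᵐ[volume] W.ubarDeriv := perLp_coe _ _

/-- The flux `fʲ(ū)` as an element of `L²`. -/
def fluxLp (j : Fin d) : L2Per n W.X :=
  perLp (F := fun x => ofRealVec n (W.f j (W.ubar x)))
    ((ofRealVec n).continuous.comp
      ((W.contDiffOn_f_two j).continuousOn.comp_continuous W.continuous_ubar W.ubar_mem))
    fun x => by simp only [W.periodic_ubar x]

theorem hasDerivAt_flux (j : Fin d) (x : ℝ) :
    HasDerivAt (fun x => W.f j (W.ubar x)) (fderiv ℝ (W.f j) (W.ubar x) (deriv W.ubar x)) x := by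
  have h1 : DifferentiableAt ℝ (W.f j) (W.ubar x) :=
    ((W.contDiffOn_f_two j).contDiffAt (W.isOpen_U.mem_nhds (W.ubar_mem x))).differentiableAt
      (by simp)
  exact h1.hasFDerivAt.comp_hasDerivAt x (W.contDiff_ubar.differentiable (by simp) x).hasDerivAt

theorem contDiff_deriv_flux (j : Fin d) :
    ContDiff ℝ 1 fun x => fderiv ℝ (W.f j) (W.ubar x) (deriv W.ubar x) := by
  have h1 : ContDiffOn ℝ 1 (fderiv ℝ (W.f j)) W.U :=
    (W.contDiffOn_f_two j).fderiv_of_isOpen W.isOpen_U (by norm_num)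
  exact (h1.comp_contDiff (W.contDiff_ubar.of_le (by norm_num)) W.ubar_mem).clm_apply
    W.contDiff_deriv_ubar

theorem periodic_deriv_flux (j : Fin d) : Function.Periodic
    (fun x => ofRealVec n (fderiv ℝ (W.f j) (W.ubar x) (deriv W.ubar x))) W.X := fun x => by
  simp only [W.periodic_ubar x, W.periodic_deriv x]

theorem A_ubarLp (j : Fin d) : W.A j W.ubarLp =
    perLp ((ofRealVec n).continuous.comp (W.contDiff_deriv_flux j).continuous)
      (W.periodic_deriv_flux j) :=
  mulOp_perLp _ _ _ _ fun _ => W.jacobian_ofRealVec j _ _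

theorem isWeakDeriv_fluxLp (j : Fin d) : IsWeakDeriv (W.fluxLp j) (W.A j W.ubarLp) := by
  rw [A_ubarLp]
  exact isWeakDeriv_perLp _ _ _ _ fun x =>
    (ofRealVec n).hasFDerivAt.comp_hasDerivAt x (W.hasDerivAt_flux j x)

theorem hasDerivAt_deriv_ubar (x : ℝ) :
    HasDerivAt (deriv W.ubar) (fderiv ℝ (W.f 0) (W.ubar x) (deriv W.ubar x)) x := by
  have h : deriv W.ubar = fun x => W.f 0 (W.ubar x) - W.qbar := W.deriv_ubar
  rw [show HasDerivAt (deriv W.ubar) = HasDerivAt fun x => W.f 0 (W.ubar x) - W.qbar by rw [h]]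
  exact (W.hasDerivAt_flux 0 x).sub_const _

/-- The profile equation differentiated once: `ū'' = A¹ū'`. -/
theorem isWeakDeriv_ubarLp : IsWeakDeriv W.ubarLp (W.A 0 W.ubarLp) := by
  rw [A_ubarLp]
  exact isWeakDeriv_perLp _ _ _ _ fun x =>
    (ofRealVec n).hasFDerivAt.comp_hasDerivAt x (W.hasDerivAt_deriv_ubar x)

theorem exists_isWeakDeriv_A_ubarLp (j : Fin d) : ∃ v, IsWeakDeriv (W.A j W.ubarLp) v := by
  rw [A_ubarLp]
  have h := W.contDiff_deriv_flux j
  have hp : Function.Periodic (fun x => ofRealVec n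
      (deriv (fun x => fderiv ℝ (W.f j) (W.ubar x) (deriv W.ubar x)) x)) W.X := fun x => by
    beta_reduce
    rw [← deriv_comp_add_const]
    simp only [W.periodic_ubar _, W.periodic_deriv _]
  refine ⟨perLp ((ofRealVec n).continuous.comp (h.continuous_deriv le_rfl)) hp, ?_⟩
  exact isWeakDeriv_perLp _ _ _ _ fun x =>
    (ofRealVec n).hasFDerivAt.comp_hasDerivAt x (h.differentiable (by simp) x).hasDerivAt

theorem ubarLp_mem_dom : W.ubarLp ∈ W.dom := by
  obtain ⟨v, hv⟩ := W.exists_isWeakDeriv_A_ubarLp 0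
  exact W.mem_dom W.isWeakDeriv_ubarLp hv hv

/-- `ū'` as an element of the domain. -/
def ubarDom : W.dom := ⟨W.ubarLp, W.ubarLp_mem_dom⟩

theorem ubarDom_coe : (W.ubarDom : L2Per n W.X) = W.ubarLp := rfl

theorem dx_ubarDom : W.dx W.ubarDom = W.A 0 W.ubarLp :=
  W.dx_eq (u := W.ubarDom) W.isWeakDeriv_ubarLp

theorem L_zero_ubarDom : W.L 0 W.ubarDom = 0 := by
  obtain ⟨v, hv⟩ := W.exists_isWeakDeriv_A_ubarLp 0
  rw [L_zero_apply, W.dxA_eq (u := W.ubarDom) hv,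
    W.dxx_eq (u := W.ubarDom) W.isWeakDeriv_ubarLp hv, sub_self]

theorem ubarLp_mem_ker0 : W.ubarLp ∈ W.ker0 := by
  exact mem_ker0.2 ⟨W.ubarLp_mem_dom, W.L_zero_ubarDom⟩

theorem periodIntegral_ubarLp : periodIntegral n W.X W.ubarLp = 0 := by
  have h : IsWeakDeriv (perLp ((ofRealVec n).continuous.comp W.continuous_ubar)
      (X := W.X) fun x => by simp only [Function.comp_apply, W.periodic_ubar x]) W.ubarLp :=
    isWeakDeriv_perLp _ _ _ _ fun x => (ofRealVec n).hasFDerivAt.comp_hasDerivAt x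
      (W.contDiff_ubar.differentiable (by simp) x).hasDerivAt
  exact h.periodIntegral_eq_zero

/-- Each term is an exact derivative: `Aʲū' = (fʲ(ū))'`, and `∂ₓū' = A¹ū'`. -/
theorem periodIntegral_L1_ubarLp (ω : RVec d) :
    periodIntegral n W.X (W.L1 ω W.ubarDom) = 0 := by
  rw [L1_apply, dx_ubarDom, ubarDom_coe]
  simp [(W.isWeakDeriv_fluxLp _).periodIntegral_eq_zero]

theorem periodIntegral_L_zero (u : W.dom) : periodIntegral n W.X (W.L 0 u) = 0 := by
  rw [L_zero_apply, map_sub, (W.isWeakDeriv_dxx u).periodIntegral_eq_zero,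
    (W.isWeakDeriv_dxA u).periodIntegral_eq_zero, sub_zero]

theorem periodIntegral_of_mem_ran0 {h : L2Per n W.X} (hh : h ∈ W.ran0) :
    periodIntegral n W.X h = 0 := by
  obtain ⟨u, rfl⟩ := hh
  exact W.periodIntegral_L_zero u

variable {W}

theorem exists_ker0_add_ran0 (h3 : W.D3) (h : L2Per n W.X) :
    ∃ k ∈ W.ker0, ∃ u : W.dom, h = k + W.L 0 u := by
  have h1 : h ∈ W.ker0 ⊔ W.ran0 := h3.1.sup_eq_top ▸ Submodule.mem_top
  obtain ⟨k, hk, _, ⟨u, rfl⟩, h2⟩ := Submodule.mem_sup.1 h1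
  exact ⟨k, hk, u, h2.symm⟩

/-- The period integral on `ker L_0`. -/
def kerMean (W : PeriodicWave n d) : W.ker0 →ₗ[ℂ] CVec n :=
  (periodIntegral n W.X : L2Per n W.X →ₗ[ℂ] CVec n) ∘ₗ W.ker0.subtype

theorem kerMean_apply (k : W.ker0) : W.kerMean k = periodIntegral n W.X k := rfl

/-- Every vector is the mean of some function, and removing the `ran L_0` component does not change
the mean. -/
theorem kerMean_surjective (h3 : W.D3) : Function.Surjective W.kerMean := fun c => by
  obtain ⟨h, rfl⟩ := periodIntegral_surjective (n := n) (X := W.X) c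
  obtain ⟨k, hk, u, rfl⟩ := exists_ker0_add_ran0 h3 h
  refine ⟨⟨k, hk⟩, ?_⟩
  rw [kerMean_apply, map_add, periodIntegral_L_zero, add_zero]

theorem finrank_ker_kerMean (h3 : W.D3) : Module.finrank ℂ (LinearMap.ker W.kerMean) = 1 := by
  have := h3.finiteDimensional
  have h := LinearMap.finrank_range_add_finrank_ker W.kerMean
  rw [LinearMap.range_eq_top.2 (kerMean_surjective h3), finrank_top, finrank_euclideanSpace_fin,
    h3.2] at h
  omega

end PeriodicWave
end Bloch

/-! ### Nonconstancy of the wave, and `ū'` as an eigenvector of `Π₀ L¹_ω`. -/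

namespace Bloch
namespace PeriodicWave

variable {n d : ℕ} [NeZero d] {W : PeriodicWave n d}

theorem coeff_eq_of_ubarLp_eq_zero (h0 : W.ubarLp = 0) (j : Fin d) (y : AddCircle W.X) :
    W.coeff j y = W.jacobian j (W.ubar 0) := by
  have h1 (x : ℝ) : deriv W.ubar x = 0 :=
    ofRealVec_injective ((eq_zero_of_perLp_eq_zero _ _ h0 x).trans (map_zero _).symm)
  induction y using QuotientAddGroup.induction_on with
  | H x =>
    have h2 := is_const_of_deriv_eq_zero (W.contDiff_ubar.differentiable (by simp)) h1 x 0
    rw [← h2]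
    rfl

theorem L_smul_single_of_eigenfunction {u : W.dom} (hu : W.L 0 u = 0) {β : ℂ}
    (h1 : W.dx u = β • (u : L2Per n W.X)) (h2 : W.A 0 u = β • (u : L2Per n W.X)) (t : ℝ) :
    W.L (t • EuclideanSpace.single 0 1) u =
      ((t : ℂ) * Complex.I * β - (t : ℂ) ^ 2) • (u : L2Per n W.X) := by
  have e1 : ∑ j ∈ Finset.univ.erase (0 : Fin d),
      ((EuclideanSpace.single 0 1 : RVec d) j : ℂ) • W.A j u = 0 := by
    refine Finset.sum_eq_zero fun j hj => ?_
    simp [Finset.ne_of_mem_erase hj]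
  have e2 : ∑ j, ((EuclideanSpace.single 0 1 : RVec d) j : ℂ) ^ 2 = 1 := by
    rw [sum_sq_eq_norm_sq]
    simp
  rw [L_smul, hu, L1_apply, e1, e2, h1, h2, zero_add, sub_zero]
  simp only [PiLp.single_apply, if_true, Complex.ofReal_one]
  module

/-- Such a `u` is an eigenfunction of `L_{t e₁}` for `itβ - t²`. If `Im β ≠ 0`, a small `t` of sign
opposite to `Im β` makes the real part `-t Im β - t²` nonnegative, against (D1). -/
theorem im_eq_zero_of_eigenfunction (hD1 : W.D1) {u : W.dom} (hu0 : u ≠ 0) (hu : W.L 0 u = 0)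
    {β : ℂ} (h1 : W.dx u = β • (u : L2Per n W.X)) (h2 : W.A 0 u = β • (u : L2Per n W.X)) :
    β.im = 0 := by
  by_contra hb
  have hX : 0 < W.X := W.X_pos
  have hb' : 0 < |β.im| := abs_pos.2 hb
  -- With `t = -s Im β` the real part is `s (1 - s) (Im β)²`, so `s ≤ 1` suffices; the other bound
  -- keeps `|t| ≤ π/X`.
  let s : ℝ := min 1 (Real.pi / W.X / |β.im|)
  have hs : 0 < s := lt_min one_pos (by positivity)
  have hs1 : s ≤ 1 := min_le_left _ _
  let t : ℝ := -(s * β.im)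
  have ht : t ≠ 0 := neg_ne_zero.2 (mul_ne_zero hs.ne' hb)
  have hre := hD1 (t • EuclideanSpace.single 0 1) ?_ ?_ _
    (mem_spec_of_eigenfunction hu0 (L_smul_single_of_eigenfunction hu h1 h2 t))
  · have e : ((t : ℂ) * Complex.I * β - (t : ℂ) ^ 2).re = -(t * β.im) - t ^ 2 := by
      simp [pow_two]
    rw [e] at hre
    have : 0 ≤ -(t * β.im) - t ^ 2 := by
      have e2 : -(t * β.im) - t ^ 2 = s * (1 - s) * β.im ^ 2 := by
        simp only [t]
        ring
      rw [e2]
      have := sub_nonneg.2 hs1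
      positivity
    linarith
  · simp only [PiLp.smul_apply, PiLp.single_apply, if_true, smul_eq_mul, mul_one, t, abs_neg,
      abs_mul, abs_of_pos hs]
    calc s * |β.im| ≤ Real.pi / W.X / |β.im| * |β.im| :=
          mul_le_mul_of_nonneg_right (min_le_right _ _) hb'.le
      _ = _ := div_mul_cancel₀ _ hb'.ne'
  · refine smul_ne_zero ht fun h => ?_
    have := congrArg (fun v : RVec d => v 0) h
    simp at this

/-- The wave is not constant. -/
theorem ubarLp_ne_zero (hD1 : W.D1) (h3 : W.D3) : W.ubarLp ≠ 0 := by
  intro h0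
  have hA {u v : L2Per n W.X} (h : IsWeakDeriv u v) : IsWeakDeriv (W.A 0 u) (W.A 0 v) :=
    h.mulOp_const (coeff_eq_of_ubarLp_eq_zero h0 0)
  -- For a constant wave `A¹` commutes with `∂ₓ`, so `∂ₓ` preserves the line of mean-free elements
  -- of `ker L_0`, and `k' = βk` on its generator. If `β ≠ 0`, the kernel equation `k'' = A¹k'`
  -- gives `A¹k = βk`, so `β` is real by (D1). A mean-free `k` with real `β` vanishes.
  obtain ⟨⟨k, hk⟩, hk0, hgen⟩ := finrank_eq_one_iff'.1 (finrank_ker_kerMean h3)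
  obtain ⟨hdom, hL⟩ := mem_ker0.1 k.2
  have hkm : periodIntegral n W.X k = 0 := hk
  have hkne : (k : L2Per n W.X) ≠ 0 := fun h => hk0 (Subtype.ext (Subtype.ext h))
  let u : W.dom := ⟨k, hdom⟩
  let v : L2Per n W.X := W.dx u
  have huv : IsWeakDeriv (k : L2Per n W.X) v := W.isWeakDeriv_dx u
  have hLu : W.L 0 u = 0 := hL
  have hvA : IsWeakDeriv v (W.A 0 v) := by
    have h1 := W.isWeakDeriv_dxx u
    rw [L_zero_apply, sub_eq_zero, W.dxA_eq (u := u) (hA huv)] at hLu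
    rwa [hLu] at h1
  have hvdom : v ∈ W.dom := W.mem_dom hvA (hA hvA) (hA hvA)
  have hvker : v ∈ W.ker0 := by
    refine mem_ker0.2 ⟨hvdom, ?_⟩
    rw [L_zero_apply, W.dxx_eq (u := ⟨v, hvdom⟩) hvA (hA hvA), W.dxA_eq (u := ⟨v, hvdom⟩) (hA hvA),
      sub_self]
  obtain ⟨β, hβ⟩ := hgen ⟨⟨v, hvker⟩, huv.periodIntegral_eq_zero⟩
  have hβv : W.dx u = β • (k : L2Per n W.X) :=
    (congrArg (fun z : LinearMap.ker W.kerMean => ((z : W.ker0) : L2Per n W.X)) hβ).symm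
  have hwd : IsWeakDeriv (k : L2Per n W.X) (β • (k : L2Per n W.X)) := hβv ▸ huv
  refine hkne (eq_zero_of_isWeakDeriv_smul ?_ hwd hkm)
  by_contra him
  have hβ0 : β ≠ 0 := fun h => him (by rw [h]; rfl)
  have h1 : IsWeakDeriv v (β • v) :=
    (weakDerivGraph n W.X).smul_mem β (show ((k : L2Per n W.X), v) ∈ weakDerivGraph n W.X from huv)
      |> fun h => by
        have e : v = β • (k : L2Per n W.X) := hβv
        change IsWeakDeriv (β • (k : L2Per n W.X)) (β • v) at h
        rwa [← e] at h
  have h2 : W.A 0 v = β • v := hvA.unique h1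
  have h4 : W.A 0 (k : L2Per n W.X) = β • (k : L2Per n W.X) := by
    have e : v = β • (k : L2Per n W.X) := hβv
    rw [e, map_smul] at h2
    exact smul_right_injective _ hβ0 h2
  exact him (im_eq_zero_of_eigenfunction hD1 (u := u) (fun h => hkne (congrArg Subtype.val h)) hL
    hβv h4)

/-- The elements of `ker L_0` with mean zero are the multiples of `ū'`. -/
theorem exists_eq_smul_ubarLp (hD1 : W.D1) (h3 : W.D3) {k : L2Per n W.X} (hk : k ∈ W.ker0)
    (h0 : periodIntegral n W.X k = 0) : ∃ c : ℂ, k = c • W.ubarLp := by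
  obtain ⟨c, hc⟩ := exists_smul_eq_of_finrank_eq_one (finrank_ker_kerMean h3)
    (x := ⟨⟨W.ubarLp, W.ubarLp_mem_ker0⟩, W.periodIntegral_ubarLp⟩)
    (fun h => ubarLp_ne_zero hD1 h3
      (congrArg (fun z : LinearMap.ker W.kerMean => ((z : W.ker0) : L2Per n W.X)) h))
    ⟨⟨k, hk⟩, h0⟩
  exact ⟨c, (congrArg (fun z : LinearMap.ker W.kerMean => ((z : W.ker0) : L2Per n W.X)) hc).symm⟩

/-- `ū'` as an element of `ker L_0`. -/
def ubarKer (W : PeriodicWave n d) : W.ker0 := ⟨W.ubarLp, W.ubarLp_mem_ker0⟩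

theorem projectionOnto_sub_mem (h3 : W.D3) (h : L2Per n W.X) :
    h - W.ker0.projectionOnto W.ran0 h3.1 h ∈ W.ran0 := by
  rw [← Submodule.projectionOnto_apply_eq_zero_iff h3.1, map_sub,
    Submodule.projectionOnto_apply_left, sub_self]

/-- `L¹_ω ū'` has mean zero, and so has its projection, since `ran L_0` is mean-free; the mean-free
part of `ker L_0` is spanned by `ū'`. -/
theorem exists_reduced_ubarKer (hD1 : W.D1) (h3 : W.D3) (ω : RVec d) :
    ∃ β : ℂ, reduced h3 ω W.ubarKer = β • W.ubarKer := by
  obtain ⟨β, hβ⟩ := exists_eq_smul_ubarLp hD1 h3 (reduced h3 ω W.ubarKer).2 <| by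
    have h := W.periodIntegral_of_mem_ran0 (projectionOnto_sub_mem h3 (W.L1 ω W.ubarDom))
    rw [map_sub, periodIntegral_L1_ubarLp, zero_sub, neg_eq_zero] at h
    exact h
  exact ⟨β, Subtype.ext hβ⟩

/-- An element of `L²` orthogonal to `ran L_0` and to `ū'` is constant. -/
theorem eq_constFun_of_orthogonal (hD1 : W.D1) (h3 : W.D3) {w : L2Per n W.X}
    (h1 : ∀ u : W.dom, inner ℂ w (W.L 0 u) = 0) (h2 : inner ℂ w W.ubarLp = 0) :
    ∃ c : CVec n, w = constFun n W.X c := by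
  have hX : W.X ≠ 0 := W.X_pos.ne'
  let c : CVec n := W.X⁻¹ • periodIntegral n W.X w
  let h : L2Per n W.X := w - constFun n W.X c
  have hm : periodIntegral n W.X h = 0 := by
    rw [map_sub, periodIntegral_constFun, smul_smul, mul_inv_cancel₀ hX, one_smul, sub_self]
  -- The mean-free part `h` of `w` lies in `span ū' + ran L_0`, to which `w` is orthogonal.
  -- Constants are orthogonal to `h` too, hence `⟪h, h⟫ = 0`.
  have hw : inner ℂ w h = 0 := by
    obtain ⟨k, hk, u, hku⟩ := exists_ker0_add_ran0 h3 h
    rw [hku, map_add, periodIntegral_L_zero, add_zero] at hm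
    obtain ⟨b, rfl⟩ := exists_eq_smul_ubarLp hD1 h3 hk hm
    rw [hku, inner_add_right, h1, inner_smul_right, h2, mul_zero, add_zero]
  refine ⟨c, sub_eq_zero.1 (inner_self_eq_zero (𝕜 := ℂ).1 ?_)⟩
  change inner ℂ (w - constFun n W.X c) h = 0
  rw [inner_sub_left, hw, inner_constFun, hm, inner_zero_right, sub_zero]

end PeriodicWave
end Bloch

/-! ### The limit `r → 0` of an eigensystem, and adaptedness. -/

/-- An eigenvector of an endomorphism with simple eigenvalues is parallel to one member of a dual
pair of bases of eigenvectors. -/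
theorem exists_eq_smul_of_dual_eigenvectors {V : Type*} [AddCommGroup V] [Module ℂ V] {N : ℕ}
    (hN : Module.finrank ℂ V = N + 1) {T : Module.End ℂ V} {e : Fin (N + 1) → V}
    {l : Fin (N + 1) → V →ₗ[ℂ] ℂ} {μ : Fin (N + 1) → ℂ} (hdual : ∀ i j, l i (e j) = if i = j then 1 else 0)
    (hT : ∀ i v, l i (T v) = μ i * l i v)
    (hsimple : ∀ z, T.HasEigenvalue z → Module.finrank ℂ (T.eigenspace z) = 1) {b : V} (hb : b ≠ 0)
    {β : ℂ} (hTb : T b = β • b) : ∃ j₀, (∀ j, l j b ≠ 0 ↔ j = j₀) ∧ b = l j₀ b • e j₀ := by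
  have hli : LinearIndependent ℂ e := by
    rw [Fintype.linearIndependent_iff]
    intro g hg i
    have := congrArg (l i) hg
    simpa [hdual] using this
  let B := basisOfLinearIndependentOfCardEqFinrank hli (by simp [hN])
  have hB (i) : B i = e i := by simp [B]
  have hexp (x : V) : x = ∑ i, l i x • e i := by
    have h : (LinearMap.id : V →ₗ[ℂ] V) = ∑ i, (l i).smulRight (e i) := by
      refine B.ext fun j => ?_
      simp [hB, hdual]
    have := LinearMap.congr_fun h x
    simpa using this
  have hTe (j) : T (e j) = μ j • e j := by
    rw [hexp (T (e j))]
    simp [hT, hdual]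
  obtain ⟨j₀, hj₀⟩ : ∃ j, l j b ≠ 0 := by
    by_contra! h
    exact hb (by rw [hexp b]; simp [h])
  have hμ {j} (hj : l j b ≠ 0) : μ j = β := by
    have := hT j b
    rw [hTb, map_smul, smul_eq_mul] at this
    exact (mul_right_cancel₀ hj this).symm
  have heig {j} (hj : l j b ≠ 0) : e j ∈ T.eigenspace β := by
    rw [Module.End.mem_eigenspace_iff, hTe, hμ hj]
  have he0 (j) : e j ≠ 0 := fun h => by
    have := hdual j j
    rw [h, map_zero, if_pos rfl] at this
    exact zero_ne_one this
  have hev : T.HasEigenvalue β :=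
    Module.End.hasEigenvalue_of_hasEigenvector ⟨heig hj₀, he0 j₀⟩
  have huniq {j} (hj : l j b ≠ 0) : j = j₀ := by
    obtain ⟨c, hc⟩ := exists_smul_eq_of_finrank_eq_one (hsimple β hev) (x := ⟨e j₀, heig hj₀⟩)
      (fun h => he0 j₀ (congrArg Subtype.val h)) ⟨e j, heig hj⟩
    have h1 : c • e j₀ = e j := congrArg Subtype.val hc
    by_contra hne
    have h2 := hdual j j
    rw [← h1, map_smul, hdual, if_neg hne, if_pos rfl, smul_zero] at h2
    exact zero_ne_one h2
  refine ⟨j₀, fun j => ⟨huniq, fun h => h ▸ hj₀⟩, ?_⟩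
  conv_lhs => rw [hexp b]
  refine Finset.sum_eq_single j₀ (fun j _ hj => ?_) (by simp)
  rw [not_not.1 (mt huniq hj), zero_smul]

namespace Bloch
namespace PeriodicWave

open scoped Topology

theorem tendsto_ray {d : ℕ} {ε : ℝ} (hε : 0 < ε) {ω : RVec d} (hω : ‖ω‖ = 1) :
    Filter.Tendsto (fun r : ℝ => (ω, r)) (𝓝[>] 0)
      (𝓝[Metric.sphere 0 1 ×ˢ Set.Ico 0 ε] (ω, 0)) := by
  refine tendsto_nhdsWithin_iff.2 ⟨?_, ?_⟩
  · exact (Continuous.tendsto (by fun_prop) (0 : ℝ)).mono_left nhdsWithin_le_nhds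
  · filter_upwards [Ioo_mem_nhdsGT hε] with r hr
    exact ⟨by simpa using hω, hr.1.le, hr.2⟩

theorem _root_.ContinuousOn.tendsto_ray {d : ℕ} {ε : ℝ} (hε : 0 < ε) {ω : RVec d} (hω : ‖ω‖ = 1)
    {Y : Type*} [TopologicalSpace Y] {f : RVec d × ℝ → Y}
    (hf : ContinuousOn f (Metric.sphere 0 1 ×ˢ Set.Ico 0 ε)) :
    Filter.Tendsto (fun r : ℝ => f (ω, r)) (𝓝[>] 0) (𝓝 (f (ω, 0))) :=
  Filter.Tendsto.comp (hf (ω, 0) ⟨by simpa using hω, le_rfl, hε⟩) (PeriodicWave.tendsto_ray hε hω)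

variable {n d : ℕ} [NeZero d] {W : PeriodicWave n d}

theorem IsRightEigenfunction.smul {ξ : RVec d} {l : ℂ} {v : L2Per n W.X}
    (h : W.IsRightEigenfunction ξ l v) {c : ℂ} (hc : c ≠ 0) :
    W.IsRightEigenfunction ξ l (c • v) := by
  obtain ⟨h0, hd, hv⟩ := h
  refine ⟨smul_ne_zero hc h0, W.dom.smul_mem c hd, ?_⟩
  have : (⟨c • v, W.dom.smul_mem c hd⟩ : W.dom) = c • ⟨v, hd⟩ := rfl
  rw [this, map_smul, hv, smul_comm]

theorem IsLeftEigenfunction.smul {ξ : RVec d} {l : ℂ} {w : L2Per n W.X}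
    (h : W.IsLeftEigenfunction ξ l w) {c : ℂ} (hc : c ≠ 0) :
    W.IsLeftEigenfunction ξ l (c • w) := by
  refine ⟨smul_ne_zero hc h.1, fun u => ?_⟩
  rw [inner_smul_left, inner_smul_left, h.2, mul_left_comm]

namespace IsEigensystem

variable {ε δ : ℝ} {lam : Fin (n + 1) → RVec d → ℝ → ℂ}
  {q qt : Fin (n + 1) → RVec d → ℝ → L2Per n W.X}

theorem lam_zero (h : W.IsEigensystem ε δ lam q qt) (j) {ω : RVec d} (hω : ‖ω‖ = 1) :
    lam j ω 0 = 0 := by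
  obtain ⟨μ, -, hμ⟩ := h.smooth_lam j
  rw [hμ ω hω 0 ⟨le_rfl, h.ε_pos⟩, Complex.ofReal_zero, zero_mul]

theorem q_zero_mem_ker0 (h : W.IsEigensystem ε δ lam q qt) (j) {ω : RVec d} (hω : ‖ω‖ = 1) :
    q j ω 0 ∈ W.ker0 := by
  obtain ⟨_, hd, hq⟩ := h.right j ω hω 0 ⟨le_rfl, h.ε_pos⟩
  rw [h.lam_zero j hω, zero_smul, zero_smul] at hq
  exact mem_ker0.2 ⟨hd, hq⟩

theorem inner_qt_zero_L (h : W.IsEigensystem ε δ lam q qt) (j) {ω : RVec d} (hω : ‖ω‖ = 1)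
    (u : W.dom) : inner ℂ (qt j ω 0) (W.L 0 u) = 0 := by
  have h1 := (h.left j ω hω 0 ⟨le_rfl, h.ε_pos⟩).2 u
  rwa [h.lam_zero j hω, zero_smul, zero_mul] at h1

/-- At `r = 0` all eigenvalues coincide and give no orthogonality. It holds for `r > 0`, where they
are distinct, and passes to the limit by continuity. -/
theorem inner_qt_zero_q_zero (h : W.IsEigensystem ε δ lam q qt) (i j) {ω : RVec d}
    (hω : ‖ω‖ = 1) : inner ℂ (qt i ω 0) (q j ω 0) = if i = j then (1 : ℂ) else 0 := by
  have h0 : (0 : ℝ) ∈ Set.Ico 0 ε := ⟨le_rfl, h.ε_pos⟩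
  split_ifs with hij
  · rw [hij, h.normalized j ω hω 0 h0]
  have h1 := (ContinuousOn.inner (𝕜 := ℂ) (h.smooth_qt i).continuousOn
    (h.smooth_q j).continuousOn).tendsto_ray h.ε_pos hω
  refine tendsto_nhds_unique h1 (tendsto_const_nhds.congr' ?_)
  filter_upwards [Ioo_mem_nhdsGT h.ε_pos] with r hr
  have hr' : r ∈ Set.Ico 0 ε := ⟨hr.1.le, hr.2⟩
  obtain ⟨_, hd, hq⟩ := h.right j ω hω r hr'
  have h2 := (h.left i ω hω r hr').2 ⟨_, hd⟩
  rw [hq, inner_smul_right, ← sub_eq_zero, ← sub_mul] at h2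
  refine ((mul_eq_zero.1 h2).resolve_left (sub_ne_zero.2 fun h3 => hij ?_)).symm
  exact (h.distinct ω hω r hr h3).symm

/-- On `ker L_0` the left eigenvalue relation reads `r⟪q̃, L¹u⟫ - r²⟪q̃, u⟫ = rμ⟪q̃, u⟫`; divide by
`r` and let `r → 0`. -/
theorem exists_inner_qt_zero_L1 (h : W.IsEigensystem ε δ lam q qt) (j) {ω : RVec d}
    (hω : ‖ω‖ = 1) : ∃ μ : ℂ, ∀ u : W.dom, W.L 0 u = 0 →
      inner ℂ (qt j ω 0) (W.L1 ω u) = μ * inner ℂ (qt j ω 0) (u : L2Per n W.X) := by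
  obtain ⟨μ, hμ, hlam⟩ := h.smooth_lam j
  refine ⟨μ (ω, 0), fun u hu => ?_⟩
  have hi (v : L2Per n W.X) : Filter.Tendsto (fun r => inner ℂ (qt j ω r) v) (𝓝[>] 0)
      (𝓝 (inner ℂ (qt j ω 0) v)) :=
    (ContinuousOn.inner (𝕜 := ℂ) (h.smooth_qt j).continuousOn
      (continuousOn_const (c := v))).tendsto_ray h.ε_pos hω
  have hr0 : Filter.Tendsto (fun r : ℝ => (r : ℂ)) (𝓝[>] 0) (𝓝 0) :=
    (Complex.continuous_ofReal.tendsto' 0 0 Complex.ofReal_zero).mono_left nhdsWithin_le_nhds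
  have h1 := (((hμ.continuousOn.tendsto_ray h.ε_pos hω).add hr0).mul (hi u))
  rw [add_zero] at h1
  refine tendsto_nhds_unique (hi (W.L1 ω u)) (h1.congr' ?_)
  filter_upwards [Ioo_mem_nhdsGT h.ε_pos] with r hr
  have hr' : r ∈ Set.Ico 0 ε := ⟨hr.1.le, hr.2⟩
  have h2 := (h.left j ω hω r hr').2 u
  have hrne : (r : ℂ) ≠ 0 := by exact_mod_cast hr.1.ne'
  rw [L_smul, hu, zero_add, sum_sq_eq_norm_sq, hω, inner_sub_right, inner_smul_right,
    inner_smul_right, hlam ω hω r hr'] at h2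
  refine mul_left_cancel₀ hrne ?_
  push_cast at h2
  linear_combination -h2

/-- The member of an eigensystem that is parallel to `ū'` at `r = 0`. -/
theorem exists_index (h : W.IsEigensystem ε δ lam q qt) (hD1 : W.D1) {h3 : W.D3} (hH3 : H3 h3)
    {ω : RVec d} (hω : ‖ω‖ = 1) :
    ∃ j₀, (∀ j, inner ℂ (qt j ω 0) W.ubarLp ≠ (0 : ℂ) ↔ j = j₀) ∧
      W.ubarLp = (inner ℂ (qt j₀ ω 0) W.ubarLp : ℂ) • q j₀ ω 0 := by
  choose μ hμ using fun j => h.exists_inner_qt_zero_L1 j hω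
  obtain ⟨β, hβ⟩ := exists_reduced_ubarKer hD1 h3 ω
  -- `q̃ᵢ(ω, 0)` annihilates `ran L_0`, so `L¹_ω v` may be replaced by its projection: `q̃ᵢ(ω, 0)`
  -- is a left eigenvector of `Π₀ L¹_ω`.
  have hT (i) (v : W.ker0) : inner ℂ (qt i ω 0) (reduced h3 ω v : L2Per n W.X) =
      μ i * inner ℂ (qt i ω 0) (v : L2Per n W.X) := by
    obtain ⟨hd, hL⟩ := mem_ker0.1 v.2
    have h4 := hμ i ⟨v, hd⟩ hL
    obtain ⟨u, hu⟩ := projectionOnto_sub_mem h3 (W.L1 ω ⟨v, hd⟩)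
    have h5 := h.inner_qt_zero_L i hω u
    rw [hu, inner_sub_right, sub_eq_zero] at h5
    exact h5.symm.trans h4
  obtain ⟨j₀, h1, h2⟩ := exists_eq_smul_of_dual_eigenvectors h3.2 (T := reduced h3 ω)
    (e := fun j => ⟨q j ω 0, h.q_zero_mem_ker0 j hω⟩)
    (l := fun i => (innerSL ℂ (qt i ω 0) : L2Per n W.X →ₗ[ℂ] ℂ) ∘ₗ W.ker0.subtype) (μ := μ)
    (fun i j => h.inner_qt_zero_q_zero i j hω) hT
    (fun z hz => Green.finrank_eigenspace_reduced hH3 hω hz)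
    (fun h0 => ubarLp_ne_zero hD1 h3 (congrArg Subtype.val h0)) hβ
  exact ⟨j₀, h1, congrArg Subtype.val h2⟩

end IsEigensystem

end PeriodicWave
end Bloch

namespace Bloch
namespace PeriodicWave
namespace IsEigensystem

open scoped Topology

theorem _root_.ContDiffOn.relabel {d : ℕ} {E : Type*} [NormedAddCommGroup E] [NormedSpace ℝ E]
    {ι : Type*} {k : WithTop ℕ∞} {F : ι → RVec d × ℝ → E} {S : Set (RVec d)} {I : Set ℝ}
    (hF : ∀ i, ContDiffOn ℝ k (F i) (S ×ˢ I)) {J : RVec d → ι}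
    (hJ : ∀ ω ∈ S, ∀ᶠ ω' in 𝓝[S] ω, J ω' = J ω) :
    ContDiffOn ℝ k (fun p => F (J p.1) p) (S ×ˢ I) := by
  intro p hp
  have h1 : Filter.Tendsto Prod.fst (𝓝[S ×ˢ I] p) (𝓝[S] p.1) :=
    continuousWithinAt_fst.tendsto_nhdsWithin fun p' hp' => hp'.1
  refine (hF (J p.1) p hp).congr_of_eventuallyEq ?_ rfl
  filter_upwards [h1.eventually (hJ p.1 hp.1)] with p' hp'
  rw [hp']

variable {n d : ℕ} [NeZero d] {W : PeriodicWave n d} {ε δ : ℝ}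
  {lam : Fin (n + 1) → RVec d → ℝ → ℂ} {q qt : Fin (n + 1) → RVec d → ℝ → L2Per n W.X}

/-- Relabelling and rescaling an eigensystem. -/
theorem relabel (h : W.IsEigensystem ε δ lam q qt) {π : RVec d → Equiv.Perm (Fin (n + 1))}
    {c : Fin (n + 1) → RVec d → ℝ → ℂ} (hc : ∀ j ω r, c j ω r ≠ 0)
    (hcs : ∀ j, ContDiffOn ℝ (⊤ : ℕ∞) (fun p : RVec d × ℝ => c j p.1 p.2)
      (Metric.sphere 0 1 ×ˢ Set.Ico 0 ε))
    (hπ : ∀ ω ∈ Metric.sphere (0 : RVec d) 1, ∀ᶠ ω' in 𝓝[Metric.sphere 0 1] ω, π ω' = π ω) :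
    W.IsEigensystem ε δ (fun j ω r => lam (π ω j) ω r) (fun j ω r => c j ω r • q (π ω j) ω r)
      (fun j ω r => (star (c j ω r))⁻¹ • qt (π ω j) ω r) := by
  have hJ (j) (ω) (hω : ω ∈ Metric.sphere (0 : RVec d) 1) :
      ∀ᶠ ω' in 𝓝[Metric.sphere 0 1] ω, π ω' j = π ω j :=
    (hπ ω hω).mono fun ω' h => by rw [h]
  have hc' (j ω r) : (star (c j ω r))⁻¹ ≠ 0 := inv_ne_zero (star_ne_zero.2 (hc j ω r))
  refine ⟨h.ε_pos, h.δ_pos, fun j => ?_, fun j => ?_, fun j => ?_, fun j ω hω r hr => ?_,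
    fun j ω hω r hr => ?_, fun j ω hω r hr => ?_, fun ω hω r hr => ?_, fun ω hω r hr => ?_⟩
  · choose μ hμ hlam using h.smooth_lam
    exact ⟨fun p => μ (π p.1 j) p, ContDiffOn.relabel hμ (hJ j), fun ω hω r hr => hlam _ ω hω r hr⟩
  · exact (hcs j).smul (ContDiffOn.relabel (F := fun i p => q i p.1 p.2) h.smooth_q (hJ j))
  · refine ContDiffOn.smul (ContDiffOn.inv ?_ fun p _ => star_ne_zero.2 (hc j p.1 p.2))
      (ContDiffOn.relabel (F := fun i p => qt i p.1 p.2) h.smooth_qt (hJ j))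
    exact Complex.conjCLE.contDiff.comp_contDiffOn (hcs j)
  · exact (h.right _ ω hω r hr).smul (hc j ω r)
  · exact (h.left _ ω hω r hr).smul (hc' j ω r)
  · rw [inner_smul_left, inner_smul_right, h.normalized _ ω hω r hr, map_inv₀, mul_one,
      ← starRingEnd_apply, Complex.conj_conj, inv_mul_cancel₀ (hc j ω r)]
  · exact (h.distinct ω hω r hr).comp (π ω).injective
  · rw [h.exhaust ω hω r hr]
    exact ((π ω).surjective.range_comp fun j => lam j ω r).symm

/-- Every eigensystem becomes adapted after relabelling and rescaling. -/
theorem exists_adapted (h : W.IsEigensystem ε δ lam q qt) (hD1 : W.D1) {h3 : W.D3} (hH3 : H3 h3) :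
    ∃ (π : RVec d → Equiv.Perm (Fin (n + 1))) (c : Fin (n + 1) → RVec d → ℝ → ℂ),
      (∀ j ω r, c j ω r ≠ 0) ∧
      W.IsEigensystem ε δ (fun j ω r => lam (π ω j) ω r)
        (fun j ω r => c j ω r • q (π ω j) ω r)
        (fun j ω r => (star (c j ω r))⁻¹ • qt (π ω j) ω r) ∧
      W.IsAdapted (fun j ω r => c j ω r • q (π ω j) ω r)
        (fun j ω r => (star (c j ω r))⁻¹ • qt (π ω j) ω r) := by
  classical
  have hex (ω : RVec d) : ∃ j₀, ‖ω‖ = 1 →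
      (∀ j, inner ℂ (qt j ω 0) W.ubarLp ≠ (0 : ℂ) ↔ j = j₀) ∧
        W.ubarLp = (inner ℂ (qt j₀ ω 0) W.ubarLp : ℂ) • q j₀ ω 0 := by
    by_cases hω : ‖ω‖ = 1
    · obtain ⟨j₀, hj₀⟩ := h.exists_index hD1 hH3 hω
      exact ⟨j₀, fun _ => hj₀⟩
    · exact ⟨0, fun h1 => absurd h1 hω⟩
  choose J hJ using hex
  let a (i : Fin (n + 1)) (p : RVec d × ℝ) : ℂ := inner ℂ (qt i p.1 0) W.ubarLp
  have ha (i) : ContDiffOn ℝ (⊤ : ℕ∞) (a i) (Metric.sphere 0 1 ×ˢ Set.Ico 0 ε) := by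
    have h1 : ContDiffOn ℝ (⊤ : ℕ∞) (fun p : RVec d × ℝ => qt i p.1 0)
        (Metric.sphere 0 1 ×ˢ Set.Ico 0 ε) :=
      (h.smooth_qt i).comp (g := fun p : RVec d × ℝ => qt i p.1 p.2)
        (f := fun p : RVec d × ℝ => (p.1, (0 : ℝ))) (by fun_prop)
        fun p hp => ⟨hp.1, le_rfl, h.ε_pos⟩
    exact h1.inner ℂ contDiffOn_const
  -- The index is the only one with `⟪q̃ⱼ(ω,0), ū'⟫ ≠ 0`, an open condition in `ω`, so it is locally
  -- constant on the sphere.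
  have hJc (ω) (hω : ω ∈ Metric.sphere (0 : RVec d) 1) :
      ∀ᶠ ω' in 𝓝[Metric.sphere 0 1] ω, J ω' = J ω := by
    have hω' : ‖ω‖ = 1 := by simpa using hω
    have hcont : ContinuousOn (fun ω' => a (J ω) (ω', 0)) (Metric.sphere 0 1) :=
      (ha (J ω)).continuousOn.comp (f := fun ω' : RVec d => (ω', (0 : ℝ))) (by fun_prop)
        fun ω' hω' => ⟨hω', le_rfl, h.ε_pos⟩
    have h0 : a (J ω) (ω, 0) ≠ 0 := (((hJ ω hω').1 _).2 rfl)
    filter_upwards [(hcont ω hω).eventually_ne h0, self_mem_nhdsWithin] with ω' h1 h2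
    exact (((hJ ω' (by simpa using h2)).1 _).1 h1).symm
  let π (ω : RVec d) : Equiv.Perm (Fin (n + 1)) := Equiv.swap 0 (J ω)
  -- Only the member moved to index `0` is rescaled, by the coefficient of `ū'` along it,
  -- independently of `r`. The value `1` off the sphere keeps `c` nonvanishing everywhere.
  let c (j : Fin (n + 1)) (ω : RVec d) (r : ℝ) : ℂ :=
    if ‖ω‖ = 1 ∧ j = 0 then a (J ω) (ω, r) else 1
  have hc0 {ω : RVec d} (hω : ‖ω‖ = 1) (r) : c 0 ω r = inner ℂ (qt (J ω) ω 0) W.ubarLp :=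
    if_pos ⟨hω, rfl⟩
  have hc1 {j} (hj : j ≠ 0) (ω r) : c j ω r = 1 := if_neg fun h => hj h.2
  have hc (j ω r) : c j ω r ≠ 0 := by
    by_cases hω : ‖ω‖ = 1 ∧ j = 0
    · rw [hω.2, hc0 hω.1]
      exact ((hJ ω hω.1).1 _).2 rfl
    · simp only [c, if_neg hω]
      exact one_ne_zero
  refine ⟨π, c, hc, h.relabel hc (fun j => ?_) fun ω hω => ?_, fun ω hω => ⟨?_, fun j hj => ?_⟩⟩
  · rcases eq_or_ne j 0 with rfl | hj
    · refine (ContDiffOn.relabel ha hJc).congr fun p hp => hc0 ?_ p.2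
      simpa using hp.1
    · exact contDiffOn_const.congr fun p _ => hc1 hj p.1 p.2
  · exact (hJc ω hω).mono fun ω' h => by simp only [π, h]
  · have e : c 0 ω 0 • q (π ω 0) ω 0 = W.ubarLp := by
      rw [hc0 hω, show π ω 0 = J ω from Equiv.swap_apply_left _ _]
      exact (hJ ω hω).2.symm
    beta_reduce
    rw [e]
    exact W.ubarLp_coe
  · have hne : π ω j ≠ J ω := fun h1 => hj <| by
      rw [← (π ω).injective.eq_iff, h1]
      exact (Equiv.swap_apply_left _ _).symm
    obtain ⟨b, hb⟩ := eq_constFun_of_orthogonal hD1 h3 (h.inner_qt_zero_L (π ω j) hω)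
      (not_not.1 (mt ((hJ ω hω).1 _).1 hne))
    refine ⟨b, ?_⟩
    beta_reduce
    rw [hc1 hj, star_one, inv_one, one_smul, hb]
    exact constFun_coe b

end IsEigensystem
end PeriodicWave
end Bloch

end

theorem lemma3p1 {n d : ℕ} [NeZero d] (W : Bloch.PeriodicWave n d)
    (hH2 : W.H2) (hD1 : W.D1) (hD2 : W.D2) (hD3 : W.D3) (hH3 : Bloch.PeriodicWave.H3 hD3) :
    (∃ (ε δ : ℝ) (lam : Fin (n + 1) → Bloch.RVec d → ℝ → ℂ)
      (q qt : Fin (n + 1) → Bloch.RVec d → ℝ → Bloch.L2Per n W.X),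
      W.IsEigensystem ε δ lam q qt ∧ W.IsAdapted q qt) ∧
    ∀ (ε δ : ℝ) (lam : Fin (n + 1) → Bloch.RVec d → ℝ → ℂ)
      (q qt : Fin (n + 1) → Bloch.RVec d → ℝ → Bloch.L2Per n W.X),
      W.IsEigensystem ε δ lam q qt →
      ∃ (π : Bloch.RVec d → Equiv.Perm (Fin (n + 1))) (c : Fin (n + 1) → Bloch.RVec d → ℝ → ℂ),
        (∀ j ω r, c j ω r ≠ 0) ∧
        W.IsEigensystem ε δ
          (fun j ω r => lam (π ω j) ω r)
          (fun j ω r => c j ω r • q (π ω j) ω r)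
          (fun j ω r => (star (c j ω r))⁻¹ • qt (π ω j) ω r) ∧
        W.IsAdapted
          (fun j ω r => c j ω r • q (π ω j) ω r)
          (fun j ω r => (star (c j ω r))⁻¹ • qt (π ω j) ω r) := by
  refine ⟨?_, fun ε δ lam q qt h => h.exists_adapted hD1 hH3⟩
  obtain ⟨ε, δ, lam, q, qt, h⟩ := Bloch.PeriodicWave.exists_eigensystem hD1 hD2 hH3
  obtain ⟨π, c, -, h1, h2⟩ := h.exists_adapted hD1 hH3
  exact ⟨ε, δ, _, _, _, h1, h2⟩
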